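/- Let $b\ge 2$. A sequential fragmentation into $b$ pieces starts from the interval $(0,1)$ and at each time $n=1,2,\dots$ splits the currently largest subinterval (the leftmost one in case of a tie) into $b$ subintervals by $b-1$ division points; the relative positions of these points in the subinterval being split are drawn, independently of the past, from one fixed distribution of $b-1$ almost surely distinct points of $(0,1)$. Let $V_1,\dots,V_b$ be the spacings which such $b-1$ points induce in $(0,1)$, and assume that $F(x)=\mathbb E\,\#\{i: V_i<x\}$ is uniformly continuous and differentiable on $(0,1)$ with $F'(x)>0$ for all $x\in(0,1)$. After $n$ splittings let $F_n$ be the empirical distribution function of the $n(b-1)$ partition points, let $M_n$ be the length of the largest subinterval, and let $$u_n(x)=\frac{\#\{\text{spacings of length}\le x M_n\}}{n(b-1)+1}$$ be the empirical distribution function of the normalized spacings. Then the empirical distribution of the partition points is asymptotically uniform if and only if the spacing distribution is (asymptotically) stationary. That is, each of the following two equivalences holds. (a) Almost surely $F_n(y)\to y$ for all $y\in(0,1)$, if and only if there is a deterministic function $u$ such that almost surely $u_n(x)\to u(x)$ for all $x\in(0,1)$. (b) $F_n(y)\to y$ in probability for every $y\in(0,1)$, if and only if there is a deterministic function $u$ such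 that $u_n(x)\to u(x)$ in probability for every $x\in(0,1)$. -/

import Mathlib

open MeasureTheory ProbabilityTheory Filter Topology

noncomputable section

namespace Fragmentation

/-- The left endpoints of the subintervals into which a finite set `P ⊆ (0,1)` of partition points
divides the unit interval. -/
def leftEnds (P : Finset ℝ) : Finset ℝ := insert 0 P

/-- The right endpoint of the subinterval with left endpoint `p`: the least element greater than
`p` of `P ∪ {1}` (for `p < 1` a minimum over a nonempty finite set). -/
def rightEnd (P : Finset ℝ) (p : ℝ) : ℝ := sInf {q : ℝ | q ∈ insert 1 P ∧ p < q}

/-- The length of the subinterval with left endpoint `p` (a spacing). -/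
def spacing (P : Finset ℝ) (p : ℝ) : ℝ := rightEnd P p - p

/-- The length of the largest subinterval. -/
def maxSpacing (P : Finset ℝ) : ℝ :=
  (leftEnds P).sup' (Finset.insert_nonempty 0 P) (spacing P)

/-- The left endpoint of the largest subinterval (of the leftmost one, in case of a tie). -/
def largestLeftEnd (P : Finset ℝ) : ℝ :=
  sInf {p : ℝ | p ∈ leftEnds P ∧ spacing P p = maxSpacing P}

/-- Split the largest subinterval `(a, a + M)` at the points `a + M * d j`, where the `d j` are
relative division points in `(0,1)`. -/
def split {m : ℕ} (d : Fin m → ℝ) (P : Finset ℝ) : Finset ℝ :=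
  P ∪ Finset.univ.image (fun j => largestLeftEnd P + maxSpacing P * d j)

/-- The partition points after `n` splittings, when the `k`-th splitting (`k = 0, 1, …`) uses the
relative division points `D k`. -/
def partitionPoints {m : ℕ} (D : ℕ → Fin m → ℝ) : ℕ → Finset ℝ
  | 0 => ∅
  | n + 1 => split (D n) (partitionPoints D n)

/-- The empirical distribution function of the partition points after `n` splittings. -/
def pointCDF {m : ℕ} (D : ℕ → Fin m → ℝ) (n : ℕ) (y : ℝ) : ℝ :=
  (((partitionPoints D n).filter (fun p => p ≤ y)).card : ℝ) / ((partitionPoints D n).card : ℝ)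

/-- The empirical distribution function of the spacings after `n` splittings, with the length of
the current largest subinterval as unit of length. -/
def spacingCDF {m : ℕ} (D : ℕ → Fin m → ℝ) (n : ℕ) (x : ℝ) : ℝ :=
  (((leftEnds (partitionPoints D n)).filter
      (fun p => spacing (partitionPoints D n) p
        ≤ x * maxSpacing (partitionPoints D n))).card : ℝ) /
    ((leftEnds (partitionPoints D n)).card : ℝ)

/-- The number `ξ(x)` of spacings shorter than `x` among those which the division points `d`
induce in `(0,1)`. -/
def spacingCount {m : ℕ} (d : Fin m → ℝ) (x : ℝ) : ℕ :=
  ((leftEnds (Finset.univ.image d)).filter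
    (fun p => spacing (Finset.univ.image d) p < x)).card

variable {Ω : Type*} [MeasurableSpace Ω]

/-- The expected count function `F(x) = 𝔼 ξ(x)` of random division points. -/
def expectedCount {m : ℕ} (μ : Measure Ω) (d : Ω → Fin m → ℝ) (x : ℝ) : ℝ :=
  ∫ ω, (spacingCount (d ω) x : ℝ) ∂μ

/-- The data of a sequential fragmentation into `b` pieces: `D k ω` are the `b - 1` relative
division points (distinct, in `(0,1)`, in any order) of the `k`-th splitting; they are drawn
independently from one distribution, whose expected count function `F` is uniformly continuous and
differentiable with positive derivative on `(0,1)`. -/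
structure IsSequentialFragmentation (μ : Measure Ω) (b : ℕ)
    (D : ℕ → Ω → Fin (b - 1) → ℝ) : Prop where
  two_le : 2 ≤ b
  measurable : ∀ k, Measurable (D k)
  indep : iIndepFun D μ
  identDistrib : ∀ k, IdentDistrib (D k) (D 0) μ μ
  mem_Ioo : ∀ᵐ ω ∂μ, ∀ j, D 0 ω j ∈ Set.Ioo (0 : ℝ) 1
  injective : ∀ᵐ ω ∂μ, Function.Injective (D 0 ω)
  uniformContinuousOn : UniformContinuousOn (expectedCount μ (D 0)) (Set.Ioo 0 1)
  differentiableOn : DifferentiableOn ℝ (expectedCount μ (D 0)) (Set.Ioo 0 1)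
  deriv_pos : ∀ x ∈ Set.Ioo (0 : ℝ) 1, 0 < deriv (expectedCount μ (D 0)) x

/-- Almost surely, the empirical distribution of the partition points converges to the uniform
distribution on `(0,1)`. -/
def UniformPointsAS {m : ℕ} (μ : Measure Ω) (D : ℕ → Ω → Fin m → ℝ) : Prop :=
  ∀ᵐ ω ∂μ, ∀ y ∈ Set.Ioo (0 : ℝ) 1,
    Tendsto (fun n => pointCDF (fun k => D k ω) n y) atTop (𝓝 y)

/-- Almost surely, the empirical distribution of the normalized spacings converges (to a
deterministic limit). -/
def StationarySpacingsAS {m : ℕ} (μ : Measure Ω) (D : ℕ → Ω → Fin m → ℝ) : Prop :=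
  ∃ u : ℝ → ℝ, ∀ᵐ ω ∂μ, ∀ x ∈ Set.Ioo (0 : ℝ) 1,
    Tendsto (fun n => spacingCDF (fun k => D k ω) n x) atTop (𝓝 (u x))

/-- In probability, the empirical distribution of the partition points converges to the uniform
distribution on `(0,1)`. -/
def UniformPointsInProb {m : ℕ} (μ : Measure Ω) (D : ℕ → Ω → Fin m → ℝ) : Prop :=
  ∀ y ∈ Set.Ioo (0 : ℝ) 1,
    TendstoInMeasure μ (fun n ω => pointCDF (fun k => D k ω) n y) atTop (fun _ => y)

/-- In probability, the empirical distribution of the normalized spacings converges (to a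
deterministic limit). -/
def StationarySpacingsInProb {m : ℕ} (μ : Measure Ω) (D : ℕ → Ω → Fin m → ℝ) : Prop :=
  ∃ u : ℝ → ℝ, ∀ x ∈ Set.Ioo (0 : ℝ) 1,
    TendstoInMeasure μ (fun n ω => spacingCDF (fun k => D k ω) n x) atTop (fun _ => u x)

end Fragmentation

end

/-! Both sides of both equivalences are true: almost surely the points become uniform and the
normalized spacings converge to `1 - tailLimit lam x / countLimit lam`. Convergence in probability
follows.

The partition is inspected at the times `tau D ε`, when the last interval longer than ε has been
split. For 0 < x < 1 there is a bounded function H with H(r) = r⁻¹ 1_{x < r} for 0 < r ≤ 1 and E ∑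
Vᵢ H(r Vᵢ) = H(r) for r > 1 (`exists_harmonic`). Splitting an interval longer than ε then preserves
in mean the sum of s H(s/ε) over the intervals of length s to the left of a fixed endpoint p. At
time `tau D ε` this sum is ε times the number of intervals left of p that are longer than xε.

With r = exp t, harmonicity is the renewal equation for the size-biased law of -log V. Since F' > 0,
Lebesgue measure on (0, ∞) is absolutely continuous with respect to this law, and bounded solutions
converge (`renewal_tendsto`). So H tends to `tailLimit lam x` at infinity, and at the earlier time
`tau D δ`, with δ much larger than ε, the sum is close to p times this limit. In between, its change
is a sum of orthogonal martingale differences of variance O(δ), because ∑ s² loses on average a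
fixed proportion of the square of each length that is split (`integral_sum_sq`,
`sum_integral_maxLen_sq_le`). Along a summable grid of δ, with ε = δ², this gives `ae_tendsto_tail`.

Letting x tend to 0 yields the number of all intervals left of p (`ae_tendsto_count`); the strong
law of large numbers bounds the short intervals that the truncation omits. Taking quotients, the
fraction of intervals left of p tends to p, and the fraction longer than xε to `tailLimit lam x /
countLimit lam`. Consecutive thresholds have ratio tending to one, so monotonicity extends these
limits to all numbers of splittings (`tendsto_left_fraction`, `tendsto_spacing_fraction`). -/

noncomputable section

namespace Fragmentation

/-! ### Deterministic facts about partitions -/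

/-- All points of `P` lie in `(0,1)`. -/
def IsPartition (P : Finset ℝ) : Prop := ∀ p ∈ P, p ∈ Set.Ioo (0 : ℝ) 1

theorem isLeast_rightEnd (P : Finset ℝ) {p : ℝ} (hp : p < 1) :
    IsLeast {q : ℝ | q ∈ insert 1 P ∧ p < q} (rightEnd P p) := by
  have hfin : {q : ℝ | q ∈ insert 1 P ∧ p < q}.Finite :=
    (insert 1 P).finite_toSet.subset fun q hq => hq.1
  have hne : {q : ℝ | q ∈ insert 1 P ∧ p < q}.Nonempty := ⟨1, by simp, hp⟩
  exact ⟨hne.csInf_mem hfin, fun q hq => csInf_le hfin.bddBelow hq⟩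

theorem lt_rightEnd (P : Finset ℝ) {p : ℝ} (hp : p < 1) : p < rightEnd P p :=
  (isLeast_rightEnd P hp).1.2

theorem rightEnd_mem (P : Finset ℝ) {p : ℝ} (hp : p < 1) : rightEnd P p ∈ insert 1 P :=
  (isLeast_rightEnd P hp).1.1

theorem rightEnd_le (P : Finset ℝ) {p q : ℝ} (hp : p < 1) (hq : q ∈ insert 1 P) (h : p < q) :
    rightEnd P p ≤ q :=
  (isLeast_rightEnd P hp).2 ⟨hq, h⟩

theorem rightEnd_eq (P : Finset ℝ) {p r : ℝ} (hr : r ∈ insert 1 P) (h : p < r)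
    (hmin : ∀ q ∈ insert 1 P, p < q → r ≤ q) : rightEnd P p = r :=
  IsLeast.csInf_eq ⟨⟨hr, h⟩, fun q hq => hmin q hq.1 hq.2⟩

theorem spacing_pos (P : Finset ℝ) {p : ℝ} (hp : p < 1) : 0 < spacing P p :=
  sub_pos.2 (lt_rightEnd P hp)

theorem IsPartition.leftEnds_mem {P : Finset ℝ} (hP : IsPartition P) {p : ℝ}
    (hp : p ∈ leftEnds P) : 0 ≤ p ∧ p < 1 := by
  rcases Finset.mem_insert.1 hp with rfl | h
  · exact ⟨le_rfl, one_pos⟩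
  · exact ⟨(hP p h).1.le, (hP p h).2⟩

theorem zero_mem_leftEnds (P : Finset ℝ) : (0 : ℝ) ∈ leftEnds P := Finset.mem_insert_self _ _

/-- The intervals to the left of an end point have total length equal to this end point. -/
theorem IsPartition.sum_spacing_lt {P : Finset ℝ} (hP : IsPartition P) {p : ℝ}
    (hp : p ∈ insert 1 (leftEnds P)) :
    ∑ q ∈ (leftEnds P).filter (· < p), spacing P q = p := by
  induction hn : ((leftEnds P).filter (· < p)).card using Nat.strong_induction_on generalizing p with
  | _ n ih =>
  have hp01 : 0 ≤ p ∧ p ≤ 1 := by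
    rcases Finset.mem_insert.1 hp with rfl | h
    · simp
    · exact ⟨(hP.leftEnds_mem h).1, (hP.leftEnds_mem h).2.le⟩
  rcases hp01.1.eq_or_lt with rfl | hpos
  · rw [Finset.filter_false_of_mem, Finset.sum_empty]
    intro x hx
    exact not_lt.2 (hP.leftEnds_mem hx).1
  have hne : ((leftEnds P).filter (· < p)).Nonempty :=
    ⟨0, Finset.mem_filter.2 ⟨zero_mem_leftEnds P, hpos⟩⟩
  -- The last left endpoint before `p` has `p` as its right end; removing its interval leaves the
  -- same statement for `q`.
  obtain ⟨q, hq, hmax⟩ := Finset.exists_max_image _ (fun x : ℝ => x) hne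
  obtain ⟨hqP, hqp⟩ := Finset.mem_filter.1 hq
  have hset : (leftEnds P).filter (· < p) = insert q ((leftEnds P).filter (· < q)) := by
    ext x
    simp only [Finset.mem_filter, Finset.mem_insert]
    constructor
    · rintro ⟨hx, hxp⟩
      rcases (hmax x (Finset.mem_filter.2 ⟨hx, hxp⟩)).eq_or_lt with h | h
      · exact Or.inl h
      · exact Or.inr ⟨hx, h⟩
    · rintro (rfl | ⟨hx, hxq⟩)
      · exact ⟨hqP, hqp⟩
      · exact ⟨hx, hxq.trans hqp⟩
  have hnot : q ∉ (leftEnds P).filter (· < q) := by simp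
  have hre : rightEnd P q = p := by
    refine rightEnd_eq P ?_ hqp ?_
    · rcases Finset.mem_insert.1 hp with rfl | h
      · simp
      · rcases Finset.mem_insert.1 h with rfl | h
        · exact absurd hpos (lt_irrefl _)
        · exact Finset.mem_insert_of_mem h
    · intro r hr hqr
      by_contra hlt
      push Not at hlt
      have hrP : r ∈ leftEnds P := by
        rcases Finset.mem_insert.1 hr with rfl | h
        · exact absurd (hlt.trans_le hp01.2) (lt_irrefl _)
        · exact Finset.mem_insert_of_mem h
      exact absurd (hmax r (Finset.mem_filter.2 ⟨hrP, hlt⟩)) (not_le.2 hqr)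
  rw [hset, Finset.sum_insert hnot, ih _ ?_ (Finset.mem_insert_of_mem hqP) rfl, spacing, hre]
  · ring
  · rw [← hn, hset, Finset.card_insert_of_notMem hnot]; exact Nat.lt_succ_self _

theorem IsPartition.sum_spacing {P : Finset ℝ} (hP : IsPartition P) :
    ∑ q ∈ leftEnds P, spacing P q = 1 := by
  rw [← hP.sum_spacing_lt (Finset.mem_insert_self 1 _), Finset.filter_true_of_mem]
  exact fun x hx => (hP.leftEnds_mem hx).2

theorem spacing_le_maxSpacing (P : Finset ℝ) {p : ℝ} (hp : p ∈ leftEnds P) :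
    spacing P p ≤ maxSpacing P := Finset.le_sup' (spacing P) hp

theorem largestLeftEnd_spec (P : Finset ℝ) :
    largestLeftEnd P ∈ leftEnds P ∧ spacing P (largestLeftEnd P) = maxSpacing P := by
  have hfin : {p : ℝ | p ∈ leftEnds P ∧ spacing P p = maxSpacing P}.Finite :=
    (leftEnds P).finite_toSet.subset fun q hq => hq.1
  obtain ⟨p, hp, h⟩ := Finset.exists_mem_eq_sup' (Finset.insert_nonempty 0 P) (spacing P)
  have hne : {p : ℝ | p ∈ leftEnds P ∧ spacing P p = maxSpacing P}.Nonempty := ⟨p, hp, h.symm⟩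
  exact hne.csInf_mem hfin

theorem largestLeftEnd_le (P : Finset ℝ) {p : ℝ} (hp : p ∈ leftEnds P)
    (h : spacing P p = maxSpacing P) : largestLeftEnd P ≤ p := by
  have hfin : {p : ℝ | p ∈ leftEnds P ∧ spacing P p = maxSpacing P}.Finite :=
    (leftEnds P).finite_toSet.subset fun q hq => hq.1
  exact csInf_le hfin.bddBelow ⟨hp, h⟩

theorem IsPartition.maxSpacing_pos {P : Finset ℝ} (hP : IsPartition P) : 0 < maxSpacing P := by
  rw [← (largestLeftEnd_spec P).2]
  exact spacing_pos P (hP.leftEnds_mem (largestLeftEnd_spec P).1).2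

theorem rightEnd_largestLeftEnd (P : Finset ℝ) :
    rightEnd P (largestLeftEnd P) = largestLeftEnd P + maxSpacing P := by
  rw [← (largestLeftEnd_spec P).2, spacing]; ring

/-! ### Division points and the pieces they induce -/

/-- Families of `m` distinct points of `(0,1)`. -/
abbrev Divisions (m : ℕ) : Type :=
  {d : Fin m → ℝ // (∀ j, d j ∈ Set.Ioo (0 : ℝ) 1) ∧ Function.Injective d}

variable {m : ℕ}

/-- The left endpoints of the pieces induced by division points. -/
def pieceLeft (d : Divisions m) : Option (Fin m) → ℝ
  | none => 0
  | some j => d.1 j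

/-- The lengths of the pieces induced by division points. -/
def pieceLen (d : Divisions m) (i : Option (Fin m)) : ℝ :=
  spacing (Finset.univ.image d.1) (pieceLeft d i)

theorem isPartition_image (d : Divisions m) : IsPartition (Finset.univ.image d.1) := by
  intro p hp
  obtain ⟨j, -, rfl⟩ := Finset.mem_image.1 hp
  exact d.2.1 j

theorem pieceLeft_mem (d : Divisions m) (i : Option (Fin m)) :
    pieceLeft d i ∈ leftEnds (Finset.univ.image d.1) := by
  cases i with
  | none => exact zero_mem_leftEnds _
  | some j => exact Finset.mem_insert_of_mem (Finset.mem_image_of_mem _ (Finset.mem_univ j))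

theorem pieceLeft_nonneg (d : Divisions m) (i : Option (Fin m)) : 0 ≤ pieceLeft d i :=
  ((isPartition_image d).leftEnds_mem (pieceLeft_mem d i)).1

theorem pieceLeft_lt_one (d : Divisions m) (i : Option (Fin m)) : pieceLeft d i < 1 :=
  ((isPartition_image d).leftEnds_mem (pieceLeft_mem d i)).2

theorem sum_leftEnds_image (d : Divisions m) {β : Type*} [AddCommMonoid β] (f : ℝ → β) :
    ∑ p ∈ leftEnds (Finset.univ.image d.1), f p = ∑ i, f (pieceLeft d i) := by
  rw [leftEnds, Finset.sum_insert, Finset.sum_image, Fintype.sum_option]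
  · rfl
  · exact fun a _ b _ h => d.2.2 h
  · intro h
    obtain ⟨j, -, hj⟩ := Finset.mem_image.1 h
    exact (d.2.1 j).1.ne' hj

theorem sum_pieceLen (d : Divisions m) : ∑ i, pieceLen d i = 1 := by
  rw [← (isPartition_image d).sum_spacing, sum_leftEnds_image]; rfl

theorem pieceLen_pos (d : Divisions m) (i : Option (Fin m)) : 0 < pieceLen d i :=
  spacing_pos _ (pieceLeft_lt_one d i)

theorem pieceLen_le_one (d : Divisions m) (i : Option (Fin m)) : pieceLen d i ≤ 1 := by
  rw [← sum_pieceLen d]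
  exact Finset.single_le_sum (fun j _ => (pieceLen_pos d j).le) (Finset.mem_univ i)

theorem pieceLen_lt_one (hm : 0 < m) (d : Divisions m) (i : Option (Fin m)) :
    pieceLen d i < 1 := by
  have : Nontrivial (Option (Fin m)) := ⟨none, some ⟨0, hm⟩, by simp⟩
  obtain ⟨k, hk⟩ := exists_ne i
  have := Finset.add_le_sum (fun j _ => (pieceLen_pos d j).le) (Finset.mem_univ i)
    (Finset.mem_univ k) hk.symm
  rw [sum_pieceLen d] at this
  linarith [pieceLen_pos d k]

/-! ### Splitting the largest interval -/

theorem IsPartition.largest_nonneg {P : Finset ℝ} (hP : IsPartition P) : 0 ≤ largestLeftEnd P :=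
  (hP.leftEnds_mem (largestLeftEnd_spec P).1).1

theorem IsPartition.largest_lt_one {P : Finset ℝ} (hP : IsPartition P) : largestLeftEnd P < 1 :=
  (hP.leftEnds_mem (largestLeftEnd_spec P).1).2

theorem IsPartition.largest_add_le {P : Finset ℝ} (hP : IsPartition P) {q : ℝ}
    (hq : q ∈ insert 1 P) (h : largestLeftEnd P < q) :
    largestLeftEnd P + maxSpacing P ≤ q := by
  rw [← rightEnd_largestLeftEnd]
  exact rightEnd_le P hP.largest_lt_one hq h

theorem IsPartition.split {P : Finset ℝ} (hP : IsPartition P) (d : Divisions m) :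
    IsPartition (split d.1 P) := by
  intro p hp
  rcases Finset.mem_union.1 hp with h | h
  · exact hP p h
  · obtain ⟨j, -, rfl⟩ := Finset.mem_image.1 h
    have h1 := hP.largest_add_le (Finset.mem_insert_self 1 P) hP.largest_lt_one
    have h2 := hP.largest_nonneg
    have h3 := hP.maxSpacing_pos
    obtain ⟨h4, h5⟩ := d.2.1 j
    exact ⟨by positivity, by nlinarith⟩

/-- Additive functionals of the spacings change by the contribution of the interval that is split. -/
theorem IsPartition.sum_split {P : Finset ℝ} (hP : IsPartition P) (d : Divisions m)
    (φ : ℝ → ℝ → ℝ) :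
    ∑ p ∈ leftEnds (Fragmentation.split d.1 P), φ p (spacing (Fragmentation.split d.1 P) p) =
      ∑ p ∈ leftEnds P, φ p (spacing P p) - φ (largestLeftEnd P) (maxSpacing P) +
        ∑ i, φ (largestLeftEnd P + maxSpacing P * pieceLeft d i)
          (maxSpacing P * pieceLen d i) := by
  set a := largestLeftEnd P with ha
  set M := maxSpacing P with hM
  set Q := Fragmentation.split d.1 P with hQ
  have hMpos : 0 < M := hP.maxSpacing_pos
  have haL : a ∈ leftEnds P := (largestLeftEnd_spec P).1
  have ha1 : a < 1 := hP.largest_lt_one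
  have hQP := hP.split d
  have hmemQ : ∀ r, r ∈ insert 1 Q ↔ r ∈ insert 1 P ∨ ∃ j, a + M * d.1 j = r := by
    intro r
    simp [hQ, Fragmentation.split, ha, hM, or_assoc]
  have hgap : ∀ r ∈ insert 1 P, a < r → a + M ≤ r := fun r hr h => hP.largest_add_le hr h
  have hnew : ∀ j, a < a + M * d.1 j ∧ a + M * d.1 j < a + M := by
    intro j
    obtain ⟨h1, h2⟩ := d.2.1 j
    exact ⟨by nlinarith, by nlinarith⟩
  have haM : a + M ∈ insert 1 P := by
    rw [← rightEnd_largestLeftEnd]; exact rightEnd_mem P ha1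
  -- old intervals
  have hold : ∀ p ∈ leftEnds P, p ≠ a → spacing Q p = spacing P p := by
    intro p hp hpa
    have hp1 := (hP.leftEnds_mem hp).2
    have : rightEnd Q p = rightEnd P p := by
      refine rightEnd_eq Q ((hmemQ _).2 (Or.inl (rightEnd_mem P hp1))) (lt_rightEnd P hp1) ?_
      intro q hq hpq
      rcases (hmemQ q).1 hq with h | ⟨j, rfl⟩
      · exact rightEnd_le P hp1 h hpq
      · rcases lt_or_gt_of_ne hpa with h | h
        · have haP : a ∈ insert 1 P := by
            rcases Finset.mem_insert.1 haL with h0 | h0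
            · exact absurd (hP.leftEnds_mem hp).1 (not_le.2 (h0 ▸ h))
            · exact Finset.mem_insert_of_mem h0
          exact (rightEnd_le P hp1 haP h).trans (hnew j).1.le
        · have hpP : p ∈ insert 1 P := by
            rcases Finset.mem_insert.1 hp with h0 | h0
            · exact absurd hP.largest_nonneg (not_le.2 (h0 ▸ h))
            · exact Finset.mem_insert_of_mem h0
          linarith [hgap p hpP h, (hnew j).2]
    rw [spacing, spacing, this]
  -- pieces
  have hpiece : ∀ i, spacing Q (a + M * pieceLeft d i) = M * pieceLen d i := by
    intro i
    have hl1 := pieceLeft_lt_one d i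
    have hl0 := pieceLeft_nonneg d i
    set D := Finset.univ.image d.1 with hD
    have hr := isLeast_rightEnd D hl1
    set r := rightEnd D (pieceLeft d i) with hrdef
    have hr1 : r ≤ 1 := rightEnd_le D hl1 (Finset.mem_insert_self _ _) hl1
    have : rightEnd Q (a + M * pieceLeft d i) = a + M * r := by
      refine rightEnd_eq Q ?_ ?_ ?_
      · rcases Finset.mem_insert.1 hr.1.1 with h | h
        · rw [h, mul_one]; exact (hmemQ _).2 (Or.inl haM)
        · obtain ⟨j, -, hj⟩ := Finset.mem_image.1 h
          exact (hmemQ _).2 (Or.inr ⟨j, by rw [hj]⟩)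
      · have := hr.1.2
        nlinarith
      · intro q hq hlt
        rcases (hmemQ q).1 hq with h | ⟨j, rfl⟩
        · have : a + M ≤ q := hgap q h (by nlinarith)
          nlinarith
        · have h1 : pieceLeft d i < d.1 j := by
            by_contra hcon
            push Not at hcon
            nlinarith
          have : r ≤ d.1 j := hr.2 ⟨Finset.mem_insert_of_mem
            (Finset.mem_image_of_mem _ (Finset.mem_univ j)), h1⟩
          nlinarith
    rw [spacing, this, pieceLen, spacing, ← hrdef]
    ring
  have hleft : leftEnds Q = leftEnds P ∪ Finset.univ.image (fun j => a + M * d.1 j) := by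
    simp [hQ, leftEnds, Fragmentation.split, ha, hM, Finset.insert_union]
  have hdisj : Disjoint (leftEnds P) (Finset.univ.image (fun j => a + M * d.1 j)) := by
    rw [Finset.disjoint_left]
    intro p hp hp'
    obtain ⟨j, -, rfl⟩ := Finset.mem_image.1 hp'
    rcases Finset.mem_insert.1 hp with h | h
    · linarith [hP.largest_nonneg, (hnew j).1]
    · linarith [hgap _ (Finset.mem_insert_of_mem h) (hnew j).1, (hnew j).2]
  have hinj : Set.InjOn (fun j => a + M * d.1 j) (Finset.univ : Finset (Fin m)) := by
    intro i _ j _ h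
    have : M * d.1 i = M * d.1 j := by simpa using h
    exact d.2.2 (mul_left_cancel₀ hMpos.ne' this)
  rw [hleft, Finset.sum_union hdisj, Finset.sum_image hinj, Fintype.sum_option,
    ← Finset.add_sum_erase _ _ haL, ← Finset.add_sum_erase (leftEnds P) _ haL]
  have e1 : ∑ p ∈ (leftEnds P).erase a, φ p (spacing Q p) =
      ∑ p ∈ (leftEnds P).erase a, φ p (spacing P p) := by
    refine Finset.sum_congr rfl fun p hp => ?_
    rw [hold p (Finset.mem_of_mem_erase hp) (Finset.ne_of_mem_erase hp)]
  have e2 : spacing P a = M := (largestLeftEnd_spec P).2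
  have e3 : spacing Q a = M * pieceLen d none := by
    have := hpiece none
    simpa [pieceLeft] using this
  have e4 : ∀ j, spacing Q (a + M * d.1 j) = M * pieceLen d (some j) := fun j => hpiece (some j)
  rw [e1, e2, e3]
  simp only [e4, pieceLeft, mul_zero, add_zero]
  ring

/-! ### The fragmentation driven by a sequence of division points -/

/-- The partition after `n` splittings. -/
def part (D : ℕ → Divisions m) (n : ℕ) : Finset ℝ := partitionPoints (fun k => (D k).1) n

/-- The length of the largest interval after `n` splittings. -/
def maxLen (D : ℕ → Divisions m) (n : ℕ) : ℝ := maxSpacing (part D n)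

/-- The left endpoint of the interval that is split next after `n` splittings. -/
def maxLeft (D : ℕ → Divisions m) (n : ℕ) : ℝ := largestLeftEnd (part D n)

/-- The sum of `φ` over all intervals, given by left endpoint and length, after `n` splittings. -/
def intervalSum (D : ℕ → Divisions m) (n : ℕ) (φ : ℝ → ℝ → ℝ) : ℝ :=
  ∑ p ∈ leftEnds (part D n), φ p (spacing (part D n) p)

theorem isPartition_part (D : ℕ → Divisions m) (n : ℕ) : IsPartition (part D n) := by
  induction n with
  | zero => simp [part, partitionPoints, IsPartition]
  | succ n ih => exact ih.split (D n)

theorem part_mono (D : ℕ → Divisions m) : Monotone (part D) :=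
  monotone_nat_of_le_succ fun _ => Finset.subset_union_left

theorem leftEnds_part_mono (D : ℕ → Divisions m) {k n : ℕ} (h : k ≤ n) :
    leftEnds (part D k) ⊆ leftEnds (part D n) :=
  Finset.insert_subset_insert _ (part_mono D h)

theorem maxLen_pos (D : ℕ → Divisions m) (n : ℕ) : 0 < maxLen D n :=
  (isPartition_part D n).maxSpacing_pos

theorem intervalSum_zero (D : ℕ → Divisions m) (φ : ℝ → ℝ → ℝ) :
    intervalSum D 0 φ = φ 0 1 := by
  have : rightEnd ∅ 0 = 1 := rightEnd_eq ∅ (by simp) one_pos (by simp)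
  simp [intervalSum, part, partitionPoints, leftEnds, spacing, this]

theorem intervalSum_succ (D : ℕ → Divisions m) (n : ℕ) (φ : ℝ → ℝ → ℝ) :
    intervalSum D (n + 1) φ = intervalSum D n φ - φ (maxLeft D n) (maxLen D n) +
      ∑ i, φ (maxLeft D n + maxLen D n * pieceLeft (D n) i) (maxLen D n * pieceLen (D n) i) :=
  (isPartition_part D n).sum_split (D n) φ

theorem intervalSum_add (D : ℕ → Divisions m) (n : ℕ) (φ ψ : ℝ → ℝ → ℝ) :
    intervalSum D n (fun p s => φ p s + ψ p s) = intervalSum D n φ + intervalSum D n ψ :=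
  Finset.sum_add_distrib

theorem intervalSum_mul (D : ℕ → Divisions m) (n : ℕ) (c : ℝ) (φ : ℝ → ℝ → ℝ) :
    intervalSum D n (fun p s => c * φ p s) = c * intervalSum D n φ :=
  (Finset.mul_sum _ _ _).symm

/-- Comparison of sums over intervals; the hypothesis may use all bounds known for intervals. -/
theorem intervalSum_le (D : ℕ → Divisions m) (n : ℕ) {φ ψ : ℝ → ℝ → ℝ}
    (h : ∀ p s, 0 ≤ p → p < 1 → 0 < s → s ≤ maxLen D n → φ p s ≤ ψ p s) :
    intervalSum D n φ ≤ intervalSum D n ψ :=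
  Finset.sum_le_sum fun p hp =>
    have hp' := (isPartition_part D n).leftEnds_mem hp
    h p _ hp'.1 hp'.2 (spacing_pos _ hp'.2) (spacing_le_maxSpacing _ hp)

theorem intervalSum_congr (D : ℕ → Divisions m) (n : ℕ) {φ ψ : ℝ → ℝ → ℝ}
    (h : ∀ p s, 0 ≤ p → p < 1 → 0 < s → s ≤ maxLen D n → φ p s = ψ p s) :
    intervalSum D n φ = intervalSum D n ψ :=
  (intervalSum_le D n fun p s h1 h2 h3 h4 => (h p s h1 h2 h3 h4).le).antisymm
    (intervalSum_le D n fun p s h1 h2 h3 h4 => (h p s h1 h2 h3 h4).ge)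

theorem intervalSum_spacing (D : ℕ → Divisions m) (n : ℕ) :
    intervalSum D n (fun _ s => s) = 1 := (isPartition_part D n).sum_spacing

theorem intervalSum_spacing_lt (D : ℕ → Divisions m) (n : ℕ) {p : ℝ}
    (hp : p ∈ insert 1 (leftEnds (part D n))) :
    intervalSum D n (fun q s => if q < p then s else 0) = p := by
  rw [intervalSum, ← Finset.sum_filter]
  exact (isPartition_part D n).sum_spacing_lt hp

theorem intervalSum_one (D : ℕ → Divisions m) (n : ℕ) :
    intervalSum D n (fun _ _ => 1) = n * m + 1 := by
  induction n with
  | zero => simp [intervalSum_zero]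
  | succ n ih =>
    rw [intervalSum_succ, ih]
    simp
    ring

/-- The number of intervals longer than `maxLen D n` is zero at time `n`, and pieces of a split
interval are not longer than it, so the number is still zero one step later. -/
theorem maxLen_succ_le (D : ℕ → Divisions m) (n : ℕ) : maxLen D (n + 1) ≤ maxLen D n := by
  have h0 : intervalSum D (n + 1) (fun _ s => if maxLen D n < s then 1 else 0) ≤ 0 := by
    rw [intervalSum_succ]
    have h1 : intervalSum D n (fun _ s => if maxLen D n < s then 1 else 0) ≤
        intervalSum D n (fun _ _ => 0) :=
      intervalSum_le D n fun p s _ _ _ hs => by rw [if_neg (not_lt.2 hs)]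
    have h2 : intervalSum D n (fun _ _ => 0) = 0 := by simp [intervalSum]
    have h3 : ∀ i, ¬ maxLen D n < maxLen D n * pieceLen (D n) i := fun i =>
      not_lt.2 (mul_le_of_le_one_right (maxLen_pos D n).le (pieceLen_le_one _ _))
    simp only [h3, if_false, Finset.sum_const_zero, lt_irrefl]
    linarith
  by_contra hlt
  push Not at hlt
  have := largestLeftEnd_spec (part D (n + 1))
  have h4 : (1 : ℝ) ≤ intervalSum D (n + 1) (fun _ s => if maxLen D n < s then 1 else 0) := by
    refine le_trans (le_of_eq ?_) (Finset.single_le_sum (f := fun p =>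
      (if maxLen D n < spacing (part D (n + 1)) p then (1 : ℝ) else 0)) ?_ this.1)
    · rw [if_pos]
      rw [this.2]; exact hlt
    · intro p _; split_ifs <;> simp
  linarith

theorem maxLen_antitone (D : ℕ → Divisions m) : Antitone (maxLen D) :=
  antitone_nat_of_succ_le (maxLen_succ_le D)

theorem maxLen_zero (D : ℕ → Divisions m) : maxLen D 0 = 1 := by
  have h := intervalSum_zero D (fun _ s => s)
  have : rightEnd ∅ 0 = 1 := rightEnd_eq ∅ (by simp) one_pos (by simp)
  simp [maxLen, maxSpacing, part, partitionPoints, leftEnds, spacing, this]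

theorem maxLen_le_one (D : ℕ → Divisions m) (n : ℕ) : maxLen D n ≤ 1 :=
  (maxLen_antitone D (Nat.zero_le n)).trans_eq (maxLen_zero D)

theorem maxLeft_nonneg (D : ℕ → Divisions m) (n : ℕ) : 0 ≤ maxLeft D n :=
  (isPartition_part D n).largest_nonneg

/-- Splitting respects the endpoints of earlier intervals. -/
theorem maxLeft_add_lt_iff (D : ℕ → Divisions m) (n : ℕ) {p : ℝ}
    (hp : p ∈ insert 1 (leftEnds (part D n))) (i : Option (Fin m)) :
    maxLeft D n + maxLen D n * pieceLeft (D n) i < p ↔ maxLeft D n < p := by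
  have h0 := pieceLeft_nonneg (D n) i
  have h1 := pieceLeft_lt_one (D n) i
  have hM := maxLen_pos D n
  constructor
  · intro h
    have : 0 ≤ maxLen D n * pieceLeft (D n) i := by positivity
    linarith
  · intro h
    have hp' : p ∈ insert 1 (part D n) := by
      rcases Finset.mem_insert.1 hp with h' | h'
      · exact h' ▸ Finset.mem_insert_self _ _
      rcases Finset.mem_insert.1 h' with h' | h'
      · exact absurd (maxLeft_nonneg D n) (not_le.2 (h' ▸ h))
      · exact Finset.mem_insert_of_mem h'
    have : maxLeft D n + maxLen D n ≤ p := (isPartition_part D n).largest_add_le hp' h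
    nlinarith

/-- This is adaptedness: through `part_update`, the `n`-th family of division points can be
resampled without affecting which interval it splits. -/
theorem part_congr {D D' : ℕ → Divisions m} {n : ℕ} (h : ∀ k < n, D k = D' k) :
    part D n = part D' n := by
  induction n with
  | zero => rfl
  | succ n ih =>
    have h1 := ih fun k hk => h k (hk.trans (Nat.lt_succ_self n))
    simp only [part, partitionPoints] at h1 ⊢
    rw [h1, h n (Nat.lt_succ_self n)]

/-! ### Measurability -/

theorem measurable_pieceLeft (i : Option (Fin m)) :
    Measurable fun d : Divisions m => pieceLeft d i := by
  cases i with
  | none => exact measurable_const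
  | some j => exact (measurable_pi_apply j).comp measurable_subtype_coe

/-- A minimum over a fixed finite index set is visibly measurable; candidates that do not lie to the
right are replaced by 1. -/
theorem rightEnd_pieceLeft (d : Divisions m) (i : Option (Fin m)) :
    rightEnd (Finset.univ.image d.1) (pieceLeft d i) =
      (Finset.univ : Finset (Option (Fin m))).inf' Finset.univ_nonempty
        (fun k => if pieceLeft d i < pieceLeft d k then pieceLeft d k else 1) := by
  have hl1 := pieceLeft_lt_one d i
  have hl0 := pieceLeft_nonneg d i
  refine rightEnd_eq _ ?_ ?_ ?_
  · obtain ⟨k, -, hk⟩ := Finset.exists_mem_eq_inf' (Finset.univ_nonempty (α := Option (Fin m)))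
      (fun k => if pieceLeft d i < pieceLeft d k then pieceLeft d k else 1)
    rw [hk]
    split_ifs with h
    · cases k with
      | none => exact absurd h (not_lt.2 hl0)
      | some j =>
        exact Finset.mem_insert_of_mem (Finset.mem_image_of_mem _ (Finset.mem_univ j))
    · exact Finset.mem_insert_self _ _
  · rw [Finset.lt_inf'_iff]
    intro k _
    split_ifs with h
    · exact h
    · exact hl1
  · intro q hq hlt
    rcases Finset.mem_insert.1 hq with rfl | hq
    · refine (Finset.inf'_le _ (Finset.mem_univ none)).trans ?_
      rw [if_neg (not_lt.2 (show pieceLeft d none ≤ pieceLeft d i from hl0))]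
    · obtain ⟨j, -, rfl⟩ := Finset.mem_image.1 hq
      refine (Finset.inf'_le _ (Finset.mem_univ (some j))).trans ?_
      rw [if_pos]
      · rfl
      · exact hlt

theorem measurable_pieceLen (i : Option (Fin m)) :
    Measurable fun d : Divisions m => pieceLen d i := by
  refine Measurable.sub ?_ (measurable_pieceLeft i)
  have h1 : ∀ k : Option (Fin m), Measurable fun d : Divisions m =>
      -if pieceLeft d i < pieceLeft d k then pieceLeft d k else (1 : ℝ) := fun k =>
    (Measurable.ite (measurableSet_lt (measurable_pieceLeft i) (measurable_pieceLeft k))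
      (measurable_pieceLeft k) measurable_const).neg
  have h2 := (Finset.measurable_sup' (Finset.univ_nonempty (α := Option (Fin m)))
    (fun k _ => h1 k)).neg
  have h3 : (fun d : Divisions m => rightEnd (Finset.univ.image d.1) (pieceLeft d i)) =
      -Finset.univ.sup' (Finset.univ_nonempty (α := Option (Fin m))) (fun k (d : Divisions m) =>
        -if pieceLeft d i < pieceLeft d k then pieceLeft d k else (1 : ℝ)) := by
    funext d
    rw [rightEnd_pieceLeft, Pi.neg_apply, Finset.sup'_apply]
    refine le_antisymm ?_ ?_
    · obtain ⟨k, hk, h⟩ := Finset.exists_mem_eq_sup' (Finset.univ_nonempty (α := Option (Fin m)))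
        (fun k => -(if pieceLeft d i < pieceLeft d k then pieceLeft d k else (1 : ℝ)))
      rw [h, neg_neg]
      exact Finset.inf'_le _ hk
    · refine Finset.le_inf' _ _ fun k hk => ?_
      have := Finset.le_sup' (fun k => -(if pieceLeft d i < pieceLeft d k then pieceLeft d k
        else (1 : ℝ))) hk
      linarith
  rw [h3]
  exact h2

/-- Measurability of the largest length is reduced to that of counts, which obey the recursion
`intervalSum_succ`. -/
theorem maxLen_le_iff (D : ℕ → Divisions m) (n : ℕ) (c : ℝ) :
    maxLen D n ≤ c ↔ intervalSum D n (fun _ s => if c < s then 1 else 0) ≤ 0 := by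
  constructor
  · intro h
    refine (intervalSum_le D n (ψ := fun _ _ => 0) fun p s _ _ _ hs => ?_).trans_eq ?_
    · rw [if_neg (not_lt.2 (hs.trans h))]
    · simp [intervalSum]
  · intro h
    by_contra hlt
    push Not at hlt
    obtain ⟨h1, h2⟩ := largestLeftEnd_spec (part D n)
    have h4 : (1 : ℝ) ≤ intervalSum D n (fun _ s => if c < s then 1 else 0) := by
      refine le_trans (le_of_eq ?_) (Finset.single_le_sum (f := fun p =>
        (if c < spacing (part D n) p then (1 : ℝ) else 0)) ?_ h1)
      · rw [if_pos]
        rw [h2]; exact hlt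
      · intro p _; split_ifs <;> simp
    linarith

theorem maxLeft_lt_iff (D : ℕ → Divisions m) (n : ℕ) (c : ℝ) :
    maxLeft D n < c ↔
      0 < intervalSum D n (fun p s => if p < c ∧ s = maxLen D n then 1 else 0) := by
  obtain ⟨h1, h2⟩ := largestLeftEnd_spec (part D n)
  constructor
  · intro h
    refine lt_of_lt_of_le one_pos (le_trans (le_of_eq ?_) (Finset.single_le_sum (f := fun p =>
      (if p < c ∧ spacing (part D n) p = maxLen D n then (1 : ℝ) else 0)) ?_ h1))
    · rw [if_pos ⟨h, h2⟩]
    · intro p _; split_ifs <;> simp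
  · intro h
    obtain ⟨p, hp, hpos⟩ := Finset.exists_lt_of_sum_lt (s := leftEnds (part D n)) (f := fun _ => (0 : ℝ))
      (g := fun p => if p < c ∧ spacing (part D n) p = maxLen D n then (1 : ℝ) else 0)
      (by simpa [intervalSum] using h)
    have : p < c ∧ spacing (part D n) p = maxLen D n := by
      by_contra hc
      rw [if_neg hc] at hpos
      exact lt_irrefl _ hpos
    exact (largestLeftEnd_le _ hp this.2).trans_lt this.1

/-- Half of a joint induction: the interval split at time `n` is measurable once additive
functionals at time `n` are, and the functionals at time `n + 1` are built from that interval. -/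
theorem measurable_maxLen_of {n : ℕ} (h : ∀ φ : (ℕ → Divisions m) → ℝ → ℝ → ℝ,
      (Measurable fun x : (ℕ → Divisions m) × ℝ × ℝ => φ x.1 x.2.1 x.2.2) →
      Measurable fun D => intervalSum D n (φ D)) :
    (Measurable fun D : ℕ → Divisions m => maxLen D n) ∧
    Measurable fun D : ℕ → Divisions m => maxLeft D n := by
  have h1 : Measurable fun D : ℕ → Divisions m => maxLen D n := by
    refine measurable_of_Iic fun c => ?_
    have : (fun D : ℕ → Divisions m => maxLen D n) ⁻¹' Set.Iic c =
        {D | intervalSum D n (fun _ s => if c < s then 1 else 0) ≤ 0} := by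
      ext D; exact maxLen_le_iff D n c
    rw [this]
    refine measurableSet_le (h (fun _ _ s => if c < s then 1 else 0) ?_) measurable_const
    exact Measurable.ite (measurableSet_lt measurable_const (measurable_snd.snd))
      measurable_const measurable_const
  refine ⟨h1, measurable_of_Iio fun c => ?_⟩
  have : (fun D : ℕ → Divisions m => maxLeft D n) ⁻¹' Set.Iio c =
      {D | 0 < intervalSum D n (fun p s => if p < c ∧ s = maxLen D n then 1 else 0)} := by
    ext D; exact maxLeft_lt_iff D n c
  rw [this]
  refine measurableSet_lt measurable_const
    (h (fun D p s => if p < c ∧ s = maxLen D n then 1 else 0) ?_)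
  refine Measurable.ite ?_ measurable_const measurable_const
  exact (measurableSet_lt measurable_snd.fst measurable_const).inter
    (measurableSet_eq_fun measurable_snd.snd (h1.comp measurable_fst))

/-- The function `φ` may depend on `D` because the induction uses random thresholds such as `maxLen
D n`. -/
theorem measurable_intervalSum (n : ℕ) (φ : (ℕ → Divisions m) → ℝ → ℝ → ℝ)
    (hφ : Measurable fun x : (ℕ → Divisions m) × ℝ × ℝ => φ x.1 x.2.1 x.2.2) :
    Measurable fun D => intervalSum D n (φ D) := by
  induction n generalizing φ with
  | zero =>
    simp_rw [intervalSum_zero]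
    exact hφ.comp (measurable_id.prodMk (measurable_const (a := ((0 : ℝ), (1 : ℝ)))))
  | succ n ih =>
    obtain ⟨h1, h2⟩ := measurable_maxLen_of ih
    simp_rw [intervalSum_succ]
    refine ((ih φ hφ).sub ?_).add (Finset.measurable_sum _ fun i _ => ?_)
    · exact hφ.comp (measurable_id.prodMk (h2.prodMk h1))
    · refine hφ.comp (measurable_id.prodMk (Measurable.prodMk ?_ ?_))
      · exact h2.add (h1.mul ((measurable_pieceLeft i).comp (measurable_pi_apply n)))
      · exact h1.mul ((measurable_pieceLen i).comp (measurable_pi_apply n))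

theorem measurable_maxLen (n : ℕ) : Measurable fun D : ℕ → Divisions m => maxLen D n :=
  (measurable_maxLen_of fun φ hφ => measurable_intervalSum n φ hφ).1

theorem measurable_maxLeft (n : ℕ) : Measurable fun D : ℕ → Divisions m => maxLeft D n :=
  (measurable_maxLen_of fun φ hφ => measurable_intervalSum n φ hφ).2

theorem part_update (D : ℕ → Divisions m) {n k : ℕ} (h : n ≤ k) (e : Divisions m) :
    part (Function.update D k e) n = part D n :=
  part_congr fun j hj => Function.update_of_ne (by omega) _ _

theorem maxLen_update (D : ℕ → Divisions m) {n k : ℕ} (h : n ≤ k) (e : Divisions m) :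
    maxLen (Function.update D k e) n = maxLen D n := by rw [maxLen, part_update D h, maxLen]

theorem maxLeft_update (D : ℕ → Divisions m) {n k : ℕ} (h : n ≤ k) (e : Divisions m) :
    maxLeft (Function.update D k e) n = maxLeft D n := by rw [maxLeft, part_update D h, maxLeft]

/-! ### Integration over sequences of independent variables -/

section Freeze

theorem measurable_update_pair {E : Type*} [MeasurableSpace E] (n : ℕ) :
    Measurable fun x : (ℕ → E) × E => Function.update x.1 n x.2 := by
  refine measurable_pi_lambda _ fun k => ?_
  by_cases h : k = n
  · subst h; simpa using measurable_snd
  · simp only [Function.update_of_ne h]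
    exact (measurable_pi_apply k).comp measurable_fst

variable {E : Type*} [MeasurableSpace E] (lam : Measure E) [IsProbabilityMeasure lam]

/-- An independent copy in one coordinate does not change the law of an i.i.d. sequence. On a
cylinder, either `n` is a constrained coordinate and its factor comes from the copy, or the update
is invisible. -/
theorem map_update_infinitePi (n : ℕ) :
    ((Measure.infinitePi fun _ : ℕ => lam).prod lam).map
      (fun x : (ℕ → E) × E => Function.update x.1 n x.2) = Measure.infinitePi fun _ : ℕ => lam := by
  have hmeas := measurable_update_pair (E := E) n
  refine Measure.eq_infinitePi _ fun s t ht => ?_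
  rw [Measure.map_apply hmeas (MeasurableSet.pi s.countable_toSet fun i _ => ht i)]
  by_cases hn : n ∈ s
  · have : (fun x : (ℕ → E) × E => Function.update x.1 n x.2) ⁻¹' (Set.pi s t) =
        (Set.pi (s.erase n) t) ×ˢ (t n) := by
      ext x
      simp only [Set.mem_preimage, Set.mem_pi, Set.mem_prod, Finset.mem_coe, Finset.mem_erase]
      constructor
      · intro h
        refine ⟨fun i hi => ?_, ?_⟩
        · simpa [Function.update_of_ne hi.1] using h i hi.2
        · simpa using h n hn
      · rintro ⟨h1, h2⟩ i hi
        by_cases hin : i = n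
        · subst hin; simpa using h2
        · simpa [Function.update_of_ne hin] using h1 i ⟨hin, hi⟩
    rw [this, Measure.prod_prod, Measure.infinitePi_pi _ (fun i _ => ht i),
      Finset.prod_erase_mul _ _ hn]
  · have : (fun x : (ℕ → E) × E => Function.update x.1 n x.2) ⁻¹' (Set.pi s t) =
        (Set.pi s t) ×ˢ Set.univ := by
      ext x
      simp only [Set.mem_preimage, Set.mem_pi, Set.mem_prod, Finset.mem_coe, Set.mem_univ, and_true]
      refine forall₂_congr fun i hi => ?_
      rw [Function.update_of_ne]
      rintro rfl; exact hn hi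
    rw [this, Measure.prod_prod, Measure.infinitePi_pi _ (fun i _ => ht i), measure_univ, mul_one]

theorem integrable_of_bound {α : Type*} [MeasurableSpace α] {μ : Measure α} [IsFiniteMeasure μ]
    {f : α → ℝ} (hf : Measurable f) {C : ℝ} (hC : ∀ x, |f x| ≤ C) : Integrable f μ :=
  Integrable.of_bound hf.aestronglyMeasurable C (ae_of_all _ hC)

/-- If `Φ x d` does not depend on the `n`-th coordinate of `x`, then the `n`-th coordinate can be
integrated separately in `Φ x (x n)`. -/
theorem integral_freeze (n : ℕ) {Φ : (ℕ → E) → E → ℝ} (hΦ : Measurable (Function.uncurry Φ))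
    {C : ℝ} (hC : ∀ x d, |Φ x d| ≤ C) (hdep : ∀ x d e, Φ (Function.update x n e) d = Φ x d) :
    ∫ x, Φ x (x n) ∂(Measure.infinitePi fun _ : ℕ => lam) =
      ∫ x, ∫ d, Φ x d ∂lam ∂(Measure.infinitePi fun _ : ℕ => lam) := by
  have hmeas := measurable_update_pair (E := E) n
  have hm2 : Measurable fun x : ℕ → E => Φ x (x n) :=
    hΦ.comp (measurable_id.prodMk (measurable_pi_apply n))
  -- Resample coordinate `n`: the new value is independent of the sequence, and the first argument
  -- of `Φ` does not notice the change.
  conv_lhs => rw [← map_update_infinitePi lam n]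
  rw [integral_map hmeas.aemeasurable hm2.aestronglyMeasurable]
  simp only [Function.update_self, hdep]
  rw [integral_prod (fun z : (ℕ → E) × E => Φ z.1 z.2)]
  exact integrable_of_bound hΦ (fun z => hC z.1 z.2)

/-- Sums of bounded martingale differences are orthogonal. -/
theorem integral_sum_sq {g : ℕ → (ℕ → E) → E → ℝ}
    (hg : ∀ n, Measurable (Function.uncurry (g n))) {C : ℝ} (hC : ∀ n x d, |g n x d| ≤ C)
    (hdep : ∀ n k, n ≤ k → ∀ x d e, g n (Function.update x k e) d = g n x d)
    (hzero : ∀ n x, ∫ d, g n x d ∂lam = 0) (N : ℕ) :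
    ∫ x, (∑ n ∈ Finset.range N, g n x (x n)) ^ 2 ∂(Measure.infinitePi fun _ : ℕ => lam) =
      ∑ n ∈ Finset.range N, ∫ x, (g n x (x n)) ^ 2 ∂(Measure.infinitePi fun _ : ℕ => lam) := by
  have hm : ∀ n, Measurable fun x : ℕ → E => g n x (x n) := fun n =>
    (hg n).comp (measurable_id.prodMk (measurable_pi_apply n))
  have hC0 : 0 ≤ C := by
    obtain ⟨d⟩ : Nonempty E := nonempty_of_isProbabilityMeasure lam
    exact (abs_nonneg _).trans (hC 0 (fun _ => d) d)
  induction N with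
  | zero => simp
  | succ N ih =>
    set T : (ℕ → E) → ℝ := fun x => ∑ n ∈ Finset.range N, g n x (x n) with hT
    have hTm : Measurable T := Finset.measurable_sum _ fun n _ => hm n
    have hTb : ∀ x, |T x| ≤ N * C := fun x =>
      (Finset.abs_sum_le_sum_abs _ _).trans ((Finset.sum_le_sum fun n _ => hC n x (x n)).trans_eq
        (by simp))
    have hTdep : ∀ x e, T (Function.update x N e) = T x := by
      intro x e
      refine Finset.sum_congr rfl fun n hn => ?_
      have hlt := Finset.mem_range.1 hn
      rw [hdep n N hlt.le, Function.update_of_ne hlt.ne]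
    -- `T` does not involve coordinate `N`, and the next increment has mean zero in that coordinate.
    have hcross : ∫ x, T x * g N x (x N) ∂(Measure.infinitePi fun _ : ℕ => lam) = 0 := by
      rw [integral_freeze lam N (Φ := fun x d => T x * g N x d) (C := N * C * C)]
      · simp only [integral_const_mul, hzero, mul_zero, integral_zero]
      · exact (hTm.comp measurable_fst).mul (hg N)
      · intro x d
        rw [abs_mul]
        exact mul_le_mul (hTb x) (hC N x d) (abs_nonneg _) (by positivity)
      · intro x d e
        simp only [hTdep, hdep N N le_rfl]
    have i1 : Integrable (fun x => T x ^ 2) (Measure.infinitePi fun _ : ℕ => lam) :=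
      integrable_of_bound (hTm.pow_const 2) (C := (N * C) ^ 2) fun x => by
        rw [abs_pow]; exact pow_le_pow_left₀ (abs_nonneg _) (hTb x) 2
    have i2 : Integrable (fun x => T x * g N x (x N)) (Measure.infinitePi fun _ : ℕ => lam) :=
      integrable_of_bound (hTm.mul (hm N)) (C := N * C * C) fun x => by
        rw [abs_mul]
        exact mul_le_mul (hTb x) (hC N x _) (abs_nonneg _) (by positivity)
    have i3 : Integrable (fun x => g N x (x N) ^ 2) (Measure.infinitePi fun _ : ℕ => lam) :=
      integrable_of_bound ((hm N).pow_const 2) (C := C ^ 2) fun x => by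
        rw [abs_pow]; exact pow_le_pow_left₀ (abs_nonneg _) (hC N x _) 2
    have : ∀ x : ℕ → E, (∑ n ∈ Finset.range (N + 1), g n x (x n)) ^ 2 =
        T x ^ 2 + (2 * (T x * g N x (x N)) + g N x (x N) ^ 2) := by
      intro x; rw [Finset.sum_range_succ]; simp only [hT]; ring
    simp only [this]
    rw [integral_add (g := fun x => 2 * (T x * g N x (x N)) + g N x (x N) ^ 2) i1
      ((i2.const_mul 2).add i3), integral_add (i2.const_mul 2) i3, integral_const_mul, hcross, Finset.sum_range_succ, ih]
    ring

end Freeze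

/-! ### A renewal theorem -/

section Renewal

variable {ν : Measure ℝ} [IsProbabilityMeasure ν] {h : ℝ → ℝ} {C : ℝ}

/-- Bounded functions on the negative half-line extend to solutions of the renewal equation. -/
theorem exists_renewal_solution (ν : Measure ℝ) [IsProbabilityMeasure ν] {φ : ℝ → ℝ}
    (hφ : Measurable φ) (h0 : ∀ t, 0 ≤ φ t) (hC : ∀ t, φ t ≤ C) :
    ∃ h : ℝ → ℝ, Measurable h ∧ (∀ t, 0 ≤ h t) ∧ (∀ t, h t ≤ C) ∧ (∀ t ≤ 0, h t = φ t) ∧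
      ∀ t, 0 < t → h t = ∫ s, h (t - s) ∂ν := by
  have hC0 : 0 ≤ C := (h0 0).trans (hC 0)
  -- Picard iteration, starting from zero on the positive half-line: the iterates increase and stay
  -- below `C`, so by monotone convergence their supremum solves the equation.
  let H : ℕ → ℝ → ENNReal := fun k => Nat.rec
    (fun t => if t ≤ 0 then ENNReal.ofReal (φ t) else 0)
    (fun _ G t => if t ≤ 0 then ENNReal.ofReal (φ t) else ∫⁻ s, G (t - s) ∂ν) k
  have H0 : ∀ t, H 0 t = if t ≤ 0 then ENNReal.ofReal (φ t) else 0 := fun t => rfl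
  have HS : ∀ k t, H (k + 1) t =
      if t ≤ 0 then ENNReal.ofReal (φ t) else ∫⁻ s, H k (t - s) ∂ν := fun k t => rfl
  have hmeas : ∀ k, Measurable (H k) := by
    intro k
    induction k with
    | zero => exact Measurable.ite measurableSet_Iic hφ.ennreal_ofReal measurable_const
    | succ k ih =>
      refine Measurable.ite measurableSet_Iic hφ.ennreal_ofReal ?_
      exact Measurable.lintegral_prod_right' (f := fun z : ℝ × ℝ => H k (z.1 - z.2))
        (ih.comp (measurable_fst.sub measurable_snd))
  have hmono : ∀ k t, H k t ≤ H (k + 1) t := by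
    intro k
    induction k with
    | zero =>
      intro t
      rw [H0, HS]
      split_ifs <;> simp
    | succ k ih =>
      intro t
      rw [HS k, HS (k + 1)]
      split_ifs
      · exact le_rfl
      · exact lintegral_mono fun s => ih _
  have hmono' : Monotone H := monotone_nat_of_le_succ fun k t => hmono k t
  have hbd : ∀ k t, H k t ≤ ENNReal.ofReal C := by
    intro k
    induction k with
    | zero =>
      intro t
      rw [H0]
      split_ifs
      · exact ENNReal.ofReal_le_ofReal (hC t)
      · exact zero_le
    | succ k ih =>
      intro t
      rw [HS]
      split_ifs
      · exact ENNReal.ofReal_le_ofReal (hC t)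
      · refine (lintegral_mono fun s => ih _).trans ?_
        simp
  let G : ℝ → ENNReal := fun t => ⨆ k, H k t
  have hGm : Measurable G := Measurable.iSup hmeas
  have hGb : ∀ t, G t ≤ ENNReal.ofReal C := fun t => iSup_le fun k => hbd k t
  have hGle : ∀ t ≤ 0, G t = ENNReal.ofReal (φ t) := by
    intro t ht
    have : ∀ k, H k t = ENNReal.ofReal (φ t) := by
      intro k
      cases k with
      | zero => rw [H0, if_pos ht]
      | succ k => rw [HS, if_pos ht]
    simp [G, this]
  have hGeq : ∀ t, 0 < t → G t = ∫⁻ s, G (t - s) ∂ν := by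
    intro t ht
    have e1 : ∫⁻ s, G (t - s) ∂ν = ⨆ k, ∫⁻ s, H k (t - s) ∂ν :=
      lintegral_iSup (fun k => (hmeas k).comp (measurable_const.sub measurable_id))
        fun i j hij s => hmono' hij _
    rw [e1]
    have e2 : ∀ k, H (k + 1) t = ∫⁻ s, H k (t - s) ∂ν := fun k => by
      rw [HS, if_neg (not_le.2 ht)]
    simp_rw [← e2]
    exact ((monotone_nat_of_le_succ fun k => hmono k t).iSup_nat_add 1).symm
  have hlt : ∀ t, G t < ⊤ := fun t => (hGb t).trans_lt ENNReal.ofReal_lt_top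
  refine ⟨fun t => (G t).toReal, hGm.ennreal_toReal, fun t => ENNReal.toReal_nonneg, fun t => ?_,
    fun t ht => ?_, fun t ht => ?_⟩
  · exact ENNReal.toReal_le_of_le_ofReal hC0 (hGb t)
  · simp only [hGle t ht, ENNReal.toReal_ofReal (h0 t)]
  · have := integral_toReal (μ := ν) (f := fun s => G (t - s))
      (hGm.comp (measurable_const.sub measurable_id)).aemeasurable (ae_of_all _ fun s => hlt _)
    rw [this, ← hGeq t ht]

theorem intervalIntegrable_of_bound (hm : Measurable h) (hb : ∀ t, |h t| ≤ C) (a b : ℝ) :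
    IntervalIntegrable h volume a b := by
  rw [intervalIntegrable_iff]
  exact Measure.integrableOn_of_bounded (M := C) (by simp) hm.aestronglyMeasurable
    (ae_of_all _ fun t => hb t)

theorem abs_intervalIntegral_le (hb : ∀ t, |h t| ≤ C) (a b : ℝ) :
    |∫ u in a..b, h u| ≤ C * |b - a| :=
  intervalIntegral.norm_integral_le_of_norm_le_const (f := h) fun x _ => hb x

theorem integrable_window {ν : Measure ℝ} (hm : Measurable h) (hb : ∀ t, |h t| ≤ C)
    (hint : Integrable (fun s : ℝ => s) ν) (t : ℝ) :
    Integrable (fun s => ∫ u in (t - s)..t, h u) ν := by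
  refine (hint.abs.const_mul C).mono' ?_ (ae_of_all _ fun s => ?_)
  · have h1 : Continuous fun x => ∫ u in (0 : ℝ)..x, h u :=
      intervalIntegral.continuous_primitive (fun a b => intervalIntegrable_of_bound hm hb a b) 0
    have h2 : (fun s => ∫ u in (t - s)..t, h u) =
        fun s => (∫ u in (0 : ℝ)..t, h u) - ∫ u in (0 : ℝ)..(t - s), h u := by
      funext s
      rw [intervalIntegral.integral_interval_sub_left] <;>
        exact intervalIntegrable_of_bound hm hb _ _
    rw [h2]
    exact (continuous_const.sub (h1.comp (continuous_const.sub continuous_id))).aestronglyMeasurable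
  · have := abs_intervalIntegral_le hb (t - s) t
    rwa [sub_sub_cancel] at this

/-- The conservation law of the renewal equation. -/
theorem renewal_conservation (hint : Integrable (fun s : ℝ => s) ν) (hm : Measurable h)
    (hb : ∀ t, |h t| ≤ C) (heq : ∀ t, 0 < t → h t = ∫ s, h (t - s) ∂ν) {t : ℝ} (ht : 0 ≤ t) :
    ∫ s, (∫ u in (t - s)..t, h u) ∂ν = ∫ s, (∫ u in (0 - s)..0, h u) ∂ν := by
  have hI := intervalIntegrable_of_bound hm hb
  -- Integrate the equation over (0, t] and exchange integrals. Shifting by `s` changes the inner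
  -- integral only by the windows of length `s` ending at `t` and at 0; the common term cancels
  -- because `ν` has mass one.
  have e1 : ∫ u in (0 : ℝ)..t, h u = ∫ s, (∫ u in (0 : ℝ)..t, h (u - s)) ∂ν := by
    simp only [intervalIntegral.integral_of_le ht]
    rw [integral_integral_swap]
    · refine setIntegral_congr_fun measurableSet_Ioc fun u hu => heq u hu.1
    · exact integrable_of_bound (hm.comp (measurable_snd.sub measurable_fst)) fun z => hb _
  have e2 : ∀ s, ∫ u in (0 : ℝ)..t, h (u - s) =
      (∫ u in (0 : ℝ)..t, h u) - (∫ u in (t - s)..t, h u) + ∫ u in (0 - s)..0, h u := by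
    intro s
    rw [intervalIntegral.integral_comp_sub_right]
    have a1 := intervalIntegral.integral_add_adjacent_intervals (hI (0 - s) 0) (hI 0 t)
    have a2 := intervalIntegral.integral_add_adjacent_intervals (hI (0 - s) (t - s)) (hI (t - s) t)
    linarith
  simp only [e2] at e1
  have w1 := integrable_window (ν := ν) hm hb hint t
  have w2 := integrable_window (ν := ν) hm hb hint 0
  rw [integral_add (f := fun s => (∫ u in (0 : ℝ)..t, h u) - (∫ u in (t - s)..t, h u))
      ((integrable_const _).sub w1) w2,
    integral_sub (integrable_const _) w1, integral_const] at e1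
  simp at e1 ⊢
  linarith

/-- Along times at which a solution of the renewal equation approaches its upper limit, the
conserved quantity determines this upper limit. -/
theorem renewal_limit_point (hpos : ∀ᵐ s ∂ν, 0 < s) (hint : Integrable (fun s : ℝ => s) ν)
    (hac : volume.restrict (Set.Ioi (0 : ℝ)) ≪ ν) (hm : Measurable h) (hb : ∀ t, |h t| ≤ C)
    (heq : ∀ t, 0 < t → h t = ∫ s, h (t - s) ∂ν) {a : ℝ} {t : ℕ → ℝ} (ht : Tendsto t atTop atTop)
    (hta : Tendsto (fun n => h (t n)) atTop (𝓝 a))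
    (hle : ∀ e > 0, ∀ᶠ u in atTop, h u ≤ a + e) :
    a * ∫ s, s ∂ν = ∫ s, (∫ u in (0 - s)..0, h u) ∂ν := by
  have hC0 : 0 ≤ C := (abs_nonneg _).trans (hb 0)
  have hfm : ∀ n, Measurable fun s => h (t n - s) := fun n =>
    hm.comp (measurable_const.sub measurable_id)
  have hfi : ∀ n, Integrable (fun s => h (t n - s)) ν := fun n =>
    integrable_of_bound (hfm n) fun s => hb _
  have hposm : ∀ n, Measurable fun s => max (h (t n - s) - a) 0 := fun n =>
    ((hfm n).sub_const a).max measurable_const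
  have hposb : ∀ n s, |max (h (t n - s) - a) 0| ≤ C + |a| := by
    intro n s
    rw [abs_of_nonneg (le_max_right _ _)]
    refine max_le ?_ (by positivity)
    linarith [(abs_le.1 (hb (t n - s))).2, neg_abs_le a]
  -- At late times `h` hardly exceeds `a`, so the mean excess vanishes by dominated convergence.
  have hposlim : Tendsto (fun n => ∫ s, max (h (t n - s) - a) 0 ∂ν) atTop (𝓝 0) := by
    have : Tendsto (fun n => ∫ s, max (h (t n - s) - a) 0 ∂ν) atTop (𝓝 (∫ _, (0 : ℝ) ∂ν)) := by
      refine tendsto_integral_of_dominated_convergence (fun _ => C + |a|)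
        (fun n => (hposm n).aestronglyMeasurable) (integrable_const _)
        (fun n => ae_of_all _ fun s => hposb n s) (ae_of_all _ fun s => ?_)
      rw [Metric.tendsto_nhds]
      intro e he
      have h1 : Tendsto (fun n => t n - s) atTop atTop :=
        tendsto_atTop_add_const_right _ (-s) ht
      filter_upwards [h1.eventually (hle (e / 2) (by positivity))] with n hn
      rw [Real.dist_eq, sub_zero, abs_of_nonneg (le_max_right _ _)]
      exact max_lt (by linarith) he
    simpa using this
  -- Use |z| = 2z⁺ - z for z = h(t n - s) - a; by the renewal equation the mean of z is h(t n) - a,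
  -- which tends to 0.
  have habs : Tendsto (fun n => ∫ s, |h (t n - s) - a| ∂ν) atTop (𝓝 0) := by
    have h1 : ∀ᶠ n in atTop, 2 * (∫ s, max (h (t n - s) - a) 0 ∂ν) - (h (t n) - a) =
        ∫ s, |h (t n - s) - a| ∂ν := by
      filter_upwards [ht.eventually (eventually_gt_atTop 0)] with n hn
      have e1 : ∀ s, |h (t n - s) - a| = 2 * max (h (t n - s) - a) 0 - (h (t n - s) - a) := by
        intro s
        rcases le_total 0 (h (t n - s) - a) with h0 | h0
        · rw [abs_of_nonneg h0, max_eq_left h0]; ring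
        · rw [abs_of_nonpos h0, max_eq_right h0]; ring
      simp_rw [e1]
      rw [integral_sub (g := fun s => h (t n - s) - a)
        ((integrable_of_bound (hposm n) (hposb n)).const_mul 2)
        ((hfi n).sub (integrable_const a)), integral_const_mul,
        integral_sub (hfi n) (integrable_const _), ← heq _ hn]
      simp
    have h2 : Tendsto (fun n => 2 * (∫ s, max (h (t n - s) - a) 0 ∂ν) - (h (t n) - a)) atTop
        (𝓝 (2 * 0 - (a - a))) := (hposlim.const_mul 2).sub (hta.sub_const a)
    simp only [mul_zero, sub_self] at h2
    exact h2.congr' h1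
  have hmeas : TendstoInMeasure ν (fun n s => h (t n - s)) atTop (fun _ => a) := by
    refine tendstoInMeasure_of_tendsto_eLpNorm (p := 1) one_ne_zero
      (fun n => (hfm n).aestronglyMeasurable) aestronglyMeasurable_const ?_
    have : ∀ n, eLpNorm ((fun s => h (t n - s)) - fun _ => a) 1 ν =
        ENNReal.ofReal (∫ s, |h (t n - s) - a| ∂ν) := by
      intro n
      rw [eLpNorm_one_eq_lintegral_enorm,
        ofReal_integral_eq_lintegral_ofReal (f := fun s => |h (t n - s) - a|)
          ((hfi n).sub (integrable_const a)).abs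
          (ae_of_all _ fun s => abs_nonneg _)]
      refine lintegral_congr fun s => ?_
      rw [Pi.sub_apply, Real.enorm_eq_ofReal_abs]
    simp_rw [this]
    simpa using ENNReal.tendsto_ofReal habs
  obtain ⟨ns, hns, hae⟩ := hmeas.exists_seq_tendsto_ae
  -- The windows are Lebesgue integrals, so convergence `ν`-almost everywhere has to be turned into
  -- convergence Lebesgue-almost everywhere on (0, ∞).
  have hae' := hac.ae_le hae
  have hwin : ∀ᵐ s ∂ν, Tendsto (fun k => ∫ u in (t (ns k) - s)..(t (ns k)), h u) atTop
      (𝓝 (a * s)) := by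
    filter_upwards [hpos] with s hs
    have e1 : ∀ k, ∫ u in (t (ns k) - s)..(t (ns k)), h u =
        ∫ u in (0 : ℝ)..s, h (t (ns k) - u) := by
      intro k
      rw [intervalIntegral.integral_comp_sub_left (fun x => h x), sub_zero]
    have e2 : a * s = ∫ u in (0 : ℝ)..s, a := by simp [mul_comm]
    simp_rw [e1]
    rw [e2]
    refine intervalIntegral.tendsto_integral_filter_of_dominated_convergence (fun _ => C)
      (Eventually.of_forall fun k => (hfm _).aestronglyMeasurable)
      (Eventually.of_forall fun k => ae_of_all _ fun u _ => hb _) (by simp) ?_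
    filter_upwards [(ae_restrict_iff' measurableSet_Ioi).1 hae'] with u hu hu'
    rw [Set.uIoc_of_le hs.le] at hu'
    exact hu hu'.1
  have hlim : Tendsto (fun k => ∫ s, (∫ u in (t (ns k) - s)..(t (ns k)), h u) ∂ν) atTop
      (𝓝 (∫ s, a * s ∂ν)) := by
    refine tendsto_integral_of_dominated_convergence (fun s => C * |s|)
      (fun k => (integrable_window hm hb hint _).aestronglyMeasurable) (hint.abs.const_mul C)
      (fun k => ae_of_all _ fun s => ?_) hwin
    have := abs_intervalIntegral_le hb (t (ns k) - s) (t (ns k))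
    rwa [sub_sub_cancel] at this
  rw [← integral_const_mul]
  refine tendsto_nhds_unique (hlim.congr' ?_) tendsto_const_nhds
  have h3 : Tendsto (fun k => t (ns k)) atTop atTop := ht.comp hns.tendsto_atTop
  filter_upwards [h3.eventually (eventually_ge_atTop 0)] with k hk
  exact renewal_conservation hint hm hb heq hk

theorem integral_pos_of_ae_pos (hpos : ∀ᵐ s ∂ν, 0 < s) (hint : Integrable (fun s : ℝ => s) ν) :
    0 < ∫ s, s ∂ν := by
  rw [integral_pos_iff_support_of_nonneg_ae (hpos.mono fun s hs => hs.le) hint]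
  have : ν (Function.support fun s : ℝ => s) = 1 := by
    refine le_antisymm prob_le_one ?_
    rw [← measure_univ (μ := ν)]
    exact measure_mono_ae (hpos.mono fun s hs _ => hs.ne')
  rw [this]; exact one_pos

/-- Bounded solutions of the renewal equation converge. -/
theorem renewal_tendsto (hpos : ∀ᵐ s ∂ν, 0 < s) (hint : Integrable (fun s : ℝ => s) ν)
    (hac : volume.restrict (Set.Ioi (0 : ℝ)) ≪ ν) (hm : Measurable h) (hb : ∀ t, |h t| ≤ C)
    (heq : ∀ t, 0 < t → h t = ∫ s, h (t - s) ∂ν) :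
    Tendsto h atTop (𝓝 ((∫ s, (∫ u in (0 - s)..0, h u) ∂ν) / ∫ s, s ∂ν)) := by
  have hmean := integral_pos_of_ae_pos hpos hint
  -- To be applied to `h` and to `-h`: the conserved quantity is linear, so the upper and the lower
  -- limit coincide.
  have key : ∀ {g : ℝ → ℝ}, Measurable g → (∀ t, |g t| ≤ C) →
      (∀ t, 0 < t → g t = ∫ s, g (t - s) ∂ν) →
      limsup g atTop = (∫ s, (∫ u in (0 - s)..0, g u) ∂ν) / ∫ s, s ∂ν := by
    intro g hgm hgb hgeq
    have hbdd : IsBoundedUnder (· ≤ ·) atTop g :=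
      isBoundedUnder_of ⟨C, fun t => (abs_le.1 (hgb t)).2⟩
    have hcob : IsCoboundedUnder (· ≤ ·) atTop g :=
      (isBoundedUnder_of ⟨-C, fun t => (abs_le.1 (hgb t)).1⟩ :
        IsBoundedUnder (· ≥ ·) atTop g).isCoboundedUnder_le
    obtain ⟨t, hta, ht⟩ := exists_seq_tendsto_limsup (f := (atTop : Filter ℝ)) (u := g) hcob hbdd
    rw [eq_div_iff hmean.ne']
    refine renewal_limit_point hpos hint hac hgm hgb hgeq ht hta fun e he => ?_
    have := eventually_lt_of_limsup_lt (u := g) (f := atTop) (b := limsup g atTop + e)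
      (by linarith) hbdd
    exact this.mono fun _ h => h.le
  have hbdd : IsBoundedUnder (· ≤ ·) atTop h :=
    isBoundedUnder_of ⟨C, fun t => (abs_le.1 (hb t)).2⟩
  have hbdd' : IsBoundedUnder (· ≥ ·) atTop h :=
    isBoundedUnder_of ⟨-C, fun t => (abs_le.1 (hb t)).1⟩
  have h1 := key hm hb heq
  have h2 := key (g := fun t => -h t) hm.neg (fun t => by rw [abs_neg]; exact hb t)
    (fun t ht => by rw [integral_neg, ← heq t ht])
  refine tendsto_of_le_liminf_of_limsup_le ?_ h1.le hbdd hbdd'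
  have hne : ∀ e > 0, ∀ᶠ u in atTop,
      (∫ s, (∫ u in (0 - s)..0, h u) ∂ν) / (∫ s, s ∂ν) - e ≤ h u := by
    intro e he
    have hb2 : IsBoundedUnder (· ≤ ·) atTop (fun t => -h t) :=
      isBoundedUnder_of ⟨C, fun t => by linarith [(abs_le.1 (hb t)).1]⟩
    have := eventually_lt_of_limsup_lt (u := fun t => -h t) (f := atTop)
      (b := limsup (fun t => -h t) atTop + e) (by linarith) hb2
    filter_upwards [this] with u hu
    rw [h2] at hu
    simp only [intervalIntegral.integral_neg, integral_neg, neg_div] at hu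
    linarith
  refine le_of_forall_pos_sub_le fun e he => ?_
  exact le_liminf_of_le hbdd.isCoboundedUnder_ge (hne e he)

end Renewal

/-! ### The distribution of the lengths of the pieces -/

/-- The intensity measure of the lengths of the pieces. -/
def lengthMeasure (lam : Measure (Divisions m)) : Measure ℝ :=
  ∑ i : Option (Fin m), lam.map fun d => pieceLen d i

/-- The size-biased distribution of `-log` of the length of a piece. -/
def sizeBiased (lam : Measure (Divisions m)) : Measure ℝ :=
  ∑ i : Option (Fin m), (lam.withDensity fun d => ENNReal.ofReal (pieceLen d i)).map
    fun d => -Real.log (pieceLen d i)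

theorem measurable_neg_log_pieceLen (i : Option (Fin m)) :
    Measurable fun d : Divisions m => -Real.log (pieceLen d i) :=
  (Real.measurable_log.comp (measurable_pieceLen i)).neg

section Law

variable (lam : Measure (Divisions m))

theorem integrable_sizeBiased_summand {f : ℝ → ℝ} (hf : Measurable f) (i : Option (Fin m))
    (hi : Integrable (fun d => pieceLen d i * f (-Real.log (pieceLen d i))) lam) :
    Integrable f ((lam.withDensity fun d => ENNReal.ofReal (pieceLen d i)).map
      fun d => -Real.log (pieceLen d i)) := by
  rw [integrable_map_measure hf.aestronglyMeasurable (measurable_neg_log_pieceLen i).aemeasurable,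
    integrable_withDensity_iff_integrable_smul' (measurable_pieceLen i).ennreal_ofReal
      (ae_of_all _ fun d => ENNReal.ofReal_lt_top)]
  refine hi.congr (ae_of_all _ fun d => ?_)
  simp only [ENNReal.toReal_ofReal (pieceLen_pos d i).le, smul_eq_mul, Function.comp]

theorem integrable_sizeBiased {f : ℝ → ℝ} (hf : Measurable f)
    (hi : ∀ i, Integrable (fun d => pieceLen d i * f (-Real.log (pieceLen d i))) lam) :
    Integrable f (sizeBiased lam) :=
  integrable_finsetSum_measure.2 fun i _ => integrable_sizeBiased_summand lam hf i (hi i)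

/-- Length-weighted averages over all pieces become integrals over a single random variable; this
turns harmonicity into a renewal equation. -/
theorem integral_sizeBiased {f : ℝ → ℝ} (hf : Measurable f)
    (hi : ∀ i, Integrable (fun d => pieceLen d i * f (-Real.log (pieceLen d i))) lam) :
    ∫ s, f s ∂(sizeBiased lam) =
      ∫ d, ∑ i, pieceLen d i * f (-Real.log (pieceLen d i)) ∂lam := by
  rw [sizeBiased, integral_finsetSum_measure fun i _ =>
    integrable_sizeBiased_summand lam hf i (hi i), integral_finsetSum _ fun i _ => hi i]
  refine Finset.sum_congr rfl fun i _ => ?_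
  rw [integral_map (measurable_neg_log_pieceLen i).aemeasurable hf.aestronglyMeasurable,
    integral_withDensity_eq_integral_toReal_smul (measurable_pieceLen i).ennreal_ofReal
      (ae_of_all _ fun d => ENNReal.ofReal_lt_top)]
  refine integral_congr_ae (ae_of_all _ fun d => ?_)
  simp only [ENNReal.toReal_ofReal (pieceLen_pos d i).le, smul_eq_mul]

/-- The total mass is the mean of the sum of the lengths of the pieces, which is 1. -/
instance isProbabilityMeasure_sizeBiased [IsProbabilityMeasure lam] :
    IsProbabilityMeasure (sizeBiased lam) := by
  constructor
  rw [sizeBiased, Measure.finsetSum_apply]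
  have : ∀ i, ((lam.withDensity fun d => ENNReal.ofReal (pieceLen d i)).map
      fun d => -Real.log (pieceLen d i)) Set.univ = ∫⁻ d, ENNReal.ofReal (pieceLen d i) ∂lam := by
    intro i
    rw [Measure.map_apply (measurable_neg_log_pieceLen i) MeasurableSet.univ, Set.preimage_univ,
      withDensity_apply _ MeasurableSet.univ, Measure.restrict_univ]
  simp_rw [this]
  rw [← lintegral_finsetSum _ fun i _ => (measurable_pieceLen i).ennreal_ofReal]
  have h2 : ∀ d : Divisions m, ∑ i, ENNReal.ofReal (pieceLen d i) = 1 := by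
    intro d
    rw [← ENNReal.ofReal_sum_of_nonneg fun i _ => (pieceLen_pos d i).le, sum_pieceLen,
      ENNReal.ofReal_one]
  simp [h2]

theorem sizeBiased_pos (hm : 0 < m) : ∀ᵐ s ∂(sizeBiased lam), 0 < s := by
  rw [sizeBiased, ae_finsetSum_measure_iff]
  intro i _
  rw [ae_map_iff (measurable_neg_log_pieceLen i).aemeasurable measurableSet_Ioi]
  exact ae_of_all _ fun d =>
    neg_pos.2 (Real.log_neg (pieceLen_pos d i) (pieceLen_lt_one hm d i))

theorem integrable_id_sizeBiased [IsFiniteMeasure lam] :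
    Integrable (fun s => s) (sizeBiased lam) := by
  refine integrable_sizeBiased lam measurable_id fun i => ?_
  refine integrable_of_bound ((measurable_pieceLen i).mul (measurable_neg_log_pieceLen i))
    (C := 1) fun d => ?_
  have h0 := pieceLen_pos d i
  have h1 := pieceLen_le_one d i
  have h2 := Real.log_nonpos h0.le h1
  -- For a length v this gives -v log v ≤ 1 - v ≤ 1.
  have h3 := Real.one_sub_inv_le_log_of_pos h0
  rw [abs_of_nonneg (mul_nonneg h0.le (neg_nonneg.2 h2))]
  have h4 : pieceLen d i * (1 - (pieceLen d i)⁻¹) = pieceLen d i - 1 := by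
    field_simp
  nlinarith [mul_le_mul_of_nonneg_left h3 h0.le]

/-- At s = -log v the factor exp s = 1/v cancels the size bias v, leaving the constant 1 for each
piece. -/
theorem integrable_exp_sizeBiased [IsFiniteMeasure lam] :
    Integrable (fun s => Real.exp s) (sizeBiased lam) := by
  refine integrable_sizeBiased lam Real.measurable_exp fun i => ?_
  refine (integrable_const (1 : ℝ)).congr (ae_of_all _ fun d => ?_)
  have h0 := pieceLen_pos d i
  simp only [Real.exp_neg, Real.exp_log h0]
  field_simp

/-- Size-biasing creates no new null sets since lengths are positive, and the map v ↦ -log v from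
(0, 1) onto (0, ∞) is differentiable, hence preserves Lebesgue null sets. -/
theorem volume_absolutelyContinuous_sizeBiased
    (hac : volume.restrict (Set.Ioo (0 : ℝ) 1) ≪ lengthMeasure lam) :
    volume.restrict (Set.Ioi (0 : ℝ)) ≪ sizeBiased lam := by
  refine Measure.AbsolutelyContinuous.mk fun A hA h0 => ?_
  have hB : MeasurableSet {v : ℝ | -Real.log v ∈ A} := Real.measurable_log.neg hA
  have hlen : lengthMeasure lam {v : ℝ | -Real.log v ∈ A} = 0 := by
    rw [sizeBiased, Measure.finsetSum_apply, Finset.sum_eq_zero_iff] at h0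
    rw [lengthMeasure, Measure.finsetSum_apply, Finset.sum_eq_zero_iff]
    intro i hi
    have h1 := h0 i hi
    rw [Measure.map_apply (measurable_neg_log_pieceLen i) hA,
      withDensity_apply_eq_zero (measurable_pieceLen i).ennreal_ofReal] at h1
    rw [Measure.map_apply (measurable_pieceLen i) hB]
    refine measure_mono_null ?_ h1
    intro d hd
    exact ⟨by simpa using pieceLen_pos d i, hd⟩
  have h2 := hac hlen
  rw [Measure.restrict_apply hB] at h2
  rw [Measure.restrict_apply hA]
  have h3 := addHaar_image_eq_zero_of_differentiableOn_of_addHaar_eq_zero volume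
    (f := fun v : ℝ => -Real.log v) (s := {v : ℝ | -Real.log v ∈ A} ∩ Set.Ioo 0 1) ?_ h2
  · refine measure_mono_null ?_ h3
    rintro s ⟨hs, hs0⟩
    refine ⟨Real.exp (-s), ⟨?_, Real.exp_pos _, ?_⟩, ?_⟩
    · simpa using hs
    · rw [Real.exp_lt_one_iff]; simpa using hs0
    · simp
  · intro v hv
    exact ((Real.differentiableAt_log hv.2.1.ne').neg).differentiableWithinAt

/-! ### Limit constants and the harmonic function -/

/-- The limit of the rescaled number of intervals that are longer than `x` times the threshold. -/
def tailLimit (x : ℝ) : ℝ :=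
  (∫ s, (min (Real.exp s) (1 / x) - 1) ∂(sizeBiased lam)) / ∫ s, s ∂(sizeBiased lam)

/-- The limit of the rescaled number of intervals. -/
def countLimit : ℝ :=
  (∫ s, (Real.exp s - 1) ∂(sizeBiased lam)) / ∫ s, s ∂(sizeBiased lam)

theorem mean_pos [IsProbabilityMeasure lam] (hm : 0 < m) : 0 < ∫ s, s ∂(sizeBiased lam) :=
  integral_pos_of_ae_pos (sizeBiased_pos lam hm) (integrable_id_sizeBiased lam)

theorem integrable_min_exp [IsProbabilityMeasure lam] (y : ℝ) :
    Integrable (fun s => min (Real.exp s) y - 1) (sizeBiased lam) :=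
  ((integrable_exp_sizeBiased lam).inf (integrable_const y)).sub (integrable_const 1)

theorem continuousAt_tailLimit [IsProbabilityMeasure lam] {x : ℝ} (hx : 0 < x) :
    ContinuousAt (tailLimit lam) x := by
  refine ContinuousAt.div_const ?_ _
  refine continuousAt_of_dominated (bound := fun s => Real.exp s + 1) ?_ ?_
    ((integrable_exp_sizeBiased lam).add (integrable_const 1)) ?_
  · exact Eventually.of_forall fun y => (integrable_min_exp lam _).aestronglyMeasurable
  · filter_upwards [eventually_gt_nhds hx] with y hy
    refine ae_of_all _ fun s => ?_
    have h1 : 0 ≤ min (Real.exp s) (1 / y) := le_min (Real.exp_pos s).le (by positivity)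
    rw [Real.norm_eq_abs, abs_le]
    constructor
    · linarith [Real.exp_pos s]
    · linarith [min_le_left (Real.exp s) (1 / y)]
  · refine ae_of_all _ fun s => ?_
    exact (continuousAt_const.min (continuousAt_const.div continuousAt_id hx.ne')).sub
      continuousAt_const

/-- The truncation of exp s at 1/x disappears as x decreases to 0; the integrable majorant is exp s
+ 1. -/
theorem tendsto_tailLimit [IsProbabilityMeasure lam] :
    Tendsto (tailLimit lam) (𝓝[>] 0) (𝓝 (countLimit lam)) := by
  refine Tendsto.div_const ?_ _
  refine tendsto_integral_filter_of_dominated_convergence (bound := fun s => Real.exp s + 1) ?_ ?_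
    ((integrable_exp_sizeBiased lam).add (integrable_const 1)) ?_
  · exact Eventually.of_forall fun y => (integrable_min_exp lam _).aestronglyMeasurable
  · filter_upwards [self_mem_nhdsWithin] with y hy
    refine ae_of_all _ fun s => ?_
    have h1 : 0 ≤ min (Real.exp s) (1 / y) :=
      le_min (Real.exp_pos s).le (one_div_nonneg.2 (le_of_lt hy))
    rw [Real.norm_eq_abs, abs_le]
    constructor
    · linarith [Real.exp_pos s]
    · linarith [min_le_left (Real.exp s) (1 / y)]
  · refine ae_of_all _ fun s => ?_
    refine tendsto_const_nhds.congr' ?_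
    have : Tendsto (fun y : ℝ => 1 / y) (𝓝[>] 0) atTop := by
      simpa only [one_div] using tendsto_inv_nhdsGT_zero
    filter_upwards [this.eventually (eventually_ge_atTop (Real.exp s))] with y hy
    rw [min_eq_left hy]

theorem countLimit_pos [IsProbabilityMeasure lam] (hm : 0 < m) : 0 < countLimit lam := by
  refine div_pos ?_ (mean_pos lam hm)
  -- Since exp s - 1 ≥ s, the numerator is at least the mean.
  have h1 : ∫ s, s ∂(sizeBiased lam) ≤ ∫ s, (Real.exp s - 1) ∂(sizeBiased lam) :=
    integral_mono (integrable_id_sizeBiased lam)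
      ((integrable_exp_sizeBiased lam).sub (integrable_const 1))
      fun s => by linarith [Real.add_one_le_exp s]
  exact (mean_pos lam hm).trans_le h1

/-- For each `x` there is a bounded function `H`, equal to `r⁻¹ 1_{x < r}` for `r ≤ 1`, which on
`(1, ∞)` is harmonic for the splitting of intervals; it converges at infinity. -/
theorem exists_harmonic [IsProbabilityMeasure lam] (hm : 0 < m)
    (hac : volume.restrict (Set.Ioo (0 : ℝ) 1) ≪ lengthMeasure lam) {x : ℝ} (hx0 : 0 < x)
    (hx1 : x < 1) :
    ∃ H : ℝ → ℝ, Measurable H ∧ (∀ r, 0 ≤ H r) ∧ (∀ r, H r ≤ 1 / x) ∧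
      (∀ r, 0 < r → r ≤ 1 → H r = if x < r then r⁻¹ else 0) ∧
      (∀ r, 1 < r → ∫ d, ∑ i, pieceLen d i * H (r * pieceLen d i) ∂lam = H r) ∧
      Tendsto H atTop (𝓝 (tailLimit lam x)) := by
  -- With t = log r the prescribed values r⁻¹ 1_{x < r} become this function, which is bounded by
  -- 1/x; a piece of length v shifts t by log v.
  have hφ : Measurable fun t => if Real.log x < t then Real.exp (-t) else 0 :=
    Measurable.ite measurableSet_Ioi (Real.measurable_exp.comp measurable_neg) measurable_const
  obtain ⟨h, hmeas, h0, hC, hneg, heq⟩ := exists_renewal_solution (C := 1 / x) (sizeBiased lam) hφ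
    (fun t => by split_ifs <;> positivity)
    (fun t => by
      split_ifs with ht
      · rw [Real.exp_neg, one_div]
        exact inv_anti₀ hx0 ((Real.log_lt_iff_lt_exp hx0).1 ht).le
      · positivity)
  have hb : ∀ t, |h t| ≤ 1 / x := fun t => by rw [abs_of_nonneg (h0 t)]; exact hC t
  have hlim := renewal_tendsto (sizeBiased_pos lam hm) (integrable_id_sizeBiased lam)
    (volume_absolutelyContinuous_sizeBiased lam hac) hmeas hb heq
  refine ⟨fun r => h (Real.log r), hmeas.comp Real.measurable_log, fun r => h0 _, fun r => hC _,
    fun r hr hr1 => ?_, fun r hr => ?_, ?_⟩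
  · simp only [hneg _ (Real.log_nonpos hr.le hr1), Real.log_lt_log_iff hx0 hr, Real.exp_neg,
      Real.exp_log hr]
  · have hr0 : 0 < r := one_pos.trans hr
    simp only
    rw [heq _ (Real.log_pos hr), integral_sizeBiased lam
      (f := fun s => h (Real.log r - s)) (hmeas.comp (measurable_const.sub measurable_id))]
    · refine integral_congr_ae (ae_of_all _ fun d => Finset.sum_congr rfl fun i _ => ?_)
      rw [Real.log_mul hr0.ne' (pieceLen_pos d i).ne', sub_neg_eq_add]
    · intro i
      refine integrable_of_bound (C := 1 / x) ((measurable_pieceLen i).mul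
        (hmeas.comp (measurable_const.sub (measurable_neg_log_pieceLen i)))) fun d => ?_
      rw [abs_mul, abs_of_pos (pieceLen_pos d i)]
      exact (mul_le_of_le_one_left (abs_nonneg _) (pieceLen_le_one d i)).trans (hb _)
  · refine Tendsto.comp ?_ Real.tendsto_log_atTop
    convert hlim using 2
    rw [tailLimit]
    congr 1
    refine integral_congr_ae ?_
    filter_upwards [sizeBiased_pos lam hm] with s hs
    have hlx : Real.log x < 0 := Real.log_neg hx0 hx1
    have hexp : ∀ a b : ℝ, ∫ u in a..b, Real.exp (-u) = Real.exp (-a) - Real.exp (-b) := by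
      intro a b
      rw [intervalIntegral.integral_comp_neg (fun u => Real.exp u), integral_exp]
    have hpos : ∀ a, Real.log x ≤ a → a ≤ 0 → ∫ u in a..0, h u = Real.exp (-a) - 1 := by
      intro a ha ha0
      have : ∫ u in a..0, h u = ∫ u in a..0, Real.exp (-u) := by
        refine intervalIntegral.integral_congr_ae (ae_of_all _ fun u hu => ?_)
        rw [Set.uIoc_of_le ha0] at hu
        rw [hneg u hu.2, if_pos (ha.trans_lt hu.1)]
      rw [this, hexp]; simp
    rw [zero_sub]
    -- The window from -s to 0 sees exp(-u) only where u > log x. Its integral is therefore exp s -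
    -- 1 or 1/x - 1, whichever is smaller.
    rcases le_total (Real.log x) (-s) with hc | hc
    · rw [hpos _ hc (by linarith), neg_neg, min_eq_left]
      rw [one_div, ← Real.exp_log (inv_pos.2 hx0), Real.log_inv]
      exact Real.exp_le_exp.2 (by linarith)
    · have hI := intervalIntegrable_of_bound hmeas hb
      rw [← intervalIntegral.integral_add_adjacent_intervals (hI (-s) (Real.log x)) (hI _ 0),
        hpos _ le_rfl hlx.le, Real.exp_neg, Real.exp_log hx0, min_eq_right]
      · have : ∫ u in (-s)..(Real.log x), h u = 0 := by
          refine intervalIntegral.integral_zero_ae (ae_of_all _ fun u hu => ?_)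
          rw [Set.uIoc_of_le hc] at hu
          rw [hneg u (hu.2.trans hlx.le), if_neg (not_lt.2 hu.2)]
        rw [this, one_div, zero_add]
      · rw [one_div, ← Real.exp_log (inv_pos.2 hx0), Real.log_inv]
        exact Real.exp_le_exp.2 (by linarith)

end Law

/-! ### Positive derivatives and absolute continuity -/

/-- On `[u, v)` the measure `ρ` has density `F'`, since both agree on half-open intervals by the
fundamental theorem of calculus; a strictly positive density can be inverted. -/
theorem volume_absolutelyContinuous_of_deriv_pos {ρ : Measure ℝ} {F : ℝ → ℝ} {u v : ℝ}
    (hρ : ∀ a b, u ≤ a → a ≤ b → b ≤ v → ρ (Set.Ico a b) = ENNReal.ofReal (F b - F a))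
    (hd : ∀ x ∈ Set.Icc u v, DifferentiableAt ℝ F x) (hpos : ∀ x ∈ Set.Icc u v, 0 < deriv F x) :
    volume.restrict (Set.Ico u v) ≪ ρ := by
  have hdm : Measurable fun x => ENNReal.ofReal (deriv F x) := (measurable_deriv F).ennreal_ofReal
  have hIco : ∀ a b, u ≤ a → a ≤ b → b ≤ v →
      ∫⁻ x in Set.Ico a b, ENNReal.ofReal (deriv F x) = ENNReal.ofReal (F b - F a) := by
    intro a b ha hab hb
    have hsub : Set.Icc a b ⊆ Set.Icc u v := Set.Icc_subset_Icc ha hb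
    -- No continuity of `F'` is needed: a nonnegative derivative is integrable.
    have hi : IntervalIntegrable (deriv F) volume a b := by
      refine intervalIntegral.intervalIntegrable_deriv_of_nonneg (g := F) ?_ ?_ ?_
      · intro x hx
        rw [Set.uIcc_of_le hab] at hx
        exact (hd x (hsub hx)).continuousAt.continuousWithinAt
      · intro x hx
        rw [min_eq_left hab, max_eq_right hab] at hx
        exact (hd x (hsub (Set.Ioo_subset_Icc_self hx))).hasDerivAt
      · intro x hx
        rw [min_eq_left hab, max_eq_right hab] at hx
        exact (hpos x (hsub (Set.Ioo_subset_Icc_self hx))).le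
    have hint := intervalIntegral.integral_eq_sub_of_hasDerivAt (f := F) (f' := deriv F)
      (a := a) (b := b) (fun x hx => by
        rw [Set.uIcc_of_le hab] at hx
        exact (hd x (hsub hx)).hasDerivAt) hi
    rw [← hint, intervalIntegral.integral_of_le hab, restrict_Ico_eq_restrict_Ioc,
      ofReal_integral_eq_lintegral_ofReal ((intervalIntegrable_iff_integrableOn_Ioc_of_le hab).1 hi)]
    refine (ae_restrict_iff' measurableSet_Ioc).2 (ae_of_all _ fun x hx => ?_)
    exact (hpos x (hsub (Set.Ioc_subset_Icc_self hx))).le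
  have heq : (volume.restrict (Set.Ico u v)).withDensity (fun x => ENNReal.ofReal (deriv F x)) =
      ρ.restrict (Set.Ico u v) := by
    refine Measure.ext_of_Ico' _ _ (fun a b hab => ?_) fun a b hab => ?_
    all_goals
      rw [withDensity_apply _ measurableSet_Ico, Measure.restrict_restrict measurableSet_Ico,
        Set.Ico_inter_Ico]
      rcases le_total (a ⊔ u) (b ⊓ v) with h | h
    · rw [hIco _ _ le_sup_right h inf_le_right]; exact ENNReal.ofReal_ne_top
    · rw [Set.Ico_eq_empty (not_lt.2 h)]; simp
    · rw [hIco _ _ le_sup_right h inf_le_right, Measure.restrict_apply measurableSet_Ico,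
        Set.Ico_inter_Ico, hρ _ _ le_sup_right h inf_le_right]
    · rw [Measure.restrict_apply measurableSet_Ico, Set.Ico_inter_Ico,
        Set.Ico_eq_empty (not_lt.2 h)]; simp
  have h1 : volume.restrict (Set.Ico u v) ≪
      (volume.restrict (Set.Ico u v)).withDensity (fun x => ENNReal.ofReal (deriv F x)) := by
    refine withDensity_absolutelyContinuous' hdm.aemeasurable ?_
    refine (ae_restrict_iff' measurableSet_Ico).2 (ae_of_all _ fun x hx => ?_)
    simpa using hpos x (Set.Ico_subset_Icc_self hx)
  rw [heq] at h1
  exact h1.trans Measure.restrict_le_self.absolutelyContinuous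

theorem spacingCount_eq (d : Divisions m) (x : ℝ) :
    (spacingCount d.1 x : ℝ) = ∑ i, if pieceLen d i < x then 1 else 0 := by
  rw [spacingCount, Finset.card_filter, Nat.cast_sum,
    sum_leftEnds_image d (fun p =>
      ((if spacing (Finset.univ.image d.1) p < x then 1 else 0 : ℕ) : ℝ))]
  refine Finset.sum_congr rfl fun i _ => ?_
  rw [pieceLen]
  split_ifs <;> simp

/-- Increments of the expected count function are the masses that `lengthMeasure lam` gives to
half-open intervals. The previous criterion applies on compact subintervals, and countably many of
these exhaust (0, 1). -/
theorem lengthMeasure_absolutelyContinuous (lam : Measure (Divisions m)) [IsProbabilityMeasure lam]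
    (hd : DifferentiableOn ℝ (fun x => ∫ d, (spacingCount d.1 x : ℝ) ∂lam) (Set.Ioo 0 1))
    (hpos : ∀ x ∈ Set.Ioo (0 : ℝ) 1, 0 < deriv (fun x => ∫ d, (spacingCount d.1 x : ℝ) ∂lam) x) :
    volume.restrict (Set.Ioo (0 : ℝ) 1) ≪ lengthMeasure lam := by
  set F : ℝ → ℝ := fun x => ∫ d, (spacingCount d.1 x : ℝ) ∂lam with hF
  have hset : ∀ (x : ℝ) (i : Option (Fin m)), MeasurableSet {d : Divisions m | pieceLen d i < x} :=
    fun x i => measurableSet_lt (measurable_pieceLen i) measurable_const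
  have hFx : ∀ x, F x = ∑ i, (lam {d | pieceLen d i < x}).toReal := by
    intro x
    simp only [hF, spacingCount_eq]
    rw [integral_finsetSum]
    · refine Finset.sum_congr rfl fun i _ => ?_
      have : (fun d : Divisions m => if pieceLen d i < x then (1 : ℝ) else 0) =
          Set.indicator {d | pieceLen d i < x} 1 := by
        funext d; simp [Set.indicator_apply]
      rw [this, integral_indicator_one (hset x i)]
      rfl
    · intro i _
      refine integrable_of_bound (C := 1)
        (Measurable.ite (hset x i) measurable_const measurable_const) fun d => ?_
      split_ifs <;> simp
  have hρ : ∀ a b, a ≤ b → lengthMeasure lam (Set.Ico a b) = ENNReal.ofReal (F b - F a) := by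
    intro a b hab
    rw [lengthMeasure, Measure.finsetSum_apply, hFx, hFx, ← Finset.sum_sub_distrib,
      ENNReal.ofReal_sum_of_nonneg]
    · refine Finset.sum_congr rfl fun i _ => ?_
      rw [Measure.map_apply (measurable_pieceLen i) measurableSet_Ico]
      have : (fun d : Divisions m => pieceLen d i) ⁻¹' Set.Ico a b =
          {d | pieceLen d i < b} \ {d | pieceLen d i < a} := by
        ext d; simp [and_comm]
      have hsub : {d : Divisions m | pieceLen d i < a} ⊆ {d | pieceLen d i < b} := by
        intro d hd
        exact lt_of_lt_of_le hd hab
      rw [this, measure_sdiff hsub (hset a i).nullMeasurableSet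
        (measure_ne_top _ _), ENNReal.ofReal_sub _ ENNReal.toReal_nonneg,
        ENNReal.ofReal_toReal (measure_ne_top _ _), ENNReal.ofReal_toReal (measure_ne_top _ _)]
    · intro i _
      refine sub_nonneg.2 (ENNReal.toReal_mono (measure_ne_top _ _) (measure_mono fun d hd => ?_))
      exact lt_of_lt_of_le hd hab
  have hcov : Set.Ioo (0 : ℝ) 1 ⊆ ⋃ n : ℕ, Set.Ico (1 / ((n : ℝ) + 2)) (1 - 1 / ((n : ℝ) + 2)) := by
    intro x hx
    obtain ⟨n, hn⟩ := exists_nat_one_div_lt (lt_min hx.1 (sub_pos.2 hx.2))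
    have h1 : 1 / ((n : ℝ) + 2) ≤ 1 / ((n : ℝ) + 1) :=
      one_div_le_one_div_of_le (by positivity) (by linarith)
    rw [lt_min_iff] at hn
    exact Set.mem_iUnion.2 ⟨n, by linarith, by linarith⟩
  refine Measure.AbsolutelyContinuous.mk fun A hA h0 => ?_
  rw [Measure.restrict_apply hA]
  refine measure_mono_null (Set.inter_subset_inter_right A hcov) ?_
  rw [Set.inter_iUnion]
  refine measure_iUnion_null fun n => ?_
  have hsub : Set.Icc (1 / ((n : ℝ) + 2)) (1 - 1 / ((n : ℝ) + 2)) ⊆ Set.Ioo 0 1 := by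
    intro x hx
    have : 0 < 1 / ((n : ℝ) + 2) := by positivity
    exact ⟨by linarith [hx.1], by linarith [hx.2]⟩
  have := volume_absolutelyContinuous_of_deriv_pos (ρ := lengthMeasure lam) (F := F)
    (fun a b _ hab _ => hρ a b hab)
    (fun x hx => (hd x (hsub hx)).differentiableAt (Ioo_mem_nhds (hsub hx).1 (hsub hx).2))
    (fun x hx => hpos x (hsub hx)) h0
  rwa [Measure.restrict_apply hA] at this

/-! ### Square-integrable fluctuations -/

/-- The law of a sequence of independent families of division points. -/
abbrev seqLaw (lam : Measure (Divisions m)) : Measure (ℕ → Divisions m) :=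
  Measure.infinitePi fun _ => lam

theorem intervalSum_sq_le (D : ℕ → Divisions m) (n : ℕ) :
    intervalSum D n (fun _ s => s ^ 2) ≤ maxLen D n := by
  refine (intervalSum_le D n (ψ := fun _ s => maxLen D n * s) fun p s _ _ h0 h1 => ?_).trans_eq ?_
  · nlinarith
  · rw [intervalSum_mul D n (maxLen D n) (fun _ s => s), intervalSum_spacing, mul_one]

theorem intervalSum_sq_nonneg (D : ℕ → Divisions m) (n : ℕ) :
    0 ≤ intervalSum D n (fun _ s => s ^ 2) :=
  Finset.sum_nonneg fun _ _ => sq_nonneg _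

/-- The decrease of the sum of squares controls the squares of the lengths that are split. -/
theorem sum_maxLen_sq_le (D : ℕ → Divisions m) {δ : ℝ} (hδ : 0 ≤ δ) (N : ℕ) :
    ∑ n ∈ Finset.range N, (if maxLen D n ≤ δ then
      maxLen D n ^ 2 * (1 - ∑ i, pieceLen (D n) i ^ 2) else 0) ≤ δ := by
  have hU : ∀ n, (if maxLen D n ≤ δ then intervalSum D n (fun _ s => s ^ 2) else δ) ≤ δ := by
    intro n
    split_ifs with h
    · exact (intervalSum_sq_le D n).trans h
    · exact le_rfl
  -- The potential is ∑ s² once all lengths are at most `δ`, and `δ` before. It never exceeds `δ`,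
  -- and each splitting with `maxLen D n ≤ δ` lowers it by exactly the `n`-th summand.
  suffices h : ∑ n ∈ Finset.range N, (if maxLen D n ≤ δ then
      maxLen D n ^ 2 * (1 - ∑ i, pieceLen (D n) i ^ 2) else 0) +
      (if maxLen D N ≤ δ then intervalSum D N (fun _ s => s ^ 2) else δ) ≤ δ by
    refine le_trans (le_add_of_nonneg_right ?_) h
    split_ifs
    · exact intervalSum_sq_nonneg D N
    · exact hδ
  induction N with
  | zero => simpa using hU 0
  | succ N ih =>
    rw [Finset.sum_range_succ]
    by_cases h : maxLen D N ≤ δ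
    · have h' := (maxLen_succ_le D N).trans h
      simp only [h, h', if_true] at ih ⊢
      rw [intervalSum_succ]
      simp only [mul_pow, ← Finset.mul_sum]
      linarith
    · simp only [h, if_false] at ih ⊢
      linarith [hU (N + 1)]

theorem sum_pieceLen_sq_lt (hm : 0 < m) (d : Divisions m) : ∑ i, pieceLen d i ^ 2 < 1 := by
  rw [← sum_pieceLen d]
  refine Finset.sum_lt_sum_of_nonempty Finset.univ_nonempty fun i _ => ?_
  nlinarith [pieceLen_pos d i, pieceLen_lt_one hm d i]

theorem measurable_sq_defect :
    Measurable fun d : Divisions m => 1 - ∑ i, pieceLen d i ^ 2 :=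
  measurable_const.sub (Finset.measurable_sum _ fun i _ => (measurable_pieceLen i).pow_const 2)

theorem abs_sq_defect_le (hm : 0 < m) (d : Divisions m) : |1 - ∑ i, pieceLen d i ^ 2| ≤ 1 := by
  have h1 := sum_pieceLen_sq_lt hm d
  have h2 : 0 ≤ ∑ i, pieceLen d i ^ 2 := Finset.sum_nonneg fun i _ => sq_nonneg _
  rw [abs_le]
  constructor <;> linarith

section Law

variable (lam : Measure (Divisions m)) [IsProbabilityMeasure lam]

/-- The mean relative decrease of the square of the length of an interval that is split. -/
def sqDefect : ℝ := ∫ d, (1 - ∑ i, pieceLen d i ^ 2) ∂lam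

theorem sqDefect_pos (hm : 0 < m) : 0 < sqDefect lam := by
  rw [sqDefect, integral_pos_iff_support_of_nonneg
    (fun d => (sub_pos.2 (sum_pieceLen_sq_lt hm d)).le)
    (integrable_of_bound measurable_sq_defect (abs_sq_defect_le hm))]
  have : (Function.support fun d : Divisions m => 1 - ∑ i, pieceLen d i ^ 2) = Set.univ := by
    ext d
    simpa using (sub_pos.2 (sum_pieceLen_sq_lt hm d)).ne'
  rw [this, measure_univ]
  exact one_pos

theorem measurable_small_sq (δ : ℝ) (n : ℕ) :
    Measurable fun D : ℕ → Divisions m => if maxLen D n ≤ δ then maxLen D n ^ 2 else 0 :=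
  Measurable.ite (measurableSet_le (measurable_maxLen n) measurable_const)
    ((measurable_maxLen n).pow_const 2) measurable_const

theorem abs_small_sq_le (D : ℕ → Divisions m) (δ : ℝ) (n : ℕ) :
    |if maxLen D n ≤ δ then maxLen D n ^ 2 else 0| ≤ 1 := by
  have h0 := maxLen_pos D n
  have h1 := maxLen_le_one D n
  split_ifs
  · rw [abs_of_nonneg (sq_nonneg _)]; nlinarith
  · simp

/-- The largest length at time `n` does not depend on the division points used next, so the
expectation of each summand in `sum_maxLen_sq_le` factors, with `sqDefect lam` as second factor. -/
theorem sum_integral_maxLen_sq_le (hm : 0 < m) {δ : ℝ} (hδ : 0 ≤ δ) (N : ℕ) :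
    ∑ n ∈ Finset.range N, ∫ D, (if maxLen D n ≤ δ then maxLen D n ^ 2 else 0) ∂(seqLaw lam) ≤
      δ / sqDefect lam := by
  rw [le_div_iff₀ (sqDefect_pos lam hm), Finset.sum_mul]
  have hb : ∀ n (D : ℕ → Divisions m) (d : Divisions m),
      |(if maxLen D n ≤ δ then maxLen D n ^ 2 else 0) * (1 - ∑ i, pieceLen d i ^ 2)| ≤ 1 := by
    intro n D d
    rw [abs_mul]
    exact mul_le_one₀ (abs_small_sq_le D δ n) (abs_nonneg _) (abs_sq_defect_le hm d)
  have hmeas : ∀ n, Measurable (Function.uncurry fun (D : ℕ → Divisions m) (d : Divisions m) =>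
      (if maxLen D n ≤ δ then maxLen D n ^ 2 else 0) * (1 - ∑ i, pieceLen d i ^ 2)) := fun n =>
    ((measurable_small_sq δ n).comp measurable_fst).mul (measurable_sq_defect.comp measurable_snd)
  have h1 : ∀ n, (∫ D, (if maxLen D n ≤ δ then maxLen D n ^ 2 else 0) ∂(seqLaw lam)) *
      sqDefect lam = ∫ D, (if maxLen D n ≤ δ then maxLen D n ^ 2 else 0) *
        (1 - ∑ i, pieceLen (D n) i ^ 2) ∂(seqLaw lam) := by
    intro n
    rw [integral_freeze lam n (hmeas n) (hb n)
      (fun x d e => by simp only [maxLen_update x le_rfl e])]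
    simp only [integral_const_mul]
    rw [integral_mul_const]
    rfl
  have hint : ∀ n, Integrable (fun D : ℕ → Divisions m =>
      (if maxLen D n ≤ δ then maxLen D n ^ 2 else 0) * (1 - ∑ i, pieceLen (D n) i ^ 2))
      (seqLaw lam) := by
    intro n
    have h2 : Measurable fun D : ℕ → Divisions m =>
        (if maxLen D n ≤ δ then maxLen D n ^ 2 else 0) * (1 - ∑ i, pieceLen (D n) i ^ 2) :=
      (measurable_small_sq δ n).mul (measurable_sq_defect.comp (measurable_pi_apply n))
    exact integrable_of_bound h2 fun D => hb n D (D n)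
  simp only [h1]
  rw [← integral_finsetSum _ fun n _ => hint n]
  calc _ ≤ ∫ _, δ ∂(seqLaw lam) := by
        refine integral_mono (integrable_finsetSum _ fun n _ => hint n) (integrable_const _)
          fun D => ?_
        simpa only [ite_mul, zero_mul] using sum_maxLen_sq_le D hδ N
    _ = δ := by simp

/-- The case `δ = 1` of the previous bound makes the sum of the squared largest lengths integrable,
so almost surely its terms tend to 0. -/
theorem ae_tendsto_maxLen (hm : 0 < m) :
    ∀ᵐ D ∂(seqLaw lam), Tendsto (maxLen D) atTop (𝓝 0) := by
  have hle : ∫⁻ D, ∑' n, ENNReal.ofReal (maxLen D n ^ 2) ∂(seqLaw lam) ≤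
      ENNReal.ofReal (1 / sqDefect lam) := by
    rw [lintegral_tsum fun n => ((measurable_maxLen n).pow_const 2).ennreal_ofReal.aemeasurable]
    refine ENNReal.tsum_le_of_sum_range_le fun N => ?_
    have h1 : ∀ n, ∫⁻ D, ENNReal.ofReal (maxLen D n ^ 2) ∂(seqLaw lam) =
        ENNReal.ofReal (∫ D, (if maxLen D n ≤ 1 then maxLen D n ^ 2 else 0) ∂(seqLaw lam)) := by
      intro n
      rw [ofReal_integral_eq_lintegral_ofReal
        (integrable_of_bound (measurable_small_sq 1 n) fun D => abs_small_sq_le D 1 n)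
        (ae_of_all _ fun D => by dsimp only; split_ifs; exacts [sq_nonneg _, le_rfl])]
      simp only [maxLen_le_one, if_true]
    simp only [h1]
    rw [← ENNReal.ofReal_sum_of_nonneg]
    · exact ENNReal.ofReal_le_ofReal (sum_integral_maxLen_sq_le lam hm zero_le_one N)
    · intro n _
      exact integral_nonneg fun D => by dsimp only; split_ifs; exacts [sq_nonneg _, le_rfl]
  have hfin := ae_lt_top' (AEMeasurable.tsum fun n =>
    ((measurable_maxLen (m := m) n).pow_const 2).ennreal_ofReal.aemeasurable)
    (hle.trans_lt ENNReal.ofReal_lt_top).ne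
  filter_upwards [hfin] with D hD
  have h2 := ENNReal.tendsto_atTop_zero_of_tsum_ne_top hD.ne
  have h3 := (ENNReal.tendsto_toReal ENNReal.zero_ne_top).comp h2
  have h4 : Tendsto (fun n => maxLen D n ^ 2) atTop (𝓝 0) := by
    refine h3.congr fun n => ?_
    simp only [Function.comp, ENNReal.toReal_ofReal (sq_nonneg (maxLen D n))]
  have h5 := (Real.continuous_sqrt.tendsto 0).comp h4
  rw [Real.sqrt_zero] at h5
  exact h5.congr fun n => Real.sqrt_sq (maxLen_pos D n).le

end Law

/-- Random variables with summable second moments tend to zero; a double-sequence version which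
does not presuppose convergence in the inner index. -/
theorem ae_eventually_frequently_lt {Ω : Type*} [MeasurableSpace Ω] {μ : Measure Ω}
    {T : ℕ → ℕ → Ω → ℝ} (hT : ∀ k N, Measurable (T k N))
    (hi : ∀ k N, Integrable (fun ω => T k N ω ^ 2) μ) {B : ℕ → ℝ} (hB : Summable B)
    (h : ∀ k N, ∫ ω, T k N ω ^ 2 ∂μ ≤ B k) :
    ∀ᵐ ω ∂μ, ∀ e > 0, ∀ᶠ k in atTop, ∃ᶠ N in atTop, |T k N ω| < e := by
  have hB0 : ∀ k, 0 ≤ B k := fun k => (integral_nonneg fun ω => sq_nonneg _).trans (h k 0)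
  have hm : ∀ k N, Measurable fun ω => ENNReal.ofReal (T k N ω ^ 2) := fun k N =>
    ((hT k N).pow_const 2).ennreal_ofReal
  have hf : ∀ k, Measurable fun ω => liminf (fun N => ENNReal.ofReal (T k N ω ^ 2)) atTop :=
    fun k => Measurable.liminf (hm k)
  -- Fatou's lemma in `N`; the resulting bounds are then summed over `k`.
  have h1 : ∀ k, ∫⁻ ω, liminf (fun N => ENNReal.ofReal (T k N ω ^ 2)) atTop ∂μ ≤
      ENNReal.ofReal (B k) := by
    intro k
    refine (lintegral_liminf_le (hm k)).trans ?_
    refine liminf_le_of_le (by isBoundedDefault) fun b hb => ?_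
    obtain ⟨N, hN⟩ := hb.exists
    refine hN.trans ?_
    rw [← ofReal_integral_eq_lintegral_ofReal (hi k N) (ae_of_all _ fun ω => sq_nonneg _)]
    exact ENNReal.ofReal_le_ofReal (h k N)
  have h2 : ∫⁻ ω, ∑' k, liminf (fun N => ENNReal.ofReal (T k N ω ^ 2)) atTop ∂μ ≠ ⊤ := by
    rw [lintegral_tsum fun k => (hf k).aemeasurable]
    refine ((ENNReal.tsum_le_tsum h1).trans_lt ?_).ne
    rw [← ENNReal.ofReal_tsum_of_nonneg hB0 hB]
    exact ENNReal.ofReal_lt_top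
  filter_upwards [ae_lt_top' (AEMeasurable.tsum fun k => (hf k).aemeasurable) h2] with ω hω e he
  have h3 := ENNReal.tendsto_atTop_zero_of_tsum_ne_top hω.ne
  filter_upwards [h3.eventually (gt_mem_nhds (ENNReal.ofReal_pos.2 (pow_pos he 2)))] with k hk
  refine (frequently_lt_of_liminf_lt (by isBoundedDefault) hk).mono fun N hN => ?_
  exact lt_of_pow_lt_pow_left₀ 2 he.le
    (by rw [sq_abs]; exact (ENNReal.ofReal_lt_ofReal_iff (pow_pos he 2)).1 hN)

/-! ### Small pieces -/

/-- The number of pieces of length at most `η`. -/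
def smallCount (η : ℝ) (d : Divisions m) : ℝ := ∑ i, if pieceLen d i ≤ η then 1 else 0

theorem measurable_smallCount (η : ℝ) : Measurable (smallCount (m := m) η) :=
  Finset.measurable_sum _ fun i _ =>
    Measurable.ite (measurableSet_le (measurable_pieceLen i) measurable_const)
      measurable_const measurable_const

theorem smallCount_nonneg (η : ℝ) (d : Divisions m) : 0 ≤ smallCount η d :=
  Finset.sum_nonneg fun i _ => by split_ifs <;> simp

theorem abs_smallCount_le (η : ℝ) (d : Divisions m) : |smallCount η d| ≤ m + 1 := by
  rw [abs_of_nonneg (smallCount_nonneg η d)]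
  calc smallCount η d ≤ ∑ _i : Option (Fin m), (1 : ℝ) :=
        Finset.sum_le_sum fun i _ => by split_ifs <;> simp
    _ = m + 1 := by simp

/-- Short intervals are counted by the short pieces among the splittings so far. -/
theorem intervalSum_small_le (D : ℕ → Divisions m) {z η : ℝ} (hz : z < 1) (n : ℕ)
    (h : ∀ j < n, z ≤ η * maxLen D j) :
    intervalSum D n (fun _ s => if s ≤ z then 1 else 0) ≤
      ∑ j ∈ Finset.range n, smallCount η (D j) := by
  induction n with
  | zero => rw [intervalSum_zero, if_neg (not_le.2 hz)]; simp
  | succ n ih =>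
    rw [intervalSum_succ, Finset.sum_range_succ]
    have h1 := ih fun j hj => h j (hj.trans (Nat.lt_succ_self n))
    have h2 : (0 : ℝ) ≤ if maxLen D n ≤ z then 1 else 0 := by split_ifs <;> simp
    have h3 : ∑ i, (if maxLen D n * pieceLen (D n) i ≤ z then (1 : ℝ) else 0) ≤
        smallCount η (D n) := by
      refine Finset.sum_le_sum fun i _ => ?_
      split_ifs with ha hb
      · exact le_rfl
      · refine absurd ?_ hb
        have h4 := h n (Nat.lt_succ_self n)
        have h5 := maxLen_pos D n
        exact le_of_mul_le_mul_left (by linarith) h5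
      · exact zero_le_one
      · exact le_rfl
    linarith

section Law

variable (lam : Measure (Divisions m)) [IsProbabilityMeasure lam]

/-- The mean number of pieces of length at most `η`. -/
def meanSmall (η : ℝ) : ℝ := ∫ d, smallCount η d ∂lam

/-- Every piece has positive length, so no piece is counted once the level is small; the number of
pieces dominates. -/
theorem tendsto_meanSmall {η : ℕ → ℝ} (hη : Tendsto η atTop (𝓝 0)) :
    Tendsto (fun j => meanSmall lam (η j)) atTop (𝓝 0) := by
  have : Tendsto (fun j => meanSmall lam (η j)) atTop (𝓝 (∫ _, (0 : ℝ) ∂lam)) := by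
    refine tendsto_integral_of_dominated_convergence (fun _ => (m : ℝ) + 1)
      (fun j => (measurable_smallCount _).aestronglyMeasurable) (integrable_const _)
      (fun j => ae_of_all _ fun d => abs_smallCount_le _ d) (ae_of_all _ fun d => ?_)
    refine tendsto_const_nhds.congr' ?_
    have h1 : ∀ i, ∀ᶠ j in atTop, η j < pieceLen d i := fun i =>
      hη.eventually (gt_mem_nhds (pieceLen_pos d i))
    filter_upwards [eventually_all.2 h1] with j hj
    simp [smallCount, not_le.2 (hj _)]
  simpa using this

theorem ae_tendsto_average {f : Divisions m → ℝ} (hf : Measurable f) {C : ℝ}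
    (hC : ∀ d, |f d| ≤ C) :
    ∀ᵐ D ∂(seqLaw lam), Tendsto (fun n : ℕ => (∑ j ∈ Finset.range n, f (D j)) / n) atTop
      (𝓝 (∫ d, f d ∂lam)) := by
  have hmp : ∀ j, MeasurePreserving (fun D : ℕ → Divisions m => D j) (seqLaw lam) lam := fun j =>
    measurePreserving_eval_infinitePi (fun _ : ℕ => lam) j
  have hid : ∀ j, IdentDistrib (fun D : ℕ → Divisions m => f (D j)) (fun D => f (D 0))
      (seqLaw lam) (seqLaw lam) := fun j =>
    IdentDistrib.comp (u := f) ⟨(hmp j).measurable.aemeasurable, (hmp 0).measurable.aemeasurable,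
      by rw [(hmp j).map_eq, (hmp 0).map_eq]⟩ hf
  have hind : iIndepFun (fun j (D : ℕ → Divisions m) => f (D j)) (seqLaw lam) :=
    iIndepFun_infinitePi (P := fun _ : ℕ => lam) (X := fun _ => f) fun _ => hf
  have h := strong_law_ae_real (fun j (D : ℕ → Divisions m) => f (D j))
    (integrable_of_bound (hf.comp (measurable_pi_apply 0)) fun D => hC _)
    (fun i j hij => hind.indepFun hij) hid
  have h2 : ∫ D, f (D 0) ∂(seqLaw lam) = ∫ d, f d ∂lam := by
    conv_rhs => rw [← (hmp 0).map_eq]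
    rw [integral_map (hmp 0).measurable.aemeasurable hf.aestronglyMeasurable]
  rw [h2] at h
  exact h

end Law

/-! ### Splitting down to a threshold -/

/-- The number of splittings after which no interval is longer than `ε`. -/
def tau (D : ℕ → Divisions m) (ε : ℝ) : ℕ := sInf {n | maxLen D n ≤ ε}

/-- Convergence to 0 makes the set defining `tau` nonempty, which excludes the default value 0 of
its infimum; the rest is monotonicity of `maxLen`. -/
theorem lt_tau_iff {D : ℕ → Divisions m} (hD : Tendsto (maxLen D) atTop (𝓝 0)) {ε : ℝ}
    (hε : 0 < ε) {n : ℕ} : n < tau D ε ↔ ε < maxLen D n := by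
  constructor
  · intro h
    exact not_le.1 fun hle => Nat.notMem_of_lt_sInf h hle
  · intro h
    by_contra hle
    have hmem : maxLen D (tau D ε) ≤ ε :=
      Nat.sInf_mem (s := {n | maxLen D n ≤ ε}) (hD.eventually (ge_mem_nhds hε)).exists
    exact absurd ((maxLen_antitone D (not_lt.1 hle)).trans hmem) (not_le.2 h)

theorem maxLen_tau_le {D : ℕ → Divisions m} (hD : Tendsto (maxLen D) atTop (𝓝 0)) {ε : ℝ}
    (hε : 0 < ε) : maxLen D (tau D ε) ≤ ε :=
  not_lt.1 fun h => lt_irrefl _ ((lt_tau_iff hD hε).2 h)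

theorem tendsto_tau {D : ℕ → Divisions m} (hD : Tendsto (maxLen D) atTop (𝓝 0)) {ε : ℕ → ℝ}
    (hε : ∀ k, 0 < ε k) (h : Tendsto ε atTop (𝓝 0)) :
    Tendsto (fun k => tau D (ε k)) atTop atTop := by
  refine tendsto_atTop.2 fun n => ?_
  filter_upwards [h.eventually (gt_mem_nhds (maxLen_pos D n))] with k hk
  exact ((lt_tau_iff hD (hε k)).2 hk).le

/-- One step before `tau D ε` the largest length still exceeds `ε`, so the bound on `n * maxLen D n`
applies there; the extra `ε` pays for the last step. -/
theorem tau_mul_le {D : ℕ → Divisions m} (hD : Tendsto (maxLen D) atTop (𝓝 0)) {C : ℝ}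
    (hC : ∀ n : ℕ, n * maxLen D n ≤ C) {ε : ℝ} (hε : 0 < ε) : tau D ε * ε ≤ C + ε := by
  rcases Nat.eq_zero_or_pos (tau D ε) with h | h
  · have := hC 0
    rw [h]
    simp at this ⊢
    linarith
  · obtain ⟨n, hn⟩ : ∃ n, tau D ε = n + 1 := ⟨tau D ε - 1, by omega⟩
    have h1 := (lt_tau_iff hD hε).1 (by omega : n < tau D ε)
    have h2 := hC n
    rw [hn]
    push_cast
    nlinarith [mul_le_mul_of_nonneg_left h1.le (Nat.cast_nonneg (α := ℝ) n)]

/-! ### Cuts and the martingale of weighted sums -/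

/-- The endpoint `p` of an interval is present, and determined, after `k₀` splittings. -/
structure IsCut (k₀ : ℕ) (p : (ℕ → Divisions m) → ℝ) : Prop where
  measurable : Measurable p
  update : ∀ k, k₀ ≤ k → ∀ D e, p (Function.update D k e) = p D
  mem : ∀ D, p D ∈ insert 1 (leftEnds (part D k₀))

theorem IsCut.mem_of_le {k₀ : ℕ} {p : (ℕ → Divisions m) → ℝ} (hp : IsCut k₀ p)
    (D : ℕ → Divisions m) {n : ℕ} (h : k₀ ≤ n) : p D ∈ insert 1 (leftEnds (part D n)) :=
  Finset.insert_subset_insert _ (leftEnds_part_mono D h) (hp.mem D)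

theorem isCut_one : IsCut (m := m) 0 fun _ => 1 :=
  ⟨measurable_const, fun _ _ _ _ => rfl, fun _ => Finset.mem_insert_self _ _⟩

/-- The change of `∑ s H (s / ε)`, over intervals of length `s` to the left of `p`, in a splitting
of an interval of length in `(ε, δ]`. -/
def fluct (k₀ : ℕ) (p : (ℕ → Divisions m) → ℝ) (H : ℝ → ℝ) (ε δ : ℝ) (n : ℕ)
    (D : ℕ → Divisions m) (d : Divisions m) : ℝ :=
  if k₀ ≤ n ∧ maxLeft D n < p D ∧ ε < maxLen D n ∧ maxLen D n ≤ δ then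
    maxLen D n * (∑ i, pieceLen d i * H (maxLen D n / ε * pieceLen d i) - H (maxLen D n / ε))
  else 0

section Fluct

variable {k₀ : ℕ} {p : (ℕ → Divisions m) → ℝ} {H : ℝ → ℝ} {C : ℝ}

theorem measurable_fluct (hp : IsCut k₀ p) (hH : Measurable H) (ε δ : ℝ) (n : ℕ) :
    Measurable (Function.uncurry (fluct k₀ p H ε δ n)) := by
  have hM : Measurable fun z : (ℕ → Divisions m) × Divisions m => maxLen z.1 n :=
    (measurable_maxLen n).comp measurable_fst
  have hset : MeasurableSet {z : (ℕ → Divisions m) × Divisions m |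
      k₀ ≤ n ∧ maxLeft z.1 n < p z.1 ∧ ε < maxLen z.1 n ∧ maxLen z.1 n ≤ δ} :=
    (MeasurableSet.const _).inter ((measurableSet_lt ((measurable_maxLeft n).comp measurable_fst)
      (hp.measurable.comp measurable_fst)).inter ((measurableSet_lt measurable_const hM).inter
        (measurableSet_le hM measurable_const)))
  refine Measurable.ite hset (hM.mul ((Finset.measurable_sum _ fun i _ => ?_).sub
    (hH.comp (hM.div_const ε)))) measurable_const
  have hL : Measurable fun z : (ℕ → Divisions m) × Divisions m => pieceLen z.2 i :=
    (measurable_pieceLen i).comp measurable_snd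
  exact hL.mul (hH.comp ((hM.div_const ε).mul hL))

theorem measurable_fluct_apply (hp : IsCut k₀ p) (hH : Measurable H) (ε δ : ℝ) (n : ℕ) :
    Measurable fun D : ℕ → Divisions m => fluct k₀ p H ε δ n D (D n) := by
  have h1 : Measurable fun D : ℕ → Divisions m => (D, D n) :=
    measurable_id.prodMk (measurable_pi_apply n)
  have h2 := (measurable_fluct hp hH ε δ n).comp h1
  simpa only [Function.comp_def, Function.uncurry_apply_pair] using h2

theorem abs_fluct_le (hH0 : ∀ r, 0 ≤ H r) (hHC : ∀ r, H r ≤ C) (ε δ : ℝ) (n : ℕ)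
    (D : ℕ → Divisions m) (d : Divisions m) :
    |fluct k₀ p H ε δ n D d| ≤ C * if maxLen D n ≤ δ then maxLen D n else 0 := by
  have hC0 : 0 ≤ C := (hH0 0).trans (hHC 0)
  have hM := maxLen_pos D n
  rw [fluct]
  split_ifs with h1 h2 h2
  · rw [abs_mul, abs_of_pos hM, mul_comm]
    refine mul_le_mul_of_nonneg_right ?_ hM.le
    have e1 : 0 ≤ ∑ i, pieceLen d i * H (maxLen D n / ε * pieceLen d i) :=
      Finset.sum_nonneg fun i _ => mul_nonneg (pieceLen_pos d i).le (hH0 _)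
    have e2 : ∑ i, pieceLen d i * H (maxLen D n / ε * pieceLen d i) ≤ C := by
      calc _ ≤ ∑ i, pieceLen d i * C := Finset.sum_le_sum fun i _ =>
            mul_le_mul_of_nonneg_left (hHC _) (pieceLen_pos d i).le
        _ = C := by rw [← Finset.sum_mul, sum_pieceLen, one_mul]
    rw [abs_le]
    constructor <;> linarith [hH0 (maxLen D n / ε), hHC (maxLen D n / ε)]
  · exact absurd h1.2.2.2 h2
  · rw [abs_zero]; positivity
  · simp

/-- Before time `k₀` the cut may depend on the resampled coordinate; for this reason `fluct` is set
to 0 there. -/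
theorem fluct_update (hp : IsCut k₀ p) (ε δ : ℝ) {n k : ℕ} (h : n ≤ k) (D : ℕ → Divisions m)
    (d e : Divisions m) :
    fluct k₀ p H ε δ n (Function.update D k e) d = fluct k₀ p H ε δ n D d := by
  by_cases hk : k₀ ≤ n
  · simp only [fluct, maxLen_update D h, maxLeft_update D h, hp.update k (hk.trans h)]
  · simp [fluct, hk]

/-- The martingale property: harmonicity is needed only at `maxLen D n / ε`, which exceeds 1 by the
condition in `fluct`. -/
theorem integral_fluct (lam : Measure (Divisions m)) [IsProbabilityMeasure lam]
    (hH : Measurable H) (hH0 : ∀ r, 0 ≤ H r) (hHC : ∀ r, H r ≤ C)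
    (hharm : ∀ r, 1 < r → ∫ d, ∑ i, pieceLen d i * H (r * pieceLen d i) ∂lam = H r)
    {ε : ℝ} (hε : 0 < ε) (δ : ℝ) (n : ℕ) (D : ℕ → Divisions m) :
    ∫ d, fluct k₀ p H ε δ n D d ∂lam = 0 := by
  by_cases h : k₀ ≤ n ∧ maxLeft D n < p D ∧ ε < maxLen D n ∧ maxLen D n ≤ δ
  · simp only [fluct, h, and_self, if_true]
    rw [integral_const_mul, integral_sub, hharm _ ((one_lt_div hε).2 h.2.2.1)]
    · simp
    · refine integrable_finsetSum _ fun i _ => integrable_of_bound (C := C)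
        ((measurable_pieceLen i).mul (hH.comp (measurable_const.mul (measurable_pieceLen i))))
        fun d => ?_
      rw [abs_mul, abs_of_pos (pieceLen_pos d i), abs_of_nonneg (hH0 _)]
      exact (mul_le_of_le_one_left (hH0 _) (pieceLen_le_one d i)).trans (hHC _)
    · exact integrable_const _
  · simp only [fluct, h, if_false, integral_zero]

/-- Orthogonality leaves the sum of the squared increments, each at most `C` times a length not
exceeding `δ`. The bound is uniform in `N` and `ε`. -/
theorem integral_sum_fluct_sq_le (lam : Measure (Divisions m)) [IsProbabilityMeasure lam]
    (hm : 0 < m) (hp : IsCut k₀ p) (hH : Measurable H) (hH0 : ∀ r, 0 ≤ H r)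
    (hHC : ∀ r, H r ≤ C)
    (hharm : ∀ r, 1 < r → ∫ d, ∑ i, pieceLen d i * H (r * pieceLen d i) ∂lam = H r)
    {ε δ : ℝ} (hε : 0 < ε) (hδ : 0 ≤ δ) (N : ℕ) :
    ∫ D, (∑ n ∈ Finset.range N, fluct k₀ p H ε δ n D (D n)) ^ 2 ∂(seqLaw lam) ≤
      C ^ 2 * (δ / sqDefect lam) := by
  have hC0 : 0 ≤ C := (hH0 0).trans (hHC 0)
  have hb : ∀ n (D : ℕ → Divisions m) d, |fluct k₀ p H ε δ n D d| ≤ C := fun n D d => by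
    refine (abs_fluct_le hH0 hHC ε δ n D d).trans (mul_le_of_le_one_right hC0 ?_)
    split_ifs
    · exact maxLen_le_one D n
    · exact zero_le_one
  rw [integral_sum_sq lam (measurable_fluct hp hH ε δ) hb
    (fun n k h D d e => fluct_update hp ε δ h D d e)
    (integral_fluct lam hH hH0 hHC hharm hε δ)]
  refine le_trans ?_ (mul_le_mul_of_nonneg_left (sum_integral_maxLen_sq_le lam hm hδ N)
    (sq_nonneg C))
  rw [Finset.mul_sum]
  refine Finset.sum_le_sum fun n _ => ?_
  rw [← integral_const_mul]
  have hmeas : Measurable fun D : ℕ → Divisions m => fluct k₀ p H ε δ n D (D n) ^ 2 :=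
    (measurable_fluct_apply hp hH ε δ n).pow_const 2
  refine integral_mono (integrable_of_bound (C := C ^ 2) hmeas fun D => ?_)
    ((integrable_of_bound (measurable_small_sq δ n)
      fun D => abs_small_sq_le D δ n).const_mul _) fun D => ?_
  · rw [abs_pow]; exact pow_le_pow_left₀ (abs_nonneg _) (hb n D _) 2
  · have h1 := abs_fluct_le (k₀ := k₀) (p := p) hH0 hHC ε δ n D (D n)
    have h2 := pow_le_pow_left₀ (abs_nonneg _) h1 2
    rw [sq_abs, mul_pow] at h2
    refine h2.trans_eq ?_
    simp only [ite_pow, ne_eq, OfNat.ofNat_ne_zero, not_false_eq_true, zero_pow]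

/-- The sum of `s H (s / ε)` over the intervals of length `s` to the left of `p`. -/
def weightedSum (p : (ℕ → Divisions m) → ℝ) (H : ℝ → ℝ) (ε : ℝ) (D : ℕ → Divisions m)
    (n : ℕ) : ℝ :=
  intervalSum D n fun q s => if q < p D then s * H (s / ε) else 0

/-- From time `k₀` on the cut is an endpoint, so the interval that is split and all its pieces lie
on the same side of it. -/
theorem weightedSum_succ (hp : IsCut k₀ p) (ε : ℝ) (D : ℕ → Divisions m) {n : ℕ} (h : k₀ ≤ n) :
    weightedSum p H ε D (n + 1) = weightedSum p H ε D n + if maxLeft D n < p D then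
      maxLen D n * (∑ i, pieceLen (D n) i * H (maxLen D n / ε * pieceLen (D n) i) -
        H (maxLen D n / ε)) else 0 := by
  rw [weightedSum, intervalSum_succ, ← weightedSum]
  simp only [maxLeft_add_lt_iff D n (hp.mem_of_le D h)]
  split_ifs
  · rw [mul_sub, Finset.mul_sum]
    have : ∀ i, maxLen D n * pieceLen (D n) i * H (maxLen D n * pieceLen (D n) i / ε) =
        maxLen D n * (pieceLen (D n) i * H (maxLen D n / ε * pieceLen (D n) i)) := by
      intro i
      rw [mul_assoc, mul_div_right_comm]
    simp only [this]
    ring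
  · simp

/-- The intervals split between the two threshold times are exactly those whose length at the
splitting lies in `(ε, δ]`, so the increments telescope. Outside this period they vanish, and the
sum is constant in `N` from `tau D ε` on. -/
theorem sum_fluct (hp : IsCut k₀ p) {D : ℕ → Divisions m} (hD : Tendsto (maxLen D) atTop (𝓝 0))
    {ε δ : ℝ} (hε : 0 < ε) (hδ : ε ≤ δ) (hk : k₀ ≤ tau D δ) {N : ℕ} (hN : tau D ε ≤ N) :
    ∑ n ∈ Finset.range N, fluct k₀ p H ε δ n D (D n) =
      weightedSum p H ε D (tau D ε) - weightedSum p H ε D (tau D δ) := by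
  have hδ0 : 0 < δ := hε.trans_le hδ
  have hle : tau D δ ≤ tau D ε := by
    by_contra hlt
    have := (lt_tau_iff hD hδ0).1 (not_le.1 hlt)
    exact absurd ((maxLen_tau_le hD hε).trans hδ) (not_le.2 this)
  have key : ∀ N, ∑ n ∈ Finset.range N, fluct k₀ p H ε δ n D (D n) =
      weightedSum p H ε D (max (tau D δ) (min N (tau D ε))) - weightedSum p H ε D (tau D δ) := by
    intro N
    induction N with
    | zero => simp
    | succ N ih =>
      rw [Finset.sum_range_succ, ih]
      rcases lt_or_ge N (tau D δ) with h1 | h1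
      · have h2 := (lt_tau_iff hD hδ0).1 h1
        have h3 : fluct k₀ p H ε δ N D (D N) = 0 := by
          rw [fluct, if_neg]
          rintro ⟨-, -, -, h⟩
          exact absurd h (not_le.2 h2)
        rw [h3, max_eq_left (by omega), max_eq_left (by omega)]
        ring
      · rcases lt_or_ge N (tau D ε) with h2 | h2
        · have e1 : max (tau D δ) (min N (tau D ε)) = N := by omega
          have e2 : max (tau D δ) (min (N + 1) (tau D ε)) = N + 1 := by omega
          have h3 := (lt_tau_iff hD hε).1 h2
          have h4 : maxLen D N ≤ δ := not_lt.1 fun h => absurd ((lt_tau_iff hD hδ0).2 h) (by omega)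
          rw [e1, e2, weightedSum_succ hp ε D (hk.trans h1), fluct]
          simp only [hk.trans h1, h3, h4, and_true, true_and]
          ring
        · have h3 : fluct k₀ p H ε δ N D (D N) = 0 := by
            rw [fluct, if_neg]
            rintro ⟨-, -, h, -⟩
            exact absurd ((lt_tau_iff hD hε).2 h) (by omega)
          have e1 : min (N + 1) (tau D ε) = min N (tau D ε) := by omega
          rw [h3, e1]
          ring
  rw [key, min_eq_right hN, max_eq_right hle]

/-- The lengths left of the cut add up to `p D`. Intervals of length at least `A * ε` contribute an
error of at most `e` in total; each of the others contributes at most `C * A * ε`, and there are at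
most `n * m + 1` of them. -/
theorem abs_weightedSum_sub_le (hp : IsCut k₀ p) {D : ℕ → Divisions m} {n : ℕ} (h : k₀ ≤ n)
    {ε : ℝ} (hε : 0 < ε) {c A e C : ℝ} (hA : 0 ≤ A) (he : 0 ≤ e) (hC : ∀ r, |H r - c| ≤ C)
    (hlarge : ∀ r, A ≤ r → |H r - c| ≤ e) :
    |weightedSum p H ε D n - p D * c| ≤ e + C * A * ε * (n * m + 1) := by
  have hC0 : 0 ≤ C := (abs_nonneg _).trans (hC 0)
  have e1 : weightedSum p H ε D n - p D * c =
      intervalSum D n fun q s => if q < p D then s * (H (s / ε) - c) else 0 := by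
    have h1 : -(p D * c) = intervalSum D n fun q s => -c * if q < p D then s else 0 := by
      rw [intervalSum_mul, intervalSum_spacing_lt D n (hp.mem_of_le D h)]
      ring
    rw [weightedSum, sub_eq_add_neg, h1, ← intervalSum_add]
    refine intervalSum_congr D n fun q s _ _ _ _ => ?_
    split_ifs <;> ring
  rw [e1]
  have e2 : e + C * A * ε * (n * m + 1) =
      intervalSum D n fun _ s => e * s + C * A * ε * 1 := by
    rw [intervalSum_add D n (fun _ s => e * s) (fun _ _ => C * A * ε * 1),
      intervalSum_mul D n e (fun _ s => s), intervalSum_mul D n _ (fun _ _ => 1),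
      intervalSum_spacing, intervalSum_one, mul_one]
  rw [e2]
  refine (Finset.abs_sum_le_sum_abs _ _).trans ?_
  change intervalSum D n (fun q s => |if q < p D then s * (H (s / ε) - c) else 0|) ≤ _
  refine intervalSum_le D n fun q s _ _ hs _ => ?_
  have h0 : 0 ≤ e * s := mul_nonneg he hs.le
  have h1 : 0 ≤ C * A * ε * 1 := by positivity
  split_ifs
  · rw [abs_mul, abs_of_pos hs]
    rcases le_total A (s / ε) with ha | ha
    · have := mul_le_mul_of_nonneg_left (hlarge _ ha) hs.le
      linarith
    · have h2 : s ≤ A * ε := (div_le_iff₀ hε).1 ha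
      have h3 := mul_le_mul_of_nonneg_left (hC (s / ε)) hs.le
      have h4 := mul_le_mul_of_nonneg_right h2 hC0
      linarith
  · rw [abs_zero]; linarith

end Fluct

/-! ### Almost sure limits along a grid of thresholds -/

/-- A summable sequence of thresholds whose ratios tend to one. -/
def grid (k : ℕ) : ℝ := 1 / ((k : ℝ) + 1) ^ 2

theorem grid_pos (k : ℕ) : 0 < grid k := by unfold grid; positivity

theorem grid_le_one (k : ℕ) : grid k ≤ 1 := by
  rw [grid, div_le_one (by positivity)]
  exact one_le_pow₀ (by linarith [Nat.cast_nonneg (α := ℝ) k])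

theorem summable_grid : Summable grid := by
  have h := (summable_nat_add_iff 1).2 (Real.summable_one_div_nat_pow.2 one_lt_two)
  refine h.congr fun k => ?_
  simp [grid]

theorem tendsto_grid : Tendsto grid atTop (𝓝 0) := summable_grid.tendsto_atTop_zero

theorem tendsto_grid_sq : Tendsto (fun k => grid k ^ 2) atTop (𝓝 0) := by
  simpa using tendsto_grid.pow 2

theorem grid_sq_le (k : ℕ) : grid k ^ 2 ≤ grid k := by
  nlinarith [grid_pos k, grid_le_one k]

/-- Levels for the truncation of short intervals. -/
def level (j : ℕ) : ℝ := 1 / ((j : ℝ) + 2)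

theorem level_pos (j : ℕ) : 0 < level j := by unfold level; positivity

theorem level_lt_one (j : ℕ) : level j < 1 := by
  rw [level, div_lt_one (by positivity)]
  linarith [Nat.cast_nonneg (α := ℝ) j]

theorem tendsto_level : Tendsto level atTop (𝓝 0) :=
  Tendsto.div_atTop tendsto_const_nhds
    (tendsto_atTop_add_const_right _ _ tendsto_natCast_atTop_atTop)

theorem intervalSum_small_add_large (D : ℕ → Divisions m) (n : ℕ) (z p : ℝ) :
    intervalSum D n (fun q s => if q < p ∧ z < s then 1 else 0) +
      intervalSum D n (fun q s => if q < p ∧ s ≤ z then 1 else 0) =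
      intervalSum D n (fun q _ => if q < p then 1 else 0) := by
  rw [← intervalSum_add]
  refine intervalSum_congr D n fun q s _ _ _ _ => ?_
  by_cases h1 : q < p <;> by_cases h2 : z < s
  · simp [h1, h2]
  · simp [h1, h2, not_lt.1 h2]
  · simp [h1]
  · simp [h1]

section Law

variable (lam : Measure (Divisions m)) [IsProbabilityMeasure lam]

theorem ae_tendsto_average_smallCount :
    ∀ᵐ D ∂(seqLaw lam), ∀ j : ℕ, Tendsto
      (fun n : ℕ => (∑ i ∈ Finset.range n, smallCount (level j) (D i)) / n) atTop
      (𝓝 (meanSmall lam (level j))) :=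
  ae_all_iff.2 fun _ => ae_tendsto_average lam (measurable_smallCount _) (abs_smallCount_le _)

/-- The length of the largest interval decreases at least like the inverse of the number of
splittings. -/
theorem exists_mul_maxLen_le (hm : 0 < m) {D : ℕ → Divisions m}
    (hD : ∀ j : ℕ, Tendsto (fun n : ℕ => (∑ i ∈ Finset.range n, smallCount (level j) (D i)) / n)
      atTop (𝓝 (meanSmall lam (level j)))) :
    ∃ C : ℝ, ∀ n : ℕ, n * maxLen D n ≤ C := by
  -- With η = `level j`, eventually fewer than n/2 intervals have length at most η `maxLen D n`. As
  -- the total length is 1, at most 1/(η `maxLen D n`) are longer; comparison with the number n m +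
  -- 1 of all intervals bounds n `maxLen D n` by 2/η.
  obtain ⟨j, hj⟩ := ((tendsto_meanSmall lam tendsto_level).eventually
    (gt_mem_nhds (by norm_num : (0 : ℝ) < 1 / 2))).exists
  obtain ⟨n₀, hn₀⟩ := eventually_atTop.1 ((hD j).eventually (gt_mem_nhds hj))
  have hη := level_pos j
  -- The summand `n₀` takes care of `n < n₀`, where lengths are at most 1.
  refine ⟨n₀ + 2 / level j, fun n => ?_⟩
  have hM := maxLen_pos D n
  have h2 : 0 < 2 / level j := by positivity
  rcases lt_or_ge n n₀ with hn | hn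
  · have : (n : ℝ) ≤ n₀ := by exact_mod_cast hn.le
    nlinarith [maxLen_le_one D n, Nat.cast_nonneg (α := ℝ) n]
  rcases Nat.eq_zero_or_pos n with rfl | hpos
  · simp; positivity
  have hn' : (0 : ℝ) < n := by exact_mod_cast hpos
  have h3 := hn₀ n hn
  rw [div_lt_iff₀ hn'] at h3
  have hz : 0 < level j * maxLen D n := by positivity
  have h4 := intervalSum_small_le D (z := level j * maxLen D n) (η := level j)
    (by nlinarith [level_lt_one j, maxLen_le_one D n]) n
    (fun i hi => mul_le_mul_of_nonneg_left (maxLen_antitone D hi.le) hη.le)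
  have h5 : intervalSum D n (fun _ _ => 1) ≤
      intervalSum D n (fun _ s => (if s ≤ level j * maxLen D n then 1 else 0) +
        (level j * maxLen D n)⁻¹ * s) := by
    refine intervalSum_le D n fun q s _ _ hs _ => ?_
    split_ifs with h
    · have : 0 ≤ (level j * maxLen D n)⁻¹ * s := by positivity
      linarith
    · rw [zero_add, ← div_eq_inv_mul, one_le_div hz]
      exact (not_le.1 h).le
  rw [intervalSum_one, intervalSum_add D n (fun _ s => if s ≤ level j * maxLen D n then 1 else 0)
    (fun _ s => (level j * maxLen D n)⁻¹ * s), intervalSum_mul D n _ (fun _ s => s),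
    intervalSum_spacing, mul_one] at h5
  have hm1 : (1 : ℝ) ≤ m := by exact_mod_cast hm
  have h6 : (n : ℝ) / 2 ≤ (level j * maxLen D n)⁻¹ := by nlinarith
  have h7 := mul_le_mul_of_nonneg_right h6 hM.le
  have h8 : (level j * maxLen D n)⁻¹ * maxLen D n = 1 / level j := by
    field_simp
  rw [h8] at h7
  have h9 : 2 / level j = 2 * (1 / level j) := by ring
  have : (0 : ℝ) ≤ n₀ := Nat.cast_nonneg _
  linarith

/-- The fluctuations between consecutive scales vanish along the grid. -/
theorem ae_eventually_frequently_fluct (hm : 0 < m) {k₀ : ℕ} {p : (ℕ → Divisions m) → ℝ}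
    (hp : IsCut k₀ p) {H : ℝ → ℝ} {C : ℝ} (hH : Measurable H) (hH0 : ∀ r, 0 ≤ H r)
    (hHC : ∀ r, H r ≤ C)
    (hharm : ∀ r, 1 < r → ∫ d, ∑ i, pieceLen d i * H (r * pieceLen d i) ∂lam = H r) :
    ∀ᵐ D ∂(seqLaw lam), ∀ e > 0, ∀ᶠ k in atTop, ∃ᶠ N in atTop,
      |∑ n ∈ Finset.range N, fluct k₀ p H (grid k ^ 2) (grid k) n D (D n)| < e := by
  have hC0 : 0 ≤ C := (hH0 0).trans (hHC 0)
  have h1 : ∀ k N, Measurable fun D : ℕ → Divisions m =>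
      ∑ n ∈ Finset.range N, fluct k₀ p H (grid k ^ 2) (grid k) n D (D n) := fun k N =>
    Finset.measurable_sum _ fun n _ => measurable_fluct_apply hp hH (grid k ^ 2) (grid k) n
  have h2 : ∀ k N (D : ℕ → Divisions m),
      |∑ n ∈ Finset.range N, fluct k₀ p H (grid k ^ 2) (grid k) n D (D n)| ≤ N * C := by
    intro k N D
    have h3 : ∀ n, |fluct k₀ p H (grid k ^ 2) (grid k) n D (D n)| ≤ C := by
      intro n
      refine (abs_fluct_le hH0 hHC _ _ n D (D n)).trans (mul_le_of_le_one_right hC0 ?_)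
      split_ifs
      · exact maxLen_le_one D n
      · exact zero_le_one
    refine (Finset.abs_sum_le_sum_abs _ _).trans ((Finset.sum_le_sum fun n _ => h3 n).trans_eq ?_)
    simp
  have h4 : ∀ k N, Integrable (fun D : ℕ → Divisions m =>
      (∑ n ∈ Finset.range N, fluct k₀ p H (grid k ^ 2) (grid k) n D (D n)) ^ 2) (seqLaw lam) := by
    intro k N
    refine integrable_of_bound ((h1 k N).pow_const 2) (C := (N * C) ^ 2) fun D => ?_
    rw [abs_pow]
    exact pow_le_pow_left₀ (abs_nonneg _) (h2 k N D) 2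
  have h5 : ∀ k N, ∫ D, (∑ n ∈ Finset.range N, fluct k₀ p H (grid k ^ 2) (grid k) n D (D n)) ^ 2
      ∂(seqLaw lam) ≤ C ^ 2 * (grid k / sqDefect lam) := fun k N =>
    integral_sum_fluct_sq_le lam hm hp hH hH0 hHC hharm (pow_pos (grid_pos k) 2) (grid_pos k).le N
  exact ae_eventually_frequently_lt (T := fun k N D =>
    ∑ n ∈ Finset.range N, fluct k₀ p H (grid k ^ 2) (grid k) n D (D n)) h1 h4 ((summable_grid.div_const (sqDefect lam)).mul_left (C ^ 2)) h5

/-- The rescaled number of intervals to the left of a cut which are longer than a multiple of the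
threshold. -/
theorem ae_tendsto_tail (hm : 0 < m)
    (hac : volume.restrict (Set.Ioo (0 : ℝ) 1) ≪ lengthMeasure lam) {x : ℝ} (hx0 : 0 < x)
    (hx1 : x < 1) {k₀ : ℕ} {p : (ℕ → Divisions m) → ℝ} (hp : IsCut k₀ p) :
    ∀ᵐ D ∂(seqLaw lam), Tendsto (fun k => grid k ^ 2 * intervalSum D (tau D (grid k ^ 2))
      (fun q s => if q < p D ∧ x * grid k ^ 2 < s then 1 else 0)) atTop
      (𝓝 (p D * tailLimit lam x)) := by
  obtain ⟨H, hH, hH0, hHC, hle1, hharm, hlim⟩ := exists_harmonic lam hm hac hx0 hx1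
  have hfl := ae_eventually_frequently_fluct lam hm hp hH hH0 hHC hharm
  filter_upwards [hfl, ae_tendsto_maxLen lam hm, ae_tendsto_average_smallCount lam]
    with D hfl hD hav
  obtain ⟨C, hC⟩ := exists_mul_maxLen_le lam hm hav
  set c := tailLimit lam x with hc
  -- At this time all lengths s are at most ε = `grid k ^ 2`, where H is explicit and s (s/ε)⁻¹ = ε.
  have hws : ∀ k, weightedSum p H (grid k ^ 2) D (tau D (grid k ^ 2)) =
      grid k ^ 2 * intervalSum D (tau D (grid k ^ 2))
        (fun q s => if q < p D ∧ x * grid k ^ 2 < s then 1 else 0) := by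
    intro k
    have hε := pow_pos (grid_pos k) 2
    rw [weightedSum, ← intervalSum_mul]
    refine intervalSum_congr D _ fun q s _ _ hs hsM => ?_
    have hs1 : s / grid k ^ 2 ≤ 1 := (div_le_one hε).2 (hsM.trans (maxLen_tau_le hD hε))
    by_cases hq : q < p D
    · rw [if_pos hq, hle1 _ (div_pos hs hε) hs1]
      simp only [hq, true_and, lt_div_iff₀ hε]
      split_ifs
      · field_simp
      · simp
    · simp [hq]
  simp only [← hws]
  rw [Metric.tendsto_atTop]
  intro e he
  have hCH : ∀ r, |H r - c| ≤ 1 / x + |c| := fun r => by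
    refine (abs_sub _ _).trans (add_le_add ?_ le_rfl)
    rw [abs_of_nonneg (hH0 r)]; exact hHC r
  obtain ⟨A, hA⟩ := eventually_atTop.1 (Metric.tendsto_nhds.1 hlim (e / 3) (by positivity))
  have hA' : ∀ r, max A 0 ≤ r → |H r - c| ≤ e / 3 := fun r hr =>
    (hA r ((le_max_left _ _).trans hr)).le
  -- The contribution of short intervals at time `tau D (grid k)` is of order `grid k ^ 2 * tau D
  -- (grid k)`, hence of order `grid k`, since `tau D (grid k) * grid k` is bounded.
  have hsmall : Tendsto (fun k => (1 / x + |c|) * max A 0 * (((C + 1) * m + 1) * grid k)) atTop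
      (𝓝 0) := by
    have := (tendsto_grid.const_mul ((C + 1) * m + 1)).const_mul ((1 / x + |c|) * max A 0)
    simpa using this
  have hev : ∀ᶠ k in atTop, |weightedSum p H (grid k ^ 2) D (tau D (grid k ^ 2)) - p D * c| < e := by
    filter_upwards [hfl (e / 3) (by positivity), hsmall.eventually (gt_mem_nhds (by positivity :
      0 < e / 3)), (tendsto_tau hD grid_pos tendsto_grid).eventually (eventually_ge_atTop k₀)]
      with k h1 h2 h3
    -- Beyond `tau D (grid k ^ 2)` the sum no longer depends on `N`, so one large `N` supplied by
    -- the frequently quantifier is enough.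
    obtain ⟨N, hN1, hN2⟩ := (h1.and_eventually (eventually_ge_atTop (tau D (grid k ^ 2)))).exists
    rw [sum_fluct hp hD (pow_pos (grid_pos k) 2) (grid_sq_le k) h3 hN2] at hN1
    have h4 := abs_weightedSum_sub_le (c := c) hp (D := D) h3 (pow_pos (grid_pos k) 2)
      (le_max_right A 0) (by positivity : 0 ≤ e / 3) hCH hA'
    have h5 := tau_mul_le hD hC (grid_pos k)
    have h6 : grid k ^ 2 * (tau D (grid k) * m + 1) ≤ ((C + 1) * m + 1) * grid k := by
      have hm0 : (0 : ℝ) ≤ m := Nat.cast_nonneg m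
      have hg0 := grid_pos k
      have hg1 := grid_le_one k
      have : (tau D (grid k) * grid k) * m ≤ (C + 1) * m :=
        mul_le_mul_of_nonneg_right (by linarith) hm0
      have h7 : (tau D (grid k) * grid k) * m + grid k ≤ (C + 1) * m + 1 := by linarith
      have := mul_le_mul_of_nonneg_right h7 hg0.le
      linarith
    have h7 : (1 / x + |c|) * max A 0 * grid k ^ 2 * (tau D (grid k) * m + 1) ≤
        (1 / x + |c|) * max A 0 * (((C + 1) * m + 1) * grid k) := by
      have : 0 ≤ (1 / x + |c|) * max A 0 := by positivity
      rw [mul_assoc]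
      exact mul_le_mul_of_nonneg_left h6 this
    have h8 := abs_sub_le (weightedSum p H (grid k ^ 2) D (tau D (grid k ^ 2)))
      (weightedSum p H (grid k ^ 2) D (tau D (grid k))) (p D * c)
    linarith
  exact eventually_atTop.1 hev

/-- The rescaled number of intervals to the left of a cut. -/
theorem ae_tendsto_count (hm : 0 < m)
    (hac : volume.restrict (Set.Ioo (0 : ℝ) 1) ≪ lengthMeasure lam) {k₀ : ℕ}
    {p : (ℕ → Divisions m) → ℝ} (hp : IsCut k₀ p) :
    ∀ᵐ D ∂(seqLaw lam), Tendsto (fun k => grid k ^ 2 * intervalSum D (tau D (grid k ^ 2))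
      (fun q _ => if q < p D then 1 else 0)) atTop (𝓝 (p D * countLimit lam)) := by
  have htail := ae_all_iff.2 fun j : ℕ =>
    ae_tendsto_tail lam hm hac (level_pos j) (level_lt_one j) hp
  filter_upwards [htail, ae_tendsto_maxLen lam hm, ae_tendsto_average_smallCount lam]
    with D htail hD hav
  obtain ⟨C, hC⟩ := exists_mul_maxLen_le lam hm hav
  have hC0 : 0 ≤ C := by simpa using hC 0
  have htau : Tendsto (fun k => tau D (grid k ^ 2)) atTop atTop :=
    tendsto_tau hD (fun k => pow_pos (grid_pos k) 2) tendsto_grid_sq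
  rw [Metric.tendsto_nhds]
  intro e he
  have hlev : Tendsto level atTop (𝓝[>] 0) :=
    tendsto_nhdsWithin_iff.2 ⟨tendsto_level, Eventually.of_forall level_pos⟩
  have h1 : Tendsto (fun j => p D * tailLimit lam (level j)) atTop (𝓝 (p D * countLimit lam)) :=
    ((tendsto_tailLimit lam).comp hlev).const_mul _
  have h2 : Tendsto (fun j => (C + 1) * meanSmall lam (level j)) atTop (𝓝 0) := by
    simpa using (tendsto_meanSmall lam tendsto_level).const_mul (C + 1)
  -- One truncation level must serve both purposes: the tail limit is close to the count limit, and
  -- the mean number of smaller pieces is negligible.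
  obtain ⟨j, hj1, hj2⟩ := ((Metric.tendsto_nhds.1 h1 (e / 3) (by positivity)).and
    (h2.eventually (gt_mem_nhds (by positivity : 0 < e / 3)))).exists
  have h3 : Tendsto (fun k => (C + 1) * ((∑ i ∈ Finset.range (tau D (grid k ^ 2)),
      smallCount (level j) (D i)) / (tau D (grid k ^ 2) : ℕ))) atTop
      (𝓝 ((C + 1) * meanSmall lam (level j))) := ((hav j).comp htau).const_mul _
  filter_upwards [Metric.tendsto_nhds.1 (htail j) (e / 3) (by positivity),
    h3.eventually (gt_mem_nhds hj2), htau.eventually (eventually_gt_atTop 0)] with k a1 a2 a3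
  have hε := pow_pos (grid_pos k) 2
  have hε1 : grid k ^ 2 ≤ 1 := (grid_sq_le k).trans (grid_le_one k)
  set n := tau D (grid k ^ 2) with hn
  have b1 := intervalSum_small_add_large D n (level j * grid k ^ 2) (p D)
  -- Every interval split so far was longer than `grid k ^ 2`, so each short interval arose as a
  -- piece of relative length at most `level j`.
  have b2 : intervalSum D n (fun q s => if q < p D ∧ s ≤ level j * grid k ^ 2 then 1 else 0) ≤
      ∑ i ∈ Finset.range n, smallCount (level j) (D i) := by
    refine le_trans (intervalSum_le D n fun q s _ _ _ _ => ?_) (intervalSum_small_le D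
      (z := level j * grid k ^ 2) (η := level j) ?_ n fun i hi => ?_)
    · by_cases hs : s ≤ level j * grid k ^ 2
      · simp only [hs, and_true, if_true]
        split_ifs <;> simp
      · simp [hs]
    · nlinarith [level_lt_one j, level_pos j]
    · exact mul_le_mul_of_nonneg_left ((lt_tau_iff hD hε).1 hi).le (level_pos j).le
  have b3 : 0 ≤ intervalSum D n
      (fun q s => if q < p D ∧ s ≤ level j * grid k ^ 2 then 1 else 0) :=
    Finset.sum_nonneg fun q _ => by dsimp only; split_ifs <;> simp
  have hn0 : (0 : ℝ) < n := by exact_mod_cast a3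
  have b4 : grid k ^ 2 * ∑ i ∈ Finset.range n, smallCount (level j) (D i) < e / 3 := by
    refine lt_of_le_of_lt ?_ a2
    have b5 := tau_mul_le hD hC hε
    rw [← hn] at b5
    have b6 : 0 ≤ (∑ i ∈ Finset.range n, smallCount (level j) (D i)) / n :=
      div_nonneg (Finset.sum_nonneg fun i _ => smallCount_nonneg _ _) hn0.le
    have b7 : grid k ^ 2 * ∑ i ∈ Finset.range n, smallCount (level j) (D i) =
        (n * grid k ^ 2) * ((∑ i ∈ Finset.range n, smallCount (level j) (D i)) / n) := by
      field_simp
    rw [b7]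
    exact mul_le_mul_of_nonneg_right (by linarith) b6
  have b8 := mul_le_mul_of_nonneg_left b2 hε.le
  have b9 := mul_nonneg hε.le b3
  rw [Real.dist_eq, abs_lt] at a1 hj1 ⊢
  rw [← b1, mul_add]
  constructor <;> linarith [a1.1, a1.2, hj1.1, hj1.2]

end Law

/-! ### Cuts at prescribed positions -/

/-- The left endpoint of the interval that contains `y` after `k₀` splittings. -/
def cutPoint (k₀ : ℕ) (y : ℝ) (D : ℕ → Divisions m) : ℝ :=
  sSup {q | q ∈ leftEnds (part D k₀) ∧ q ≤ y}

theorem isGreatest_cutPoint (k₀ : ℕ) {y : ℝ} (hy : 0 ≤ y) (D : ℕ → Divisions m) :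
    IsGreatest {q | q ∈ leftEnds (part D k₀) ∧ q ≤ y} (cutPoint k₀ y D) := by
  have hfin : {q | q ∈ leftEnds (part D k₀) ∧ q ≤ y}.Finite :=
    (leftEnds (part D k₀)).finite_toSet.subset fun q hq => hq.1
  have hne : {q | q ∈ leftEnds (part D k₀) ∧ q ≤ y}.Nonempty := ⟨0, zero_mem_leftEnds _, hy⟩
  exact ⟨hne.csSup_mem hfin, fun q hq => le_csSup hfin.bddAbove hq⟩

theorem isCut_cutPoint (k₀ : ℕ) {y : ℝ} (hy : 0 ≤ y) : IsCut (m := m) k₀ (cutPoint k₀ y) where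
  measurable := by
    refine measurable_of_Ioi fun c => ?_
    have : cutPoint (m := m) k₀ y ⁻¹' Set.Ioi c =
        {D | 0 < intervalSum D k₀ fun q _ => if c < q ∧ q ≤ y then 1 else 0} := by
      ext D
      obtain ⟨h1, h2⟩ := isGreatest_cutPoint k₀ hy D
      constructor
      · intro h
        refine lt_of_lt_of_le one_pos (le_trans (le_of_eq ?_) (Finset.single_le_sum
          (f := fun q => if c < q ∧ q ≤ y then (1 : ℝ) else 0) ?_ h1.1))
        · rw [if_pos ⟨h, h1.2⟩]
        · intro q _; split_ifs <;> simp
      · intro h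
        obtain ⟨q, hq, hpos⟩ := Finset.exists_lt_of_sum_lt (s := leftEnds (part D k₀))
          (f := fun _ => (0 : ℝ)) (g := fun q => if c < q ∧ q ≤ y then (1 : ℝ) else 0)
          (by simpa [intervalSum] using h)
        have : c < q ∧ q ≤ y := by
          by_contra hc
          rw [if_neg hc] at hpos
          exact lt_irrefl _ hpos
        exact this.1.trans_le (h2 ⟨hq, this.2⟩)
    rw [this]
    refine measurableSet_lt measurable_const
      (measurable_intervalSum k₀ (fun _ q _ => if c < q ∧ q ≤ y then 1 else 0) ?_)
    exact Measurable.ite ((measurableSet_lt measurable_const measurable_snd.fst).inter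
      (measurableSet_le measurable_snd.fst measurable_const)) measurable_const measurable_const
  update k hk D e := by rw [cutPoint, part_update D hk, cutPoint]
  mem D := Finset.mem_insert_of_mem (isGreatest_cutPoint k₀ hy D).1.1

theorem cutPoint_le (k₀ : ℕ) {y : ℝ} (hy : 0 ≤ y) (D : ℕ → Divisions m) : cutPoint k₀ y D ≤ y :=
  (isGreatest_cutPoint k₀ hy D).1.2

/-- The interval containing `y` is not longer than the largest one, so cuts approximate every
position as `k₀` grows. -/
theorem lt_cutPoint_add (k₀ : ℕ) {y : ℝ} (hy : 0 ≤ y) (hy1 : y < 1) (D : ℕ → Divisions m) :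
    y < cutPoint k₀ y D + maxLen D k₀ := by
  obtain ⟨h1, h2⟩ := isGreatest_cutPoint k₀ hy D
  have hlt : cutPoint k₀ y D < 1 := h1.2.trans_lt hy1
  have h3 : y < rightEnd (part D k₀) (cutPoint k₀ y D) := by
    by_contra hle
    have hmem := rightEnd_mem (part D k₀) hlt
    rcases Finset.mem_insert.1 hmem with h | h
    · exact hle (h ▸ hy1)
    · exact absurd (h2 ⟨Finset.mem_insert_of_mem h, not_lt.1 hle⟩)
        (not_le.2 (lt_rightEnd _ hlt))
  have h4 := spacing_le_maxSpacing (part D k₀) h1.1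
  rw [spacing] at h4
  have h5 : maxLen D k₀ = maxSpacing (part D k₀) := rfl
  linarith

/-! ### From thresholds to numbers of splittings -/

theorem grid_sq_antitone : Antitone fun k => grid k ^ 2 := by
  intro j k h
  have h1 : grid k ≤ grid j := by
    unfold grid
    have : (j : ℝ) ≤ k := by exact_mod_cast h
    gcongr
  exact pow_le_pow_left₀ (grid_pos k).le h1 2

/-- The ratio is (1 + 1/(k + 1))⁴; a polynomial grid is summable and still fine enough to
interpolate between thresholds. -/
theorem tendsto_grid_ratio : Tendsto (fun k => grid k ^ 2 / grid (k + 1) ^ 2) atTop (𝓝 1) := by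
  have h1 : Tendsto (fun k : ℕ => 1 + 1 / ((k : ℝ) + 1)) atTop (𝓝 (1 + 0)) :=
    tendsto_const_nhds.add tendsto_one_div_add_atTop_nhds_zero_nat
  have h2 := h1.pow 4
  rw [add_zero, one_pow] at h2
  refine h2.congr fun k => ?_
  unfold grid
  push_cast
  field_simp

/-- The numbers of splittings are located between the times belonging to grid thresholds. -/
theorem exists_grid_index {D : ℕ → Divisions m} (hD : Tendsto (maxLen D) atTop (𝓝 0)) :
    ∃ κ : ℕ → ℕ, Tendsto κ atTop atTop ∧
      ∀ n, grid (κ n + 1) ^ 2 < maxLen D n ∧ maxLen D n ≤ grid (κ n) ^ 2 := by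
  have hex : ∀ n, ∃ k, grid (k + 1) ^ 2 < maxLen D n := fun n =>
    (((tendsto_add_atTop_iff_nat 1).2 tendsto_grid_sq).eventually
      (gt_mem_nhds (maxLen_pos D n))).exists
  classical
  refine ⟨fun n => Nat.find (hex n), ?_, fun n => ⟨Nat.find_spec (hex n), ?_⟩⟩
  · refine tendsto_atTop.2 fun K => ?_
    filter_upwards [hD.eventually (ge_mem_nhds (pow_pos (grid_pos K) 2))] with n hn
    by_contra hlt
    have h1 := Nat.find_spec (hex n)
    have h2 : grid K ^ 2 ≤ grid (Nat.find (hex n) + 1) ^ 2 := grid_sq_antitone (by omega)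
    linarith
  -- At index 0 the upper bound is trivial, as `grid 0 = 1`; otherwise it is the minimality of the
  -- index.
  · rcases Nat.eq_zero_or_pos (Nat.find (hex n)) with h | h
    · simp only [h]
      simpa [grid] using maxLen_le_one D n
    · have h1 := Nat.find_min (hex n) (Nat.sub_lt h one_pos)
      have h2 : Nat.find (hex n) - 1 + 1 = Nat.find (hex n) := by omega
      rw [h2] at h1
      exact not_lt.1 h1

/-- Scaling the upper bound by the threshold with index `κ n` instead of `κ n + 1` costs a factor
tending to 1. -/
theorem tendsto_grid_squeeze {κ : ℕ → ℕ} (hκ : Tendsto κ atTop atTop) {A f : ℕ → ℝ} {L : ℝ}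
    (hA : Tendsto (fun k => grid k ^ 2 * A k) atTop (𝓝 L))
    (h1 : ∀ n, A (κ n) ≤ f n) (h2 : ∀ n, f n ≤ A (κ n + 1)) :
    Tendsto (fun n => grid (κ n) ^ 2 * f n) atTop (𝓝 L) := by
  have hup : Tendsto (fun k => grid k ^ 2 * A (k + 1)) atTop (𝓝 L) := by
    have := tendsto_grid_ratio.mul ((tendsto_add_atTop_iff_nat 1).2 hA)
    rw [one_mul] at this
    refine this.congr fun k => ?_
    have := (grid_pos (k + 1)).ne'
    field_simp
  refine tendsto_of_tendsto_of_tendsto_of_le_of_le (hA.comp hκ) (hup.comp hκ) (fun n => ?_)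
    fun n => ?_
  · exact mul_le_mul_of_nonneg_left (h1 n) (sq_nonneg _)
  · exact mul_le_mul_of_nonneg_left (h2 n) (sq_nonneg _)

/-- The number of left endpoints of intervals in a half-line increases with time. -/
theorem intervalSum_left_mono (D : ℕ → Divisions m) (p : ℝ) {n k : ℕ} (h : n ≤ k) :
    intervalSum D n (fun q _ => if q < p then 1 else 0) ≤
      intervalSum D k (fun q _ => if q < p then 1 else 0) :=
  Finset.sum_le_sum_of_subset_of_nonneg (leftEnds_part_mono D h)
    fun q _ _ => by dsimp only; split_ifs <;> simp

/-- The number of intervals that are too short to be split increases with time. -/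
theorem intervalSum_short_mono (D : ℕ → Divisions m) {w : ℝ} {n k : ℕ} (h : n ≤ k)
    (hw : ∀ j < k, w < maxLen D j) :
    intervalSum D n (fun _ s => if s ≤ w then 1 else 0) ≤
      intervalSum D k (fun _ s => if s ≤ w then 1 else 0) := by
  induction k, h using Nat.le_induction with
  | base => exact le_rfl
  | succ k hk ih =>
    refine (ih fun j hj => hw j (hj.trans (Nat.lt_succ_self k))).trans ?_
    rw [intervalSum_succ, if_neg (not_le.2 (hw k (Nat.lt_succ_self k))), sub_zero]
    exact le_add_of_nonneg_right (Finset.sum_nonneg fun i _ => by split_ifs <;> simp)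

section Paths

variable {D : ℕ → Divisions m} {K : ℝ}

/-- Both the number of intervals left of `p` and the total number increase with time, so each is
squeezed between its values at two neighbouring threshold times; the scaling cancels in the
quotient. -/
theorem tendsto_left_fraction (hD : Tendsto (maxLen D) atTop (𝓝 0)) (hK : 0 < K)
    (h1 : Tendsto (fun k => grid k ^ 2 * intervalSum D (tau D (grid k ^ 2)) fun _ _ => 1) atTop
      (𝓝 K)) {p : ℝ}
    (hp : Tendsto (fun k => grid k ^ 2 * intervalSum D (tau D (grid k ^ 2))
      fun q _ => if q < p then 1 else 0) atTop (𝓝 (p * K))) :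
    Tendsto (fun n : ℕ => intervalSum D n (fun q _ => if q < p then 1 else 0) / (n * m + 1)) atTop
      (𝓝 p) := by
  obtain ⟨κ, hκ, hκn⟩ := exists_grid_index hD
  have hlow : ∀ n, tau D (grid (κ n) ^ 2) ≤ n := fun n => not_lt.1 fun h =>
    absurd ((lt_tau_iff hD (pow_pos (grid_pos _) 2)).1 h) (not_lt.2 (hκn n).2)
  have hup : ∀ n, n ≤ tau D (grid (κ n + 1) ^ 2) := fun n =>
    ((lt_tau_iff hD (pow_pos (grid_pos _) 2)).2 (hκn n).1).le
  have a1 := tendsto_grid_squeeze hκ hp (fun n => intervalSum_left_mono D p (hlow n))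
    (fun n => intervalSum_left_mono D p (hup n))
  have hone : ∀ {n k : ℕ}, n ≤ k → intervalSum D n (fun _ _ => 1) ≤ intervalSum D k fun _ _ => 1 := by
    intro n k h
    rw [intervalSum_one, intervalSum_one]
    have : (n : ℝ) ≤ k := by exact_mod_cast h
    nlinarith [Nat.cast_nonneg (α := ℝ) m]
  have a2 := tendsto_grid_squeeze hκ h1 (fun n => hone (hlow n)) (fun n => hone (hup n))
  have a3 := a1.div a2 hK.ne'
  rw [mul_div_cancel_right₀ _ hK.ne'] at a3
  refine a3.congr fun n => ?_
  rw [Pi.div_apply, intervalSum_one, mul_div_mul_left _ _ (pow_pos (grid_pos _) 2).ne']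

/-- Here the bound `x * maxLen D n` moves with `n`. It is squeezed between rational multiples of
neighbouring thresholds, and continuity of `c` at `x` closes the gap. -/
theorem tendsto_spacing_fraction (hD : Tendsto (maxLen D) atTop (𝓝 0)) (hK : 0 < K)
    (h1 : Tendsto (fun k => grid k ^ 2 * intervalSum D (tau D (grid k ^ 2)) fun _ _ => 1) atTop
      (𝓝 K)) {c : ℝ → ℝ}
    (hc : ∀ z : ℚ, (z : ℝ) ∈ Set.Ioo (0 : ℝ) 1 → Tendsto (fun k => grid k ^ 2 *
      intervalSum D (tau D (grid k ^ 2)) fun _ s => if z * grid k ^ 2 < s then 1 else 0) atTop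
      (𝓝 (c z))) {x : ℝ} (hx : x ∈ Set.Ioo (0 : ℝ) 1) (hcont : ContinuousAt c x) :
    Tendsto (fun n : ℕ => intervalSum D n (fun _ s => if s ≤ x * maxLen D n then 1 else 0) /
      (n * m + 1)) atTop (𝓝 (1 - c x / K)) := by
  obtain ⟨κ, hκ, hκn⟩ := exists_grid_index hD
  have hlow : ∀ n, tau D (grid (κ n) ^ 2) ≤ n := fun n => not_lt.1 fun h =>
    absurd ((lt_tau_iff hD (pow_pos (grid_pos _) 2)).1 h) (not_lt.2 (hκn n).2)
  have hup : ∀ n, n ≤ tau D (grid (κ n + 1) ^ 2) := fun n =>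
    ((lt_tau_iff hD (pow_pos (grid_pos _) 2)).2 (hκn n).1).le
  have hone : ∀ {n k : ℕ}, n ≤ k → intervalSum D n (fun _ _ => 1) ≤ intervalSum D k fun _ _ => 1 := by
    intro n k h
    rw [intervalSum_one, intervalSum_one]
    have : (n : ℝ) ≤ k := by exact_mod_cast h
    nlinarith [Nat.cast_nonneg (α := ℝ) m]
  have a2 := tendsto_grid_squeeze hκ h1 (fun n => hone (hlow n)) (fun n => hone (hup n))
  -- short intervals at the threshold times
  set A : ℚ → ℕ → ℝ := fun z k => intervalSum D (tau D (grid k ^ 2))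
    fun _ s => if s ≤ z * grid k ^ 2 then 1 else 0 with hA
  have hAlim : ∀ z : ℚ, (z : ℝ) ∈ Set.Ioo (0 : ℝ) 1 →
      Tendsto (fun k => grid k ^ 2 * A z k) atTop (𝓝 (K - c z)) := by
    intro z hz
    refine (h1.sub (hc z hz)).congr fun k => ?_
    rw [← mul_sub, hA]
    congr 1
    rw [sub_eq_iff_eq_add, ← intervalSum_add]
    refine intervalSum_congr D _ fun q s _ _ _ _ => ?_
    by_cases hs : s ≤ z * grid k ^ 2
    · simp [hs, not_lt.2 hs]
    · simp [hs, not_le.1 hs]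
  set f : ℕ → ℝ := fun n => intervalSum D n (fun _ s => if s ≤ x * maxLen D n then 1 else 0)
    with hf
  have hind : ∀ (n : ℕ) {w w' : ℝ}, w ≤ w' → intervalSum D n (fun _ s => if s ≤ w then 1 else 0) ≤
      intervalSum D n (fun _ s => if s ≤ w' then 1 else 0) := by
    intro n w w' h
    refine intervalSum_le D n fun q s _ _ _ _ => ?_
    by_cases hs : s ≤ w
    · simp [hs, hs.trans h]
    · simp only [hs, if_false]; split_ifs <;> simp
  have hratio := tendsto_grid_ratio.comp hκ
  -- Since the ratio of thresholds tends to 1, eventually `z * grid (κ n) ^ 2` lies below `x *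
  -- maxLen D n`. Intervals this short are not split meanwhile, so their number can only grow.
  have hflow : ∀ z : ℚ, (z : ℝ) < x → ∀ᶠ n in atTop, A z (κ n) ≤ f n := by
    intro z hz
    have h2 := (hratio.const_mul (z : ℝ)).eventually (gt_mem_nhds (by rwa [mul_one]))
    filter_upwards [h2] with n hn
    have hg := pow_pos (grid_pos (κ n + 1)) 2
    have h3 : z * grid (κ n) ^ 2 < x * grid (κ n + 1) ^ 2 := by
      have h4 := mul_lt_mul_of_pos_right hn hg
      simp only [Function.comp] at h4
      rwa [mul_assoc, div_mul_cancel₀ _ hg.ne'] at h4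
    have h5 : x * grid (κ n + 1) ^ 2 < x * maxLen D n := mul_lt_mul_of_pos_left (hκn n).1 hx.1
    have h6 : x * maxLen D n ≤ maxLen D n := mul_le_of_le_one_left (maxLen_pos D n).le hx.2.le
    refine (intervalSum_short_mono D (hlow n) fun j hj => ?_).trans (hind n (h3.trans h5).le)
    exact ((h3.trans h5).trans_le h6).trans_le (maxLen_antitone D hj.le)
  have hfup : ∀ z : ℚ, x < z → ∀ᶠ n in atTop, f n ≤ A z (κ n + 1) := by
    intro z hz
    have h2 := (hratio.const_mul x).eventually (gt_mem_nhds (by rwa [mul_one] : x * 1 < z))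
    have h2' := (hratio.const_mul x).eventually (gt_mem_nhds (by rw [mul_one]; exact hx.2))
    filter_upwards [h2, h2'] with n hn hn'
    have hg := pow_pos (grid_pos (κ n + 1)) 2
    have h3 : x * grid (κ n) ^ 2 < z * grid (κ n + 1) ^ 2 := by
      have h4 := mul_lt_mul_of_pos_right hn hg
      simp only [Function.comp] at h4
      rwa [mul_assoc, div_mul_cancel₀ _ hg.ne'] at h4
    have h3' : x * grid (κ n) ^ 2 < grid (κ n + 1) ^ 2 := by
      have h4 := mul_lt_mul_of_pos_right hn' hg
      simp only [Function.comp] at h4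
      rwa [mul_assoc, div_mul_cancel₀ _ hg.ne', one_mul] at h4
    refine (hind n (mul_le_mul_of_nonneg_left (hκn n).2 hx.1.le)).trans
      ((intervalSum_short_mono D (hup n) fun j hj => ?_).trans (hind _ h3.le))
    exact h3'.trans ((lt_tau_iff hD hg).1 hj)
  have hfl : Tendsto (fun n => grid (κ n) ^ 2 * f n) atTop (𝓝 (K - c x)) := by
    rw [Metric.tendsto_nhds]
    intro e he
    obtain ⟨r, hr, hr'⟩ := Metric.eventually_nhds_iff.1 (Metric.tendsto_nhds.1 hcont (e / 2)
      (by positivity))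
    obtain ⟨z, hz1, hz2⟩ := exists_rat_btwn (max_lt hx.1 (sub_lt_self x hr))
    obtain ⟨z', hz1', hz2'⟩ := exists_rat_btwn (lt_min hx.2 (lt_add_of_pos_right x hr))
    rw [max_lt_iff] at hz1
    rw [lt_min_iff] at hz2'
    have b1 := hr' (y := (z : ℝ)) (by rw [Real.dist_eq, abs_lt]; constructor <;> linarith)
    have b2 := hr' (y := (z' : ℝ)) (by rw [Real.dist_eq, abs_lt]; constructor <;> linarith)
    rw [Real.dist_eq, abs_lt] at b1 b2
    have c1 := (hAlim z ⟨hz1.1, hz2.trans hx.2⟩).comp hκ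
    have c2 : Tendsto (fun k => grid k ^ 2 * A z' (k + 1)) atTop (𝓝 (K - c z')) := by
      have := tendsto_grid_ratio.mul
        ((tendsto_add_atTop_iff_nat 1).2 (hAlim z' ⟨hx.1.trans hz1', hz2'.1⟩))
      rw [one_mul] at this
      refine this.congr fun k => ?_
      have := (grid_pos (k + 1)).ne'
      field_simp
    have c3 := c2.comp hκ
    filter_upwards [hflow z hz2, hfup z' hz1', Metric.tendsto_nhds.1 c1 (e / 2) (by positivity),
      Metric.tendsto_nhds.1 c3 (e / 2) (by positivity)] with n d1 d2 d3 d4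
    simp only [Function.comp, Real.dist_eq, abs_lt] at d3 d4 ⊢
    have hg := sq_nonneg (grid (κ n))
    have d5 := mul_le_mul_of_nonneg_left d1 hg
    have d6 := mul_le_mul_of_nonneg_left d2 hg
    constructor <;> linarith [d3.1, d3.2, d4.1, d4.2, b1.1, b1.2, b2.1, b2.2]
  have a3 := hfl.div a2 hK.ne'
  rw [sub_div, div_self hK.ne'] at a3
  refine a3.congr fun n => ?_
  rw [Pi.div_apply, intervalSum_one, mul_div_mul_left _ _ (pow_pos (grid_pos _) 2).ne']

/-- Convergence of the fractions of intervals to the left of cuts carries over to all positions. -/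
theorem tendsto_le_fraction (hD : Tendsto (maxLen D) atTop (𝓝 0))
    (h : ∀ (k₀ : ℕ) (y : ℚ), (0 : ℝ) ≤ y → Tendsto (fun n : ℕ => intervalSum D n
      (fun q _ => if q < cutPoint k₀ y D then 1 else 0) / (n * m + 1)) atTop
      (𝓝 (cutPoint k₀ y D))) {y : ℝ} (hy : y ∈ Set.Ioo (0 : ℝ) 1) :
    Tendsto (fun n : ℕ => intervalSum D n (fun q _ => if q ≤ y then 1 else 0) / (n * m + 1)) atTop
      (𝓝 y) := by
  rw [Metric.tendsto_nhds]
  intro e he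
  -- With all lengths below `r`, the cut for `z` lies in (y - 2r, y) and the cut for `z'` in (y, y +
  -- 2r); the second bound on `r` keeps `z'` below 1.
  set r := min (e / 4) ((1 - y) / 4) with hr
  have hr0 : 0 < r := lt_min (by positivity) (by linarith [hy.2])
  have hr1 : r ≤ e / 4 := min_le_left _ _
  have hr2 : r ≤ (1 - y) / 4 := min_le_right _ _
  obtain ⟨k₀, hk₀⟩ := (hD.eventually (gt_mem_nhds hr0)).exists
  obtain ⟨z, hz1, hz2⟩ := exists_rat_btwn (max_lt hy.1 (sub_lt_self y hr0))
  obtain ⟨z', hz1', hz2'⟩ := exists_rat_btwn (by linarith : y + r < y + 2 * r)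
  rw [max_lt_iff] at hz1
  have hz'0 : (0 : ℝ) ≤ z' := by linarith [hy.1]
  have b1 := cutPoint_le k₀ hz1.1.le D
  have b2 := lt_cutPoint_add k₀ hz1.1.le (hz2.trans hy.2) D
  have b3 := cutPoint_le k₀ hz'0 D
  have b4 := lt_cutPoint_add k₀ hz'0 (by linarith) D
  filter_upwards [Metric.tendsto_nhds.1 (h k₀ z hz1.1.le) (e / 4) (by positivity),
    Metric.tendsto_nhds.1 (h k₀ z' hz'0) (e / 4) (by positivity)] with n d1 d2
  rw [Real.dist_eq, abs_lt] at d1 d2 ⊢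
  have hn : (0 : ℝ) < n * m + 1 := by positivity
  have e1 : intervalSum D n (fun q _ => if q < cutPoint k₀ z D then 1 else 0) ≤
      intervalSum D n (fun q _ => if q ≤ y then 1 else 0) := by
    refine intervalSum_le D n fun q s _ _ _ _ => ?_
    by_cases hq : q < cutPoint k₀ z D
    · simp [hq, show q ≤ y by linarith]
    · simp only [hq, if_false]; split_ifs <;> simp
  have e2 : intervalSum D n (fun q _ => if q ≤ y then 1 else 0) ≤
      intervalSum D n (fun q _ => if q < cutPoint k₀ z' D then 1 else 0) := by
    refine intervalSum_le D n fun q s _ _ _ _ => ?_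
    by_cases hq : q ≤ y
    · simp [hq, show q < cutPoint k₀ z' D by linarith]
    · simp only [hq, if_false]; split_ifs <;> simp
  have f1 := div_le_div_of_nonneg_right e1 hn.le
  have f2 := div_le_div_of_nonneg_right e2 hn.le
  constructor <;> linarith [d1.1, d1.2, d2.1, d2.2]

/-! ### The empirical distribution functions -/

/-- The left endpoint 0 belongs to an interval but is not a partition point, whence the correction
by 1. -/
theorem pointCDF_eq (D : ℕ → Divisions m) (n : ℕ) {y : ℝ} (hy : 0 ≤ y) :
    pointCDF (fun k => (D k).1) n y =
      (intervalSum D n (fun q _ => if q ≤ y then 1 else 0) - 1) / (n * m) := by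
  have h0 : (0 : ℝ) ∉ part D n := fun h => lt_irrefl _ (isPartition_part D n 0 h).1
  have h1 : intervalSum D n (fun q _ => if q ≤ y then 1 else 0) =
      1 + (((part D n).filter (fun p => p ≤ y)).card : ℝ) := by
    rw [intervalSum, leftEnds, Finset.sum_insert h0, if_pos hy, Finset.card_filter]
    push_cast
    rfl
  have h2 : ((part D n).card : ℝ) = n * m := by
    have h3 := intervalSum_one D n
    rw [intervalSum, leftEnds, Finset.sum_insert h0] at h3
    simp at h3
    linarith
  rw [h1, add_sub_cancel_left, ← h2]
  rfl

theorem spacingCDF_eq (D : ℕ → Divisions m) (n : ℕ) (x : ℝ) :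
    spacingCDF (fun k => (D k).1) n x =
      intervalSum D n (fun _ s => if s ≤ x * maxLen D n then 1 else 0) / (n * m + 1) := by
  rw [← intervalSum_one D n, intervalSum, intervalSum, spacingCDF, Finset.card_filter]
  push_cast
  simp only [Finset.sum_const, nsmul_eq_mul, mul_one]
  rfl

theorem measurable_pointCDF (n : ℕ) {y : ℝ} (hy : 0 ≤ y) :
    Measurable fun D : ℕ → Divisions m => pointCDF (fun k => (D k).1) n y := by
  simp only [pointCDF_eq _ n hy]
  refine ((measurable_intervalSum n (fun _ q _ => if q ≤ y then 1 else 0) ?_).sub_const 1).div_const _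
  exact Measurable.ite (measurableSet_le measurable_snd.fst measurable_const)
    measurable_const measurable_const

theorem measurable_spacingCDF (n : ℕ) (x : ℝ) :
    Measurable fun D : ℕ → Divisions m => spacingCDF (fun k => (D k).1) n x := by
  simp only [spacingCDF_eq]
  refine (measurable_intervalSum n (fun D _ s => if s ≤ x * maxLen D n then 1 else 0) ?_).div_const _
  exact Measurable.ite (measurableSet_le measurable_snd.snd
    (((measurable_maxLen n).comp measurable_fst).const_mul x)) measurable_const measurable_const

theorem tendsto_pointCDF (hm : 0 < m) {y : ℝ} (hy : 0 ≤ y)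
    (h : Tendsto (fun n : ℕ => intervalSum D n (fun q _ => if q ≤ y then 1 else 0) / (n * m + 1))
      atTop (𝓝 y)) :
    Tendsto (fun n => pointCDF (fun k => (D k).1) n y) atTop (𝓝 y) := by
  have hm' : (0 : ℝ) < m := by exact_mod_cast hm
  have h1 : Tendsto (fun n : ℕ => ((n : ℝ) * m)⁻¹) atTop (𝓝 0) :=
    tendsto_inv_atTop_zero.comp (tendsto_natCast_atTop_atTop.atTop_mul_const hm')
  have h2 : Tendsto (fun n : ℕ => intervalSum D n (fun q _ => if q ≤ y then 1 else 0) /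
      (n * m + 1) * (1 + ((n : ℝ) * m)⁻¹) - ((n : ℝ) * m)⁻¹) atTop (𝓝 (y * (1 + 0) - 0)) :=
    (h.mul (h1.const_add 1)).sub h1
  rw [add_zero, mul_one, sub_zero] at h2
  refine h2.congr' ?_
  filter_upwards [eventually_gt_atTop 0] with n hn
  have hn' : (0 : ℝ) < n := by exact_mod_cast hn
  rw [pointCDF_eq D n hy]
  field_simp

end Paths

/-- The two limit theorems for independent families of division points. -/
theorem ae_tendsto_pointCDF_spacingCDF (lam : Measure (Divisions m)) [IsProbabilityMeasure lam]
    (hm : 0 < m) (hac : volume.restrict (Set.Ioo (0 : ℝ) 1) ≪ lengthMeasure lam) :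
    ∀ᵐ D ∂(seqLaw lam),
      (∀ y ∈ Set.Ioo (0 : ℝ) 1, Tendsto (fun n => pointCDF (fun k => (D k).1) n y) atTop (𝓝 y)) ∧
      ∀ x ∈ Set.Ioo (0 : ℝ) 1, Tendsto (fun n => spacingCDF (fun k => (D k).1) n x) atTop
        (𝓝 (1 - tailLimit lam x / countLimit lam)) := by
  -- Countably many cuts and rational levels suffice, so there is one exceptional null set; all
  -- other positions and levels follow by monotonicity and continuity.
  have hcount : ∀ᵐ D ∂(seqLaw lam), ∀ (k₀ : ℕ) (y : ℚ), (0 : ℝ) ≤ y →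
      Tendsto (fun k => grid k ^ 2 * intervalSum D (tau D (grid k ^ 2))
        (fun q _ => if q < cutPoint k₀ y D then 1 else 0)) atTop
        (𝓝 (cutPoint k₀ y D * countLimit lam)) := by
    refine ae_all_iff.2 fun k₀ => ae_all_iff.2 fun y => ?_
    by_cases hy : (0 : ℝ) ≤ y
    · filter_upwards [ae_tendsto_count lam hm hac (isCut_cutPoint k₀ hy)] with D h _ using h
    · exact ae_of_all _ fun D h => absurd h hy
  have htail : ∀ᵐ D ∂(seqLaw lam), ∀ z : ℚ, (z : ℝ) ∈ Set.Ioo (0 : ℝ) 1 →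
      Tendsto (fun k => grid k ^ 2 * intervalSum D (tau D (grid k ^ 2))
        (fun _ s => if z * grid k ^ 2 < s then 1 else 0)) atTop (𝓝 (tailLimit lam z)) := by
    refine ae_all_iff.2 fun z => ?_
    by_cases hz : (z : ℝ) ∈ Set.Ioo (0 : ℝ) 1
    · filter_upwards [ae_tendsto_tail lam hm hac hz.1 hz.2 isCut_one] with D h _
      rw [one_mul] at h
      refine h.congr fun k => ?_
      congr 1
      exact intervalSum_congr D _ fun q s _ hq _ _ => by simp [hq]
    · exact ae_of_all _ fun D h => absurd h hz
  filter_upwards [ae_tendsto_maxLen lam hm, hcount, htail, ae_tendsto_count lam hm hac isCut_one]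
    with D hD hcount htail hone
  have hK := countLimit_pos lam hm
  have h1 : Tendsto (fun k => grid k ^ 2 * intervalSum D (tau D (grid k ^ 2)) fun _ _ => 1) atTop
      (𝓝 (countLimit lam)) := by
    rw [one_mul] at hone
    refine hone.congr fun k => ?_
    congr 1
    exact intervalSum_congr D _ fun q s _ hq _ _ => by simp [hq]
  refine ⟨fun y hy => ?_, fun x hx => ?_⟩
  · exact tendsto_pointCDF hm hy.1.le (tendsto_le_fraction hD
      (fun k₀ z hz => tendsto_left_fraction hD hK h1 (hcount k₀ z hz)) hy)
  · simp only [spacingCDF_eq]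
    exact tendsto_spacing_fraction hD hK h1 htail hx (continuousAt_tailLimit lam hx.1)

/-! ### Passage to the law of the division points -/

/-- Off a null set all families consist of distinct points of (0, 1). Replacing the other families
by a fixed good one gives independent variables in `Divisions (b - 1)` with a common law, and the
joint law is the product measure; F is unaffected by the change. -/
theorem IsSequentialFragmentation.exists_divisions {Ω : Type*} [MeasurableSpace Ω] {μ : Measure Ω}
    [IsProbabilityMeasure μ] {b : ℕ} {D : ℕ → Ω → Fin (b - 1) → ℝ}
    (hD : IsSequentialFragmentation μ b D) :
    ∃ (lam : Measure (Divisions (b - 1))) (X : Ω → ℕ → Divisions (b - 1)),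
      IsProbabilityMeasure lam ∧ Measurable X ∧ μ.map X = seqLaw lam ∧
      (∀ᵐ ω ∂μ, ∀ k, (X ω k).1 = D k ω) ∧
      volume.restrict (Set.Ioo (0 : ℝ) 1) ≪ lengthMeasure lam := by
  let Good : (Fin (b - 1) → ℝ) → Prop := fun d =>
    (∀ j, d j ∈ Set.Ioo (0 : ℝ) 1) ∧ Function.Injective d
  have hGoodm : MeasurableSet {d | Good d} := by
    have h1 : {d : Fin (b - 1) → ℝ | Good d} = (⋂ j, {d | d j ∈ Set.Ioo (0 : ℝ) 1}) ∩
        ⋂ i, ⋂ j, ⋂ _ : i ≠ j, {d | d i = d j}ᶜ := by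
      ext d
      simp only [Good, Set.mem_inter_iff, Set.mem_iInter, Set.mem_compl_iff, Function.Injective]
      refine and_congr Iff.rfl ⟨fun h i j hij he => hij (h he), fun h i j he => ?_⟩
      by_contra hij
      exact h i j hij he
    rw [h1]
    refine (MeasurableSet.iInter fun j => measurable_pi_apply j measurableSet_Ioo).inter
      (MeasurableSet.iInter fun i => MeasurableSet.iInter fun j => MeasurableSet.iInter fun _ =>
        (measurableSet_eq_fun (measurable_pi_apply i) (measurable_pi_apply j)).compl)
  have hgood0 : ∀ᵐ ω ∂μ, Good (D 0 ω) := by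
    filter_upwards [hD.mem_Ioo, hD.injective] with ω h1 h2 using ⟨h1, h2⟩
  have hgood : ∀ᵐ ω ∂μ, ∀ k, Good (D k ω) :=
    ae_all_iff.2 fun k => (hD.identDistrib k).symm.ae_snd hGoodm hgood0
  obtain ⟨ω₀, hω₀⟩ := hgood0.exists
  classical
  let g : (Fin (b - 1) → ℝ) → Divisions (b - 1) := fun d => ⟨if Good d then d else D 0 ω₀, by
    split_ifs with h
    · exact h
    · exact hω₀⟩
  have hg : Measurable g :=
    (Measurable.ite hGoodm measurable_id measurable_const).subtype_mk
  have hgD : ∀ d, Good d → (g d).1 = d := fun d hd => if_pos hd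
  let Y : ℕ → Ω → Divisions (b - 1) := fun k ω => g (D k ω)
  have hY : ∀ k, Measurable (Y k) := fun k => hg.comp (hD.measurable k)
  have hYlaw : ∀ k, μ.map (Y k) = μ.map (Y 0) := fun k =>
    ((hD.identDistrib k).comp hg).map_eq
  have hYind : iIndepFun Y μ := hD.indep.comp (fun _ => g) fun _ => hg
  have hprob : IsProbabilityMeasure (μ.map (Y 0)) :=
    Measure.isProbabilityMeasure_map (hY 0).aemeasurable
  refine ⟨μ.map (Y 0), fun ω k => Y k ω, hprob, measurable_pi_lambda _ hY, ?_, ?_, ?_⟩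
  · rw [hYind.map_fun_eq_infinitePi_map hY]
    simp only [hYlaw]
  · filter_upwards [hgood] with ω hω k using hgD _ (hω k)
  · have hF : expectedCount μ (D 0) =
        fun x => ∫ d, (spacingCount d.1 x : ℝ) ∂(μ.map (Y 0)) := by
      funext x
      rw [integral_map (hY 0).aemeasurable]
      · refine integral_congr_ae ?_
        filter_upwards [hgood] with ω hω
        simp only [Y, hgD _ (hω 0)]
      · simp only [spacingCount_eq]
        exact (Finset.measurable_sum _ fun i _ => Measurable.ite
          (measurableSet_lt (measurable_pieceLen i) measurable_const)
          measurable_const measurable_const).aestronglyMeasurable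
    exact lengthMeasure_absolutelyContinuous _ (hF ▸ hD.differentiableOn) (hF ▸ hD.deriv_pos)

end Fragmentation

end

/-! ### The equivalences: all four convergence statements hold -/

theorem mainTheorem5 {Ω : Type*} [MeasurableSpace Ω] (μ : MeasureTheory.Measure Ω)
    [MeasureTheory.IsProbabilityMeasure μ] (b : ℕ) (D : ℕ → Ω → Fin (b - 1) → ℝ)
    (hD : Fragmentation.IsSequentialFragmentation μ b D) :
    (Fragmentation.UniformPointsAS μ D ↔ Fragmentation.StationarySpacingsAS μ D) ∧
    (Fragmentation.UniformPointsInProb μ D ↔ Fragmentation.StationarySpacingsInProb μ D) := by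
  obtain ⟨lam, X, hlam, hX, hmap, hXD, hac⟩ := hD.exists_divisions
  have hm : 0 < b - 1 := by have := hD.two_le; omega
  have hlim := Fragmentation.ae_tendsto_pointCDF_spacingCDF lam hm hac
  rw [← hmap] at hlim
  have hlim' := ae_of_ae_map hX.aemeasurable hlim
  have hseq : ∀ᵐ ω ∂μ, (fun k => (X ω k).1) = fun k => D k ω :=
    hXD.mono fun ω hω => funext hω
  have hP : Fragmentation.UniformPointsAS μ D := by
    filter_upwards [hlim', hseq] with ω h1 h2
    rw [h2] at h1
    exact h1.1
  have hS : ∀ᵐ ω ∂μ, ∀ x ∈ Set.Ioo (0 : ℝ) 1,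
      Tendsto (fun n => Fragmentation.spacingCDF (fun k => D k ω) n x) atTop
        (𝓝 (1 - Fragmentation.tailLimit lam x / Fragmentation.countLimit lam)) := by
    filter_upwards [hlim', hseq] with ω h1 h2
    rw [h2] at h1
    exact h1.2
  have hPprob : Fragmentation.UniformPointsInProb μ D := by
    intro y hy
    refine tendstoInMeasure_of_tendsto_ae (fun n => ?_) (hP.mono fun ω h => h y hy)
    refine ((Fragmentation.measurable_pointCDF n hy.1.le).comp hX).aestronglyMeasurable.congr ?_
    filter_upwards [hseq] with ω h
    simp only [Function.comp, h]
  have hSprob : Fragmentation.StationarySpacingsInProb μ D := by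
    refine ⟨_, fun x hx => tendstoInMeasure_of_tendsto_ae (fun n => ?_)
      (hS.mono fun ω h => h x hx)⟩
    refine ((Fragmentation.measurable_spacingCDF n x).comp hX).aestronglyMeasurable.congr ?_
    filter_upwards [hseq] with ω h
    simp only [Function.comp, h]
  exact ⟨iff_of_true hP ⟨_, hS⟩, iff_of_true hPprob hSprob⟩
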